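/- Let $L>0$, let $f:\mathbb R\to\mathbb R$ be smooth, and let $\mathcal M$ be the Fourier multiplier $\widehat{\mathcal M g}(n)=\theta(n)\widehat g(n)$, $n\in\mathbb Z$, on $L$-periodic functions, where $\theta:\mathbb R\to\mathbb R$ is even and continuous and, for some $m>0$, $\kappa_0\in\mathbb R$ and $\upsilon_1,\upsilon_2>0$, $\upsilon_1|\kappa|^m\le\theta(\kappa)\le\upsilon_2|\kappa|^m$ for all $|\kappa|\ge\kappa_0$. All functions are real-valued; $(u,v)=\int_0^L uv\,dx$, $\|u\|^2=(u,u)$, and $H^s_{per}=H^s_{per}([0,L])$ has the norm $\|u\|_s^2=L\sum_{n\in\mathbb Z}(1+n^2)^s|\widehat u(n)|^2$. Consider $$u_t+(f(u))_x-(\mathcal M u)_x=0. \tag{1}$$ If $m\le 1$, assume in addition that $u\mapsto\int_0^L W(u)\,dx$, $W(y)=\int_0^y f$, is finite and of class $C^2$ on $H^{m/2}_{per}$. A solution of (1) in $H^s_{per}$ is a function $u\in C([0,\infty);H^s_{per})$ with $f(u)\in L^1_{loc}$ such that $\widehat u(t,n)=\widehat u(0,n)+\int_0^t\frac{2\pi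 i n}{L}\big(\theta(n)\widehat u(\tau,n)-\widehat{f(u(\tau))}(n)\big)d\tau$ for all $n\in\mathbb Z$, $t\ge0$. Equation (1) is called globally well-posed in $H^s_{per}$ if every $u_0\in H^s_{per}$ is the initial value of exactly one such solution, the solution depends continuously on $u_0$ in $C([0,T];H^s_{per})$ for every $T>0$, and smooth initial data give solutions in $C([0,\infty);H^r_{per})$ for every $r\ge s$. Let $\omega,A\in\mathbb R$ and let $\phi\in C^\infty_{per}([0,L])$ satisfy $\mathcal M\phi+\omega\phi-f(\phi)+A=0$, so that $\phi(x-\omega t)$ is a traveling wave solution of (1). Let $\mathcal L=\mathcal M+\omega-f'(\phi)$, considered on $L^2_{per}([0,L])$ with domain $H^m_{per}$. Let $(\mu,\nu)\in\mathbb R^2\setminus\{(0,0)\}$ and $Q(u)=\mu\int_0^L u\,dx+\frac{\nu}{2}\int_0^L u^2\,dx$, so that $Q'(\phi)=\mu+\nu\phi$. Assume: - $(H_0)$ $\mathcal L$ has exactly one negative eigenvalue, which is simple, and $0$ is a simple eigenvalue with eigenfunction $\phi'$. - $(H_1)$ There are $c_1,c_2>0$ with $(\mathcal L v,v)\ge c_1\|v\|_{m/2}^2-c_2\|v\|^2$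 for all $v\in C^\infty_{per}([0,L])$. - $(H_2)$ There is $c_3>0$ with $(\mathcal L v,v)\ge c_3\|v\|^2$ for all $v\in H^m_{per}$ satisfying $(v,\phi')=(v,Q'(\phi))=0$. Assume that (1) is globally well-posed in $H^s_{per}$ for some $s\ge m/2$. Then $\phi$ is orbitally stable in $H^{m/2}_{per}$: for every $\varepsilon>0$ there is $\delta>0$ such that, whenever $s\ge m/2$ is such that (1) is globally well-posed in $H^s_{per}$ and $u_0\in H^s_{per}$ satisfies $\|u_0-\phi\|_{m/2}<\delta$, the solution $u(t)$ of (1) with $u(0)=u_0$ exists for all $t\ge0$ and $$\inf_{r\in\mathbb R}\|u(t)-\phi(\cdot+r)\|_{m/2}<\varepsilon\qquad\text{for all }t\ge0.$$ -/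

import Mathlib

open MeasureTheory Set Filter Topology
open scoped ContDiff ENNReal

noncomputable section

namespace PerWave

/-- Real-valued square integrable functions on the circle of length `L`.  (The reference measure
used for a.e. equivalence is the normalised one; integrals over a period are written with the
Lebesgue measure `volume`, of total mass `L`.) -/
abbrev L2per (L : ℝ) [Fact (0 < L)] : Type :=
  Lp ℝ 2 (AddCircle.haarAddCircle (T := L))

section Coefficients

variable {L : ℝ} [Fact (0 < L)]

/-- The Fourier coefficient `ĝ(n) = (1/L) ∫₀ᴸ g(x) exp(-2πinx/L) dx` of a real function on the
circle. -/
def fcFun (g : AddCircle L → ℝ) (n : ℤ) : ℂ :=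
  fourierCoeff (fun x => ((g x : ℝ) : ℂ)) n

/-- The Fourier coefficients of an element of `L²`. -/
def fc (u : L2per L) (n : ℤ) : ℂ := fcFun (fun x => u x) n

/-- The inner product `(u, v) = ∫₀ᴸ u v dx`. -/
def pair (u v : L2per L) : ℝ := ∫ x : AddCircle L, u x * v x

/-- Complexification of a real `L²` function. -/
def toC (u : L2per L) : Lp ℂ 2 (AddCircle.haarAddCircle (T := L)) :=
  Complex.ofRealCLM.compLpL 2 AddCircle.haarAddCircle u

theorem toC_ae (u : L2per L) :
    toC u =ᵐ[AddCircle.haarAddCircle] fun x => ((u x : ℝ) : ℂ) :=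
  ContinuousLinearMap.coeFn_compLpL Complex.ofRealCLM u

theorem fc_eq_repr (u : L2per L) (n : ℤ) : fc u n = fourierBasis.repr (toC u) n := by
  rw [fourierBasis_repr]
  exact (congrFun (fourierCoeff_congr_ae (toC_ae u)) n).symm

theorem fc_add (u v : L2per L) (n : ℤ) : fc (u + v) n = fc u n + fc v n := by
  simp [fc_eq_repr, toC, map_add]

theorem toC_smul (c : ℝ) (u : L2per L) : toC (c • u) = (c : ℂ) • toC u := by
  ext1
  filter_upwards [toC_ae (c • u), toC_ae u, Lp.coeFn_smul c u,
    Lp.coeFn_smul (c : ℂ) (toC u)] with x h1 h2 h3 h4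
  rw [h1, h3, h4]
  simp [h2]

theorem fc_smul (c : ℝ) (u : L2per L) (n : ℤ) : fc (c • u) n = (c : ℂ) * fc u n := by
  rw [fc_eq_repr, fc_eq_repr, toC_smul, map_smul]
  rfl

theorem fc_zero (n : ℤ) : fc (0 : L2per L) n = 0 := by
  simp [fc_eq_repr, toC]

theorem eq_zero_of_fc {u : L2per L} (h : ∀ n, fc u n = 0) : u = 0 := by
  have h1 : toC u = 0 := by
    apply fourierBasis.repr.injective
    ext n
    rw [← fc_eq_repr, h n]
    simp
  ext1
  have h2 := toC_ae u
  rw [h1] at h2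
  filter_upwards [h2, Lp.coeFn_zero ℂ 2 (AddCircle.haarAddCircle (T := L)),
    Lp.coeFn_zero ℝ 2 (AddCircle.haarAddCircle (T := L))] with x hx h0 h0'
  rw [h0] at hx
  rw [h0']
  have : ((u x : ℝ) : ℂ) = 0 := by simpa using hx.symm
  simpa using this

theorem summable_fc_sq (u : L2per L) : Summable fun n => ‖fc u n‖ ^ 2 := by
  simp_rw [fc_eq_repr]
  exact_mod_cast (lp.hasSum_norm (by norm_num) (fourierBasis.repr (toC u))).summable

theorem fc_neg (u : L2per L) (n : ℤ) : fc u (-n) = (starRingEnd ℂ) (fc u n) := by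
  unfold fc fcFun fourierCoeff
  rw [← integral_conj]
  refine integral_congr_ae (Eventually.of_forall fun x => ?_)
  simp only [smul_eq_mul, map_mul, Complex.conj_ofReal, neg_neg]
  rw [fourier_neg]
  simp

end Coefficients

/-! ### The periodic Sobolev spaces -/

/-- `1 + n²`. -/
def wt (n : ℤ) : ℝ := 1 + (n : ℝ) ^ 2

theorem one_le_wt (n : ℤ) : 1 ≤ wt n := by unfold wt; nlinarith [sq_nonneg (n : ℝ)]

theorem wt_pos (n : ℤ) : 0 < wt n := lt_of_lt_of_le one_pos (one_le_wt n)

section Sobolev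

variable {L : ℝ} [Fact (0 < L)]

/-- The weighted sequence `√L (1 + n²)^{s/2} û(n)`. -/
def wseq (s : ℝ) (u : L2per L) (n : ℤ) : ℂ := ((√L * wt n ^ (s / 2) : ℝ) : ℂ) * fc u n

theorem norm_wseq_sq (s : ℝ) (u : L2per L) (n : ℤ) :
    ‖wseq s u n‖ ^ 2 = L * (wt n ^ s * ‖fc u n‖ ^ 2) := by
  have hL : (0 : ℝ) ≤ L := (Fact.out : 0 < L).le
  have h1 : (wt n ^ (s / 2)) ^ 2 = wt n ^ s := by
    rw [← Real.rpow_natCast, ← Real.rpow_mul (wt_pos n).le]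
    norm_num
  rw [wseq, norm_mul, Complex.norm_real, mul_pow, Real.norm_eq_abs, sq_abs, mul_pow, h1,
    Real.sq_sqrt hL, mul_assoc]

theorem memlp_wseq_iff (s : ℝ) (u : L2per L) :
    Memℓp (wseq s u) 2 ↔ Summable fun n : ℤ => wt n ^ s * ‖fc u n‖ ^ 2 := by
  have hL : L ≠ 0 := (Fact.out : 0 < L).ne'
  rw [memℓp_gen_iff (by norm_num)]
  have : (fun n => ‖wseq s u n‖ ^ (2 : ℝ≥0∞).toReal)
      = fun n => L * (wt n ^ s * ‖fc u n‖ ^ 2) := by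
    funext n
    rw [← norm_wseq_sq]
    norm_num
  rw [this, summable_mul_left_iff hL]

theorem wseq_add (s : ℝ) (u v : L2per L) : wseq s (u + v) = wseq s u + wseq s v := by
  funext n
  simp [wseq, fc_add, mul_add]

theorem wseq_smul (s c : ℝ) (u : L2per L) : wseq s (c • u) = c • wseq s u := by
  funext n
  simp [wseq, fc_smul]
  ring

variable (L) in
/-- `{u ∈ L² : ∑ₙ (1 + n²)^s |û(n)|² < ∞}`. -/
def sobolev (s : ℝ) : Submodule ℝ (L2per L) where
  carrier := {u | Summable fun n : ℤ => wt n ^ s * ‖fc u n‖ ^ 2}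
  zero_mem' := by simp [fc_zero, summable_zero]
  add_mem' := by
    intro u v hu hv
    rw [mem_ofPred_eq, ← memlp_wseq_iff] at *
    rw [wseq_add]
    exact hu.add hv
  smul_mem' := by
    intro c u hu
    rw [mem_ofPred_eq, ← memlp_wseq_iff] at *
    rw [wseq_smul]
    exact hu.const_smul c

variable (L) in
/-- The real periodic Sobolev space `H^s_per([0, L])`, `s ≥ 0`, which carries the norm
`‖u‖_s = (L ∑ₙ (1 + n²)^s |û(n)|²)^{1/2}` defined below. -/
def HPer (s : ℝ) : Type := sobolev L s

instance (s : ℝ) : AddCommGroup (HPer L s) := inferInstanceAs (AddCommGroup (sobolev L s))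

instance (s : ℝ) : Module ℝ (HPer L s) := inferInstanceAs (Module ℝ (sobolev L s))

/-- The underlying `L²` function. -/
def HPer.toL2 {s : ℝ} : HPer L s →ₗ[ℝ] L2per L := (sobolev L s).subtype

theorem HPer.summable {s : ℝ} (u : HPer L s) :
    Summable fun n : ℤ => wt n ^ s * ‖fc u.toL2 n‖ ^ 2 := Subtype.property u

theorem HPer.ext_toL2 {s : ℝ} {u v : HPer L s} (h : u.toL2 = v.toL2) : u = v := Subtype.ext h

/-- An element of `L²` with summable weighted coefficients, as an element of `H^s`. -/
def HPer.mk {s : ℝ} (u : L2per L) (hu : Summable fun n : ℤ => wt n ^ s * ‖fc u n‖ ^ 2) :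
    HPer L s := ⟨u, hu⟩

theorem HPer.toL2_mk {s : ℝ} (u : L2per L)
    (hu : Summable fun n : ℤ => wt n ^ s * ‖fc u n‖ ^ 2) : (HPer.mk u hu).toL2 = u := rfl

/-- The isometry of `H^s` into `ℓ²(ℤ)` given by `u ↦ (√L (1 + n²)^{s/2} û(n))ₙ`. -/
def HPer.toSeq (s : ℝ) : HPer L s →ₗ[ℝ] lp (fun _ : ℤ => ℂ) 2 where
  toFun u := ⟨wseq s u.toL2, (memlp_wseq_iff s u.toL2).2 u.summable⟩
  map_add' u v := by
    apply Subtype.ext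
    simp only [map_add, wseq_add]
    rfl
  map_smul' c u := by
    apply Subtype.ext
    simp only [map_smul, wseq_smul]
    rfl

theorem HPer.toSeq_injective (s : ℝ) : Function.Injective (HPer.toSeq (L := L) s) := by
  rw [← LinearMap.ker_eq_bot, LinearMap.ker_eq_bot']
  intro u hu
  apply HPer.ext_toL2
  rw [map_zero]
  apply eq_zero_of_fc
  intro n
  have h1 : wseq s u.toL2 n = 0 := by
    exact congrArg (fun a : lp (fun _ : ℤ => ℂ) 2 => (a : ℤ → ℂ) n) hu
  have h2 : (0 : ℝ) < √L * wt n ^ (s / 2) :=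
    mul_pos (Real.sqrt_pos.2 Fact.out) (Real.rpow_pos_of_pos (wt_pos n) _)
  have h3 : ((√L * wt n ^ (s / 2) : ℝ) : ℂ) ≠ 0 := by exact_mod_cast h2.ne'
  exact (mul_eq_zero.1 h1).resolve_left h3

instance (s : ℝ) : NormedAddCommGroup (HPer L s) :=
  NormedAddCommGroup.induced (HPer L s) (lp (fun _ : ℤ => ℂ) 2) (HPer.toSeq s)
    (HPer.toSeq_injective s)

instance (s : ℝ) : NormedSpace ℝ (HPer L s) :=
  NormedSpace.induced ℝ (HPer L s) (lp (fun _ : ℤ => ℂ) 2) (HPer.toSeq s)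

/-- The norm of `H^s`. -/
theorem HPer.norm_sq {s : ℝ} (u : HPer L s) :
    ‖u‖ ^ 2 = L * ∑' n : ℤ, wt n ^ s * ‖fc u.toL2 n‖ ^ 2 := by
  have h1 : ‖u‖ = ‖HPer.toSeq s u‖ := rfl
  have h2 := lp.norm_rpow_eq_tsum (p := 2) (by norm_num) (HPer.toSeq s u)
  have h3 : ∀ n, ‖HPer.toSeq s u n‖ ^ 2 = L * (wt n ^ s * ‖fc u.toL2 n‖ ^ 2) :=
    fun n => norm_wseq_sq s u.toL2 n
  have h4 : ‖HPer.toSeq s u‖ ^ 2 = ∑' n, ‖HPer.toSeq s u n‖ ^ 2 := by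
    simpa using h2
  rw [h1, h4, ← tsum_mul_left]
  exact tsum_congr h3

/-- The inclusion `H^s ⊆ H^r` for `r ≤ s`. -/
def HPer.incl {r s : ℝ} (h : r ≤ s) (u : HPer L s) : HPer L r :=
  HPer.mk u.toL2 <| by
    refine Summable.of_nonneg_of_le
      (fun n => mul_nonneg (Real.rpow_nonneg (wt_pos n).le _) (sq_nonneg _)) (fun n => ?_)
      u.summable
    exact mul_le_mul_of_nonneg_right (Real.rpow_le_rpow_of_exponent_le (one_le_wt n) h)
      (sq_nonneg _)

end Sobolev

/-! ### Smooth periodic functions -/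

/-- `C^∞_per([0, L])`: smooth real functions on the line of period `L`. -/
structure SmoothPer (L : ℝ) where
  toFun : ℝ → ℝ
  smooth : ContDiff ℝ ∞ toFun
  periodic : Function.Periodic toFun L

namespace SmoothPer

variable {L : ℝ}

/-- The derivative `g'`. -/
def deriv (g : SmoothPer L) : SmoothPer L where
  toFun := _root_.deriv g.toFun
  smooth := (contDiff_infty_iff_deriv.1 g.smooth).2
  periodic x := by
    have h : (fun y => g.toFun (y + L)) = g.toFun := funext g.periodic
    rw [← deriv_comp_add_const, h]

/-- The translate `g(· + r)`. -/
def translate (g : SmoothPer L) (r : ℝ) : SmoothPer L where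
  toFun x := g.toFun (x + r)
  smooth := g.smooth.comp (contDiff_id.add contDiff_const)
  periodic x := by
    have h := g.periodic (x + r)
    rw [add_right_comm] at h
    exact h

/-- The composition `h ∘ g` with a smooth function `h` of a real variable. -/
def comp (h : ℝ → ℝ) (hh : ContDiff ℝ ∞ h) (g : SmoothPer L) : SmoothPer L where
  toFun x := h (g.toFun x)
  smooth := hh.comp g.smooth
  periodic x := by simp only [g.periodic x]

/-- `a + b g` for real constants `a`, `b`. -/
def affine (a b : ℝ) (g : SmoothPer L) : SmoothPer L :=
  comp (fun y => a + b * y) (contDiff_const.add (contDiff_const.mul contDiff_id)) g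

/-- `g₁ + c g₂`. -/
def addMul (g₁ : SmoothPer L) (c : ℝ) (g₂ : SmoothPer L) : SmoothPer L where
  toFun x := g₁.toFun x + c * g₂.toFun x
  smooth := g₁.smooth.add (contDiff_const.mul g₂.smooth)
  periodic x := by simp only [g₁.periodic x, g₂.periodic x]

/-- The induced function on the circle. -/
def circle (g : SmoothPer L) : AddCircle L → ℝ := g.periodic.lift

theorem circle_coe (g : SmoothPer L) (x : ℝ) : g.circle (x : AddCircle L) = g.toFun x :=
  g.periodic.lift_coe x

theorem continuous_circle (g : SmoothPer L) : Continuous g.circle :=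
  continuous_coinduced_dom.2 g.smooth.continuous

/-- The induced continuous function on the circle. -/
def toCM (g : SmoothPer L) : C(AddCircle L, ℝ) := ⟨g.circle, g.continuous_circle⟩

variable [Fact (0 < L)]

/-- The class of a smooth function in `L²`. -/
def toL2 (g : SmoothPer L) : L2per L :=
  ContinuousMap.toLp 2 AddCircle.haarAddCircle ℝ g.toCM

theorem toL2_ae (g : SmoothPer L) : g.toL2 =ᵐ[AddCircle.haarAddCircle] g.circle :=
  ContinuousMap.coeFn_toLp AddCircle.haarAddCircle g.toCM

theorem fc_toL2 (g : SmoothPer L) (n : ℤ) :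
    fc g.toL2 n = (1 / L) • ∫ x in (0 : ℝ)..L, fourier (-n) (x : AddCircle L) • (g.toFun x : ℂ) := by
  have h1 : fc g.toL2 n = fcFun g.circle n := by
    refine congrFun (fourierCoeff_congr_ae ?_) n
    filter_upwards [g.toL2_ae] with x hx
    rw [hx]
  rw [h1, fcFun, fourierCoeff_eq_intervalIntegral _ _ 0, zero_add]
  simp only [circle_coe]

theorem fc_addMul (g₁ g₂ : SmoothPer L) (c : ℝ) (n : ℤ) :
    fc (g₁.addMul c g₂).toL2 n = fc g₁.toL2 n + c * fc g₂.toL2 n := by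
  have h : (g₁.addMul c g₂).toL2 = g₁.toL2 + c • g₂.toL2 := by
    ext1
    filter_upwards [(g₁.addMul c g₂).toL2_ae, g₁.toL2_ae, g₂.toL2_ae,
      Lp.coeFn_add g₁.toL2 (c • g₂.toL2), Lp.coeFn_smul c g₂.toL2] with x h1 h2 h3 h4 h5
    rw [h1, h4, Pi.add_apply, h5, Pi.smul_apply, h2, h3]
    induction x using QuotientAddGroup.induction_on with
    | H x => exact (circle_coe _ x).trans (by
        rw [show g₁.circle (QuotientAddGroup.mk x) = g₁.toFun x from circle_coe g₁ x,
          show g₂.circle (QuotientAddGroup.mk x) = g₂.toFun x from circle_coe g₂ x]; rfl)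
  rw [h, fc_add, fc_smul]

theorem fc_deriv (g : SmoothPer L) (n : ℤ) :
    fc g.deriv.toL2 n = (2 * Real.pi * Complex.I * n / L) * fc g.toL2 n := by
  have hL : 0 < L := Fact.out
  have hLC : (L : ℂ) ≠ 0 := by exact_mod_cast hL.ne'
  have hd : ∀ x, HasDerivAt g.toFun (g.deriv.toFun x) x := fun x =>
    ((contDiff_infty_iff_deriv.1 g.smooth).1 x).hasDerivAt
  have hparts := intervalIntegral.integral_mul_deriv_eq_deriv_mul (a := 0) (b := L)
    (u := fun x : ℝ => fourier (-n) (x : AddCircle L))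
    (v := fun x : ℝ => (g.toFun x : ℂ))
    (u' := fun x : ℝ => -2 * Real.pi * Complex.I * n / L * fourier (-n) (x : AddCircle L))
    (v' := fun x : ℝ => (g.deriv.toFun x : ℂ))
    (fun x _ => hasDerivAt_fourier_neg L n x)
    (fun x _ => (hd x).ofReal_comp)
    (Continuous.intervalIntegrable (by fun_prop) _ _)
    (Continuous.intervalIntegrable
      (Complex.continuous_ofReal.comp g.deriv.smooth.continuous) _ _)
  rw [fc_toL2, fc_toL2]
  simp only [smul_eq_mul]
  rw [hparts]
  have hper : g.toFun L = g.toFun 0 := by simpa using g.periodic 0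
  have hc : ((L : ℝ) : AddCircle L) = ((0 : ℝ) : AddCircle L) := by
    simp
  rw [hper, hc, sub_self, zero_sub]
  simp only [mul_assoc]
  simp only [Complex.real_smul]
  simp only [intervalIntegral.integral_const_mul, div_eq_mul_inv, mul_assoc]
  ring

/-- `g - (L/2π)² g''`, whose coefficients are `(1 + n²) ĝ(n)`. -/
def bessel (g : SmoothPer L) : SmoothPer L :=
  g.addMul (-(L / (2 * Real.pi)) ^ 2) g.deriv.deriv

theorem fc_bessel (g : SmoothPer L) (n : ℤ) : fc g.bessel.toL2 n = wt n * fc g.toL2 n := by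
  have hLC : (L : ℂ) ≠ 0 := by exact_mod_cast (Fact.out : 0 < L).ne'
  have hpi : (Real.pi : ℂ) ≠ 0 := by exact_mod_cast Real.pi_ne_zero
  rw [bessel, fc_addMul, fc_deriv, fc_deriv, wt]
  push_cast
  field_simp
  ring_nf
  simp

theorem fc_bessel_iter (g : SmoothPer L) (k : ℕ) (n : ℤ) :
    fc (bessel^[k] g).toL2 n = (wt n : ℂ) ^ k * fc g.toL2 n := by
  induction k with
  | zero => simp
  | succ k ih => rw [Function.iterate_succ_apply', fc_bessel, ih, pow_succ]; ring

theorem summable_sobolev (g : SmoothPer L) (s : ℝ) :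
    Summable fun n : ℤ => wt n ^ s * ‖fc g.toL2 n‖ ^ 2 := by
  obtain ⟨k, hk⟩ := exists_nat_ge s
  refine Summable.of_nonneg_of_le
    (fun n => mul_nonneg (Real.rpow_nonneg (wt_pos n).le _) (sq_nonneg _)) (fun n => ?_)
    (summable_fc_sq (bessel^[k] g).toL2)
  rw [fc_bessel_iter, norm_mul, mul_pow, norm_pow, Complex.norm_real,
    Real.norm_of_nonneg (wt_pos n).le, ← pow_mul]
  refine mul_le_mul_of_nonneg_right ?_ (sq_nonneg _)
  rw [← Real.rpow_natCast]
  refine Real.rpow_le_rpow_of_exponent_le (one_le_wt n) ?_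
  push_cast
  have : (0 : ℝ) ≤ k := Nat.cast_nonneg k
  linarith

/-- A smooth periodic function as an element of `H^s`. -/
def toH (s : ℝ) (g : SmoothPer L) : HPer L s := HPer.mk g.toL2 (g.summable_sobolev s)

end SmoothPer

/-! ### The dispersion operator -/

/-- The symbols `θ` of order `m > 0`. -/
structure IsSymbol (m : ℝ) (θ : ℝ → ℝ) : Prop where
  pos : 0 < m
  even : ∀ k, θ (-k) = θ k
  continuous : Continuous θ
  growth : ∃ κ₀ υ₁ υ₂ : ℝ, 0 < υ₁ ∧ 0 < υ₂ ∧
    ∀ k : ℝ, κ₀ ≤ |k| → υ₁ * |k| ^ m ≤ θ k ∧ θ k ≤ υ₂ * |k| ^ m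

theorem IsSymbol.bound {m : ℝ} {θ : ℝ → ℝ} (hθ : IsSymbol m θ) :
    ∃ C : ℝ, ∀ n : ℤ, θ n ^ 2 ≤ C * wt n ^ m := by
  obtain ⟨κ₀, υ₁, υ₂, h1, h2, hb⟩ := hθ.growth
  obtain ⟨B, hB⟩ := (isCompact_Icc (a := -κ₀) (b := κ₀)).exists_bound_of_continuousOn
    hθ.continuous.continuousOn
  refine ⟨max (B ^ 2) (υ₂ ^ 2), fun n => ?_⟩
  have hm := hθ.pos
  have hw1 : 1 ≤ wt n ^ m := Real.one_le_rpow (one_le_wt n) hm.le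
  rcases le_total κ₀ |(n : ℝ)| with h | h
  · obtain ⟨ha, hc⟩ := hb n h
    have hn : 0 ≤ |(n : ℝ)| ^ m := Real.rpow_nonneg (abs_nonneg _) _
    have h0 : 0 ≤ θ n := le_trans (mul_nonneg h1.le hn) ha
    have h3 : (|(n : ℝ)| ^ m) ^ 2 ≤ wt n ^ m := by
      rw [← Real.rpow_natCast, ← Real.rpow_mul (abs_nonneg _), mul_comm,
        Real.rpow_mul (abs_nonneg _)]
      refine Real.rpow_le_rpow (Real.rpow_nonneg (abs_nonneg _) _) ?_ hm.le
      rw [Real.rpow_natCast, sq_abs, wt]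
      linarith
    calc θ n ^ 2 ≤ (υ₂ * |(n : ℝ)| ^ m) ^ 2 := pow_le_pow_left₀ h0 hc 2
      _ = υ₂ ^ 2 * (|(n : ℝ)| ^ m) ^ 2 := by ring
      _ ≤ υ₂ ^ 2 * wt n ^ m := mul_le_mul_of_nonneg_left h3 (sq_nonneg _)
      _ ≤ _ := mul_le_mul_of_nonneg_right (le_max_right _ _) (by linarith)
  · have h4 := hB n (abs_le.1 h)
    rw [Real.norm_eq_abs] at h4
    have h5 : θ n ^ 2 ≤ B ^ 2 := by
      rw [← sq_abs]
      exact pow_le_pow_left₀ (abs_nonneg _) h4 2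
    calc θ n ^ 2 ≤ B ^ 2 * 1 := by linarith
      _ ≤ B ^ 2 * wt n ^ m := mul_le_mul_of_nonneg_left hw1 (sq_nonneg _)
      _ ≤ _ := mul_le_mul_of_nonneg_right (le_max_left _ _) (by linarith)

section Operators

variable {L : ℝ} [Fact (0 < L)]

/-- Every conjugation-symmetric square summable sequence is the sequence of Fourier coefficients
of a real `L²` function. -/
theorem exists_fc_eq (a : ℤ → ℂ) (ha : Summable fun n => ‖a n‖ ^ 2)
    (hs : ∀ n, a (-n) = (starRingEnd ℂ) (a n)) : ∃ w : L2per L, ∀ n, fc w n = a n := by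
  have hmem : Memℓp a 2 := by
    rw [memℓp_gen_iff (by norm_num)]
    simpa using ha
  set F : Lp ℂ 2 (AddCircle.haarAddCircle (T := L)) := fourierBasis.repr.symm ⟨a, hmem⟩ with hF
  have hFa : ∀ n, fourierCoeff F n = a n := by
    intro n
    rw [← fourierBasis_repr, hF, LinearIsometryEquiv.apply_symm_apply]
  have hint : Integrable F AddCircle.haarAddCircle := (Lp.memLp F).integrable (by norm_num)
  refine ⟨Complex.reCLM.compLpL 2 AddCircle.haarAddCircle F, fun n => ?_⟩
  have hae : (fun x => (((Complex.reCLM.compLpL 2 AddCircle.haarAddCircle F :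
      L2per L) x : ℝ) : ℂ)) =ᵐ[AddCircle.haarAddCircle]
      fun x => (1 / 2 : ℂ) * (F x + (starRingEnd ℂ) (F x)) := by
    filter_upwards [ContinuousLinearMap.coeFn_compLpL (p := 2)
      (μ := AddCircle.haarAddCircle (T := L)) Complex.reCLM F] with x hx
    rw [hx, Complex.add_conj]
    simp
  have hconj : fourierCoeff (fun x => (starRingEnd ℂ) (F x)) n
      = (starRingEnd ℂ) (fourierCoeff F (-n)) := by
    unfold fourierCoeff
    rw [← integral_conj]
    refine integral_congr_ae (Eventually.of_forall fun x => ?_)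
    simp only [smul_eq_mul, map_mul, neg_neg]
    rw [fourier_neg]
  have hint' : Integrable (fun x => (starRingEnd ℂ) (F x)) AddCircle.haarAddCircle :=
    (Complex.conjCLE.toContinuousLinearMap).integrable_comp hint
  have hadd := congrFun (fourierCoeff.add hint hint') n
  have h1 : fc (Complex.reCLM.compLpL 2 AddCircle.haarAddCircle F : L2per L) n
      = fourierCoeff (fun x => (1 / 2 : ℂ) * (F x + (starRingEnd ℂ) (F x))) n :=
    congrFun (fourierCoeff_congr_ae hae) n
  rw [h1, fourierCoeff.const_mul]
  have h2 : fourierCoeff (fun x => F x + (starRingEnd ℂ) (F x)) n = a n + a n := by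
    refine Eq.trans hadd ?_
    rw [Pi.add_apply, hconj, hFa, hFa, hs, Complex.conj_conj]
  rw [h2]
  ring

theorem exists_multiplier {m : ℝ} {θ : ℝ → ℝ} (hθ : IsSymbol m θ) (v : HPer L m) :
    ∃ w : L2per L, ∀ n : ℤ, fc w n = (θ n : ℂ) * fc v.toL2 n := by
  refine exists_fc_eq _ ?_ ?_
  · obtain ⟨C, hC⟩ := hθ.bound
    refine Summable.of_nonneg_of_le (fun n => sq_nonneg _) (fun n => ?_)
      (v.summable.mul_left C)
    rw [norm_mul, mul_pow, Complex.norm_real, Real.norm_eq_abs, sq_abs, ← mul_assoc]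
    exact mul_le_mul_of_nonneg_right (hC n) (sq_nonneg _)
  · intro n
    rw [fc_neg, map_mul, Complex.conj_ofReal]
    push_cast
    rw [hθ.even]

/-- The operator `M : H^m → L²` with `(M v)^(n) = θ(n) v̂(n)`. -/
def multiplier {m : ℝ} {θ : ℝ → ℝ} (hθ : IsSymbol m θ) (v : HPer L m) : L2per L :=
  Classical.choose (exists_multiplier hθ v)

theorem fc_multiplier {m : ℝ} {θ : ℝ → ℝ} (hθ : IsSymbol m θ) (v : HPer L m) (n : ℤ) :
    fc (multiplier hθ v) n = (θ n : ℂ) * fc v.toL2 n :=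
  Classical.choose_spec (exists_multiplier hθ v) n

theorem memLp_smooth_mul (g : SmoothPer L) (v : L2per L) :
    MemLp (fun x => g.circle x * v x) 2 AddCircle.haarAddCircle := by
  obtain ⟨C, hC⟩ := (isCompact_univ (X := AddCircle L)).exists_bound_of_continuousOn
    g.continuous_circle.continuousOn
  refine MemLp.of_le_mul (c := C) (Lp.memLp v)
    (g.continuous_circle.aestronglyMeasurable.mul (Lp.aestronglyMeasurable v))
    (Eventually.of_forall fun x => ?_)
  rw [norm_mul]
  exact mul_le_mul_of_nonneg_right (hC x (mem_univ x)) (norm_nonneg _)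

/-- The product of a smooth periodic function and an `L²` function. -/
def smoothMul (g : SmoothPer L) (v : L2per L) : L2per L := (memLp_smooth_mul g v).toLp _

theorem contDiff_deriv {f : ℝ → ℝ} (hf : ContDiff ℝ ∞ f) : ContDiff ℝ ∞ (deriv f) :=
  (contDiff_infty_iff_deriv.1 hf).2

/-- The travelling wave equation (`om` is the speed `ω`) `M φ + om φ - f(φ) + A = 0`. -/
def IsTravellingWave {m : ℝ} {θ f : ℝ → ℝ} (hθ : IsSymbol m θ) (hf : ContDiff ℝ ∞ f)
    (om A : ℝ) (φ : SmoothPer L) : Prop :=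
  multiplier hθ (φ.toH m) + om • φ.toL2 - (φ.comp f hf).toL2 + (φ.affine A 0).toL2 = 0

/-- The linearised operator `𝓛 = M + om - f'(φ)` from `D(𝓛) = H^m` to `L²`. -/
def linOp {m : ℝ} {θ f : ℝ → ℝ} (hθ : IsSymbol m θ) (hf : ContDiff ℝ ∞ f)
    (om : ℝ) (φ : SmoothPer L) (v : HPer L m) : L2per L :=
  multiplier hθ v + om • v.toL2 - smoothMul (φ.comp (deriv f) (contDiff_deriv hf)) v.toL2

/-- `χ ≠ 0` spans the eigenspace of `T : H^m → L²` for `lam`; in particular `lam` is an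
eigenvalue and it is simple. -/
def SpansEigenspace {m : ℝ} (T : HPer L m → L2per L) (lam : ℝ) (χ : HPer L m) : Prop :=
  χ ≠ 0 ∧ ∀ v : HPer L m, T v = lam • v.toL2 ↔ ∃ c : ℝ, v = c • χ

/-- There is exactly one negative eigenvalue, it is simple, and `0` is a simple eigenvalue with
eigenfunction `φ'`. -/
def SpectralCondition {m : ℝ} (T : HPer L m → L2per L) (φ : SmoothPer L) : Prop :=
  (∃ lam < 0, (∃ χ, SpansEigenspace T lam χ) ∧
    ∀ ν < 0, ∀ v : HPer L m, v ≠ 0 → T v = ν • v.toL2 → ν = lam) ∧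
  SpansEigenspace T 0 (φ.deriv.toH m)

/-- The Gårding inequality `(𝓛 v, v) ≥ c₁ ‖v‖²_{m/2} - c₂ ‖v‖²` for smooth `v`. -/
def GardingCondition {m : ℝ} (T : HPer L m → L2per L) : Prop :=
  ∃ c₁ c₂ : ℝ, 0 < c₁ ∧ 0 < c₂ ∧ ∀ v : SmoothPer L,
    c₁ * ‖v.toH (m / 2)‖ ^ 2 - c₂ * pair v.toL2 v.toL2 ≤ pair (T (v.toH m)) v.toL2

/-- Coercivity of `𝓛` on `{v : (v, φ') = (v, Q'(φ)) = 0}`.  For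
`Q(u) = a ∫ u + (b/2) ∫ u²` one has `Q'(φ) = a + b φ`. -/
def CoercivityCondition {m : ℝ} (T : HPer L m → L2per L) (a b : ℝ) (φ : SmoothPer L) : Prop :=
  ∃ c₃ : ℝ, 0 < c₃ ∧ ∀ v : HPer L m,
    pair v.toL2 φ.deriv.toL2 = 0 → pair v.toL2 (φ.affine a b).toL2 = 0 →
      c₃ * pair v.toL2 v.toL2 ≤ pair (T v) v.toL2

/-! ### The evolution equation -/

/-- `u ∈ C([0, ∞); H^s)` is a global solution of `u_t + (f(u))_x - (M u)_x = 0`: one has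
`f(u) ∈ L¹_loc`, and the equation, tested with each exponential `exp(-2πinx/L)` and
integrated in time, holds. -/
structure IsSolution (θ f : ℝ → ℝ) {s : ℝ} (u : ℝ → HPer L s) : Prop where
  continuous : ContinuousOn u (Ici 0)
  integrable : ∀ᵐ τ ∂(volume.restrict (Ici (0 : ℝ))),
    Integrable (fun x : AddCircle L => f ((u τ).toL2 x))
  locally_integrable : ∀ t : ℝ, 0 ≤ t →
    IntervalIntegrable (fun τ => ∫ x : AddCircle L, |f ((u τ).toL2 x)|) volume 0 t
  equation : ∀ n : ℤ, ∀ t : ℝ, 0 ≤ t →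
    fc (u t).toL2 n = fc (u 0).toL2 n + ∫ τ in (0 : ℝ)..t,
      (2 * Real.pi * Complex.I * n / L) *
        ((θ n : ℂ) * fc (u τ).toL2 n - fcFun (fun x => f ((u τ).toL2 x)) n)

variable (L) in
/-- Global well-posedness (for `t ≥ 0`) of the Cauchy problem in `H^s`: existence, uniqueness,
continuous dependence on the data, and persistence of the regularity of smooth data. -/
structure GloballyWellPosed (θ f : ℝ → ℝ) (s : ℝ) : Prop where
  existence : ∀ u₀ : HPer L s, ∃ u : ℝ → HPer L s, IsSolution θ f u ∧ u 0 = u₀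
  uniqueness : ∀ u v : ℝ → HPer L s, IsSolution θ f u → IsSolution θ f v → u 0 = v 0 →
    ∀ t, 0 ≤ t → u t = v t
  dependence : ∀ u : ℝ → HPer L s, IsSolution θ f u → ∀ T > 0, ∀ ε > 0, ∃ δ > 0,
    ∀ v : ℝ → HPer L s, IsSolution θ f v → ‖v 0 - u 0‖ < δ →
      ∀ t ∈ Icc 0 T, ‖v t - u t‖ < ε
  persistence : ∀ u : ℝ → HPer L s, IsSolution θ f u → (∃ g : SmoothPer L, u 0 = g.toH s) →
    ∀ r : ℝ, s ≤ r → ∃ w : ℝ → HPer L r, ContinuousOn w (Ici 0) ∧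
      ∀ t, 0 ≤ t → (w t).toL2 = (u t).toL2

/-- The distance in `H^r` from `v` to the orbit `{φ(· + ρ) : ρ ∈ ℝ}`. -/
def orbitDist {r : ℝ} (v : HPer L r) (φ : SmoothPer L) : ℝ :=
  ⨅ ρ : ℝ, ‖v - (φ.translate ρ).toH r‖

/-- Orbital stability in `H^{m/2}`: `δ` depends on `ε` only, and the data may be taken in
any `H^s`, `s ≥ m/2`, in which the Cauchy problem is globally well-posed. -/
def OrbitallyStable (m : ℝ) (θ f : ℝ → ℝ) (φ : SmoothPer L) : Prop :=
  ∀ ε > 0, ∃ δ > 0, ∀ (s : ℝ) (hs : m / 2 ≤ s), GloballyWellPosed L θ f s →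
    ∀ u₀ : HPer L s, ‖u₀.incl hs - φ.toH (m / 2)‖ < δ →
      (∃ u : ℝ → HPer L s, IsSolution θ f u ∧ u 0 = u₀) ∧
      ∀ u : ℝ → HPer L s, IsSolution θ f u → u 0 = u₀ →
        ∀ t, 0 ≤ t → orbitDist ((u t).incl hs) φ < ε

variable (L) in
/-- With `W(y) = ∫₀^y f`, the functional `u ↦ ∫₀ᴸ W(u) dx` is finite and of class `C²` on
`H^r`. -/
def PotentialIsC2 (f : ℝ → ℝ) (r : ℝ) : Prop :=
  (∀ u : HPer L r, Integrable (fun x : AddCircle L => ∫ y in (0 : ℝ)..(u.toL2 x), f y)) ∧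
  ContDiff ℝ 2 (fun u : HPer L r => ∫ x : AddCircle L, ∫ y in (0 : ℝ)..(u.toL2 x), f y)

end Operators

end PerWave

end

open MeasureTheory Set Filter Topology
open scoped ContDiff ENNReal

noncomputable section

namespace PerWave

/-! ### Parseval's identity and bounded Fourier multipliers on real `L²`. -/

section FourierL2

variable {L : ℝ} [Fact (0 < L)]

/-! The proof is Lyapunov's method. The action G(u) = E(u) + (ω/2)‖u‖² + A∫u, with E(u) = ½(Mu, u) -
∫W(u), has φ as a critical point, by the travelling wave equation, and 𝓛 as its second derivative
there. G and Q are invariant under translations and are conserved by the flow, since energy,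
momentum and mass are.

(H₂) makes 𝓛 positive off the two directions φ' and Q'(φ). The first is removed by symmetry: u is
translated so that v = u(· - r) - φ is orthogonal to φ'. The second is removed by conservation: (v,
Q'(φ)) equals Q(φ + v) - Q(φ) up to a term quadratic in v. Hence, near the orbit, ‖v‖² ≤ C(|G(u) -
G(φ)| + (Q(u) - Q(φ))²) in `H^{m/2}` (`exists_norm_sq_le`). The right side is constant in time and
small initially. As the distance to the orbit is continuous in time, it cannot cross a small
threshold. The penalty term spares any adjustment of u₀ to the level set of Q.

Four ingredients carry this. (a) `exists_coercive`: (H₁) upgrades the `L²` bound of (H₂) to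
`H^{m/2}`, and the two constraints become penalty terms. (b) `exists_abs_potentialRem_le_sobolev`:
the second order expansion of ∫W(u) at φ. For m > 1 it comes from the embedding in `L^∞`. For m ≤ 1
the assumed `C²` regularity gives some expansion, whose coefficients are identified along smooth
directions and then by density. (c) `IsSolution.conservation`: momentum and energy are conserved for
rough solutions. Smooth data are treated by persistence of regularity and projection on finitely
many frequencies, general data by continuous dependence. (d) `exists_modulation`: the translate of φ
closest in `L²` is also close in `H^{m/2}`, by interpolation with `H^m`. -/

theorem ext_fc {u v : L2per L} (h : ∀ n, fc u n = fc v n) : u = v := by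
  rw [← sub_eq_zero]
  refine eq_zero_of_fc fun n => ?_
  have h1 := fc_add (u - v) v n
  rw [sub_add_cancel, h n] at h1
  simpa using h1.symm

theorem inner_toC (u v : L2per L) : inner ℂ (toC u) (toC v) = ((inner ℝ u v : ℝ) : ℂ) := by
  rw [L2.inner_def, L2.inner_def, ← integral_complex_ofReal]
  refine integral_congr_ae ?_
  filter_upwards [toC_ae u, toC_ae v] with x h1 h2
  rw [h1, h2]
  simp

/-- Parseval's identity. -/
theorem hasSum_inner_fc (u v : L2per L) :
    HasSum (fun n => ((starRingEnd ℂ) (fc u n) * fc v n).re) (inner ℝ u v) := by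
  have h := lp.hasSum_inner (𝕜 := ℂ) (fourierBasis.repr (toC u)) (fourierBasis.repr (toC v))
  rw [LinearIsometryEquiv.inner_map_map, inner_toC] at h
  have h' := Complex.hasSum_re h
  rw [Complex.ofReal_re] at h'
  refine h'.congr_fun fun n => ?_
  rw [fc_eq_repr, fc_eq_repr, RCLike.inner_apply, mul_comm]

theorem hasSum_norm_sq_fc (u : L2per L) : HasSum (fun n => ‖fc u n‖ ^ 2) (‖u‖ ^ 2) := by
  rw [← real_inner_self_eq_norm_sq]
  refine (hasSum_inner_fc u u).congr_fun fun n => ?_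
  rw [mul_comm, Complex.mul_conj, Complex.ofReal_re, Complex.normSq_eq_norm_sq]

theorem norm_fc_le (u : L2per L) (n : ℤ) : ‖fc u n‖ ≤ ‖u‖ := by
  refine le_of_sq_le_sq ?_ (norm_nonneg _)
  exact le_hasSum (hasSum_norm_sq_fc u) n fun _ _ => sq_nonneg _

theorem norm_le_of_fc_le {u : L2per L} {v : L2per L} {C : ℝ} (hC : 0 ≤ C)
    (h : ∀ n, ‖fc u n‖ ≤ C * ‖fc v n‖) : ‖u‖ ≤ C * ‖v‖ := by
  refine le_of_sq_le_sq ?_ (by positivity)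
  rw [mul_pow]
  refine hasSum_le (fun n => ?_) (hasSum_norm_sq_fc u) ((hasSum_norm_sq_fc v).mul_left (C ^ 2))
  rw [← mul_pow]
  exact pow_le_pow_left₀ (norm_nonneg _) (h n) 2

theorem pair_eq_inner (u v : L2per L) : pair u v = L * inner ℝ u v := by
  have hL : 0 < L := Fact.out
  rw [pair, L2.inner_def, AddCircle.integral_haarAddCircle, smul_eq_mul, ← mul_assoc,
    mul_inv_cancel₀ hL.ne', one_mul]
  refine integral_congr_ae (Eventually.of_forall fun x => ?_)
  simp [mul_comm]

theorem pair_self (u : L2per L) : pair u u = L * ‖u‖ ^ 2 := by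
  rw [pair_eq_inner, real_inner_self_eq_norm_sq]

/-- The Fourier coefficient as a continuous linear functional. -/
def fcCLM (n : ℤ) : L2per L →L[ℝ] ℂ :=
  LinearMap.mkContinuous
    { toFun := fun u => fc u n
      map_add' := fun u v => fc_add u v n
      map_smul' := fun c u => by simp [fc_smul] } 1 fun u => by
    rw [one_mul]
    exact norm_fc_le u n

theorem fc_sub (u v : L2per L) (n : ℤ) : fc (u - v) n = fc u n - fc v n :=
  map_sub (fcCLM n) u v

/-! ### Bounded Fourier multipliers -/

/-- Symbols of bounded multipliers preserving real functions. -/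
structure IsRealSymbol (c : ℤ → ℂ) : Prop where
  bounded : ∃ C, ∀ n, ‖c n‖ ≤ C
  conj : ∀ n, c (-n) = (starRingEnd ℂ) (c n)

theorem IsRealSymbol.exists_apply {c : ℤ → ℂ} (hc : IsRealSymbol c) (u : L2per L) :
    ∃ w : L2per L, ∀ n, fc w n = c n * fc u n := by
  obtain ⟨C, hC⟩ := hc.bounded
  refine exists_fc_eq _ ?_ fun n => ?_
  · refine Summable.of_nonneg_of_le (fun n => sq_nonneg _) (fun n => ?_)
      ((summable_fc_sq u).mul_left (C ^ 2))
    rw [norm_mul, mul_pow]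
    exact mul_le_mul_of_nonneg_right (pow_le_pow_left₀ (norm_nonneg _) (hC n) 2) (sq_nonneg _)
  · rw [map_mul, fc_neg, hc.conj]

variable (L) in
/-- The bounded Fourier multiplier with symbol `c`. -/
def mult {c : ℤ → ℂ} (hc : IsRealSymbol c) : L2per L →L[ℝ] L2per L :=
  LinearMap.mkContinuousOfExistsBound
    { toFun := fun u => Classical.choose (hc.exists_apply u)
      map_add' := fun u v => ext_fc fun n => by
        rw [fc_add, Classical.choose_spec (hc.exists_apply (u + v)),
          Classical.choose_spec (hc.exists_apply u), Classical.choose_spec (hc.exists_apply v),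
          fc_add, mul_add]
      map_smul' := fun r u => ext_fc fun n => by
        rw [RingHom.id_apply, fc_smul, Classical.choose_spec (hc.exists_apply (r • u)),
          Classical.choose_spec (hc.exists_apply u), fc_smul]
        ring } <| by
    obtain ⟨C, hC⟩ := hc.bounded
    refine ⟨C, fun u => norm_le_of_fc_le ((norm_nonneg _).trans (hC 0)) fun n => ?_⟩
    change ‖fc (Classical.choose (hc.exists_apply u)) n‖ ≤ _
    rw [Classical.choose_spec (hc.exists_apply u), norm_mul]
    exact mul_le_mul_of_nonneg_right (hC n) (norm_nonneg _)

theorem fc_mult {c : ℤ → ℂ} (hc : IsRealSymbol c) (u : L2per L) (n : ℤ) :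
    fc (mult L hc u) n = c n * fc u n :=
  Classical.choose_spec (hc.exists_apply u) n

theorem norm_mult_le {c : ℤ → ℂ} (hc : IsRealSymbol c) {C : ℝ} (hC : ∀ n, ‖c n‖ ≤ C)
    (u : L2per L) : ‖mult L hc u‖ ≤ C * ‖u‖ :=
  norm_le_of_fc_le ((norm_nonneg _).trans (hC 0)) fun n => by
    rw [fc_mult, norm_mul]
    exact mul_le_mul_of_nonneg_right (hC n) (norm_nonneg _)

theorem IsRealSymbol.ofReal {c : ℤ → ℝ} (hb : ∃ C, ∀ n, |c n| ≤ C) (hc : ∀ n, c (-n) = c n) :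
    IsRealSymbol fun n => (c n : ℂ) where
  bounded := by
    obtain ⟨C, hC⟩ := hb
    exact ⟨C, fun n => by rw [Complex.norm_real]; exact hC n⟩
  conj n := by rw [hc, Complex.conj_ofReal]

theorem inner_mult_ofReal {c : ℤ → ℝ} (hc : IsRealSymbol fun n => (c n : ℂ)) (u v : L2per L) :
    inner ℝ (mult L hc u) v = inner ℝ u (mult L hc v) := by
  refine (hasSum_inner_fc _ _).unique ((hasSum_inner_fc _ _).congr_fun fun n => ?_)
  rw [fc_mult, fc_mult, map_mul, Complex.conj_ofReal]
  ring_nf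

/-- Multipliers with imaginary symbol are skew-adjoint. -/
theorem inner_mult_skew {c : ℤ → ℂ} (hc : IsRealSymbol c)
    (h : ∀ n, (starRingEnd ℂ) (c n) = -c n) (u v : L2per L) :
    inner ℝ (mult L hc u) v = -inner ℝ u (mult L hc v) := by
  refine (hasSum_inner_fc _ _).unique ((hasSum_inner_fc _ _).neg.congr_fun fun n => ?_)
  rw [fc_mult, fc_mult, map_mul, h, ← Complex.neg_re]
  ring_nf

theorem inner_mult_skew_self {c : ℤ → ℂ} (hc : IsRealSymbol c)
    (h : ∀ n, (starRingEnd ℂ) (c n) = -c n) (u : L2per L) :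
    inner ℝ u (mult L hc u) = 0 := by
  have h1 := inner_mult_skew hc h u u
  rw [real_inner_comm] at h1
  linarith

end FourierL2

/-! ### Sobolev spaces through Bessel potentials -/

section Bessel

variable {L : ℝ} [Fact (0 < L)]

theorem wt_neg (n : ℤ) : wt (-n) = wt n := by simp [wt]

theorem wt_rpow_half_sq (n : ℤ) (s : ℝ) : (wt n ^ (s / 2)) ^ 2 = wt n ^ s := by
  rw [← Real.rpow_natCast, ← Real.rpow_mul (wt_pos n).le]
  norm_num

theorem HPer.toL2_add {s : ℝ} (u v : HPer L s) : (u + v).toL2 = u.toL2 + v.toL2 := map_add _ u v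

theorem HPer.exists_bessel {s : ℝ} (u : HPer L s) :
    ∃ w : L2per L, ∀ n, fc w n = ((wt n ^ (s / 2) : ℝ) : ℂ) * fc u.toL2 n := by
  refine exists_fc_eq _ (u.summable.congr fun n => ?_) fun n => ?_
  · rw [norm_mul, Complex.norm_real, mul_pow, Real.norm_eq_abs, sq_abs, wt_rpow_half_sq]
  · rw [map_mul, fc_neg, wt_neg, Complex.conj_ofReal]

theorem HPer.norm_sq_of_bessel {s : ℝ} (u : HPer L s) {w : L2per L}
    (hw : ∀ n, fc w n = ((wt n ^ (s / 2) : ℝ) : ℂ) * fc u.toL2 n) : ‖u‖ ^ 2 = L * ‖w‖ ^ 2 := by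
  rw [HPer.norm_sq, ← (hasSum_norm_sq_fc w).tsum_eq]
  congr 1
  refine tsum_congr fun n => ?_
  rw [hw, norm_mul, Complex.norm_real, mul_pow, Real.norm_eq_abs, sq_abs, wt_rpow_half_sq]

variable (L) in
/-- The Bessel potential `H^s → L²`, with symbol `(1 + n²)^{s/2}`. -/
def besselPot (s : ℝ) : HPer L s →L[ℝ] L2per L :=
  LinearMap.mkContinuous
    { toFun := fun u => Classical.choose u.exists_bessel
      map_add' := fun u v => ext_fc fun n => by
        rw [fc_add, Classical.choose_spec (u + v).exists_bessel,
          Classical.choose_spec u.exists_bessel, Classical.choose_spec v.exists_bessel,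
          HPer.toL2_add, fc_add, mul_add]
      map_smul' := fun r u => ext_fc fun n => by
        rw [RingHom.id_apply, fc_smul, Classical.choose_spec (r • u).exists_bessel,
          Classical.choose_spec u.exists_bessel, map_smul, fc_smul]
        ring } (√L)⁻¹ fun u => by
    have hL : 0 < √L := Real.sqrt_pos.2 Fact.out
    rw [le_inv_mul_iff₀ hL]
    refine le_of_sq_le_sq ?_ (norm_nonneg _)
    rw [mul_pow, Real.sq_sqrt (Fact.out : 0 < L).le,
      u.norm_sq_of_bessel (Classical.choose_spec u.exists_bessel)]
    rfl

theorem fc_besselPot {s : ℝ} (u : HPer L s) (n : ℤ) :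
    fc (besselPot L s u) n = ((wt n ^ (s / 2) : ℝ) : ℂ) * fc u.toL2 n :=
  Classical.choose_spec u.exists_bessel n

theorem HPer.norm_sq_eq {s : ℝ} (u : HPer L s) : ‖u‖ ^ 2 = L * ‖besselPot L s u‖ ^ 2 :=
  u.norm_sq_of_bessel (fc_besselPot u)

theorem HPer.norm_eq {s : ℝ} (u : HPer L s) : ‖u‖ = √L * ‖besselPot L s u‖ := by
  have hL : 0 < L := Fact.out
  refine (sq_eq_sq₀ (norm_nonneg _) (by positivity)).1 ?_
  rw [mul_pow, Real.sq_sqrt hL.le, u.norm_sq_eq]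

/-- Comparison of Sobolev norms through Fourier coefficients. -/
theorem HPer.norm_le_of_fc_le {r s : ℝ} {u : HPer L r} {v : HPer L s} {C : ℝ} (hC : 0 ≤ C)
    (h : ∀ n, wt n ^ (r / 2) * ‖fc u.toL2 n‖ ≤ C * (wt n ^ (s / 2) * ‖fc v.toL2 n‖)) :
    ‖u‖ ≤ C * ‖v‖ := by
  rw [u.norm_eq, v.norm_eq, mul_left_comm]
  refine mul_le_mul_of_nonneg_left (PerWave.norm_le_of_fc_le hC fun n => ?_) (Real.sqrt_nonneg _)
  rw [fc_besselPot, fc_besselPot, norm_mul, norm_mul, Complex.norm_real, Complex.norm_real,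
    Real.norm_of_nonneg (Real.rpow_nonneg (wt_pos n).le _),
    Real.norm_of_nonneg (Real.rpow_nonneg (wt_pos n).le _)]
  exact h n

theorem HPer.norm_toL2_le {s : ℝ} (hs : 0 ≤ s) (u : HPer L s) : ‖u.toL2‖ ≤ (√L)⁻¹ * ‖u‖ := by
  have hL : 0 < √L := Real.sqrt_pos.2 Fact.out
  rw [u.norm_eq, ← mul_assoc, inv_mul_cancel₀ hL.ne']
  refine PerWave.norm_le_of_fc_le zero_le_one fun n => ?_
  rw [fc_besselPot, norm_mul, one_mul, Complex.norm_real,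
    Real.norm_of_nonneg (Real.rpow_nonneg (wt_pos n).le _)]
  exact le_mul_of_one_le_left (norm_nonneg _) (Real.one_le_rpow (one_le_wt n) (by linarith))

variable (L) in
/-- The inclusion `H^s ⊆ L²`, as a continuous linear map. -/
def toL2CLM {s : ℝ} (hs : 0 ≤ s) : HPer L s →L[ℝ] L2per L :=
  LinearMap.mkContinuous HPer.toL2 (√L)⁻¹ (HPer.norm_toL2_le hs)

theorem HPer.toL2_incl {r s : ℝ} (h : r ≤ s) (u : HPer L s) : (u.incl h).toL2 = u.toL2 :=
  HPer.toL2_mk _ _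

theorem HPer.toL2_smul {s : ℝ} (c : ℝ) (u : HPer L s) : (c • u).toL2 = c • u.toL2 :=
  map_smul HPer.toL2 c u

theorem HPer.incl_add {r s : ℝ} (h : r ≤ s) (u v : HPer L s) :
    (u + v).incl h = u.incl h + v.incl h := by
  apply HPer.ext_toL2
  rw [toL2_add, toL2_incl, toL2_incl, toL2_incl, toL2_add]

theorem HPer.incl_smul {r s : ℝ} (h : r ≤ s) (c : ℝ) (u : HPer L s) :
    (c • u).incl h = c • u.incl h := by
  apply HPer.ext_toL2
  rw [toL2_smul, toL2_incl, toL2_incl, toL2_smul]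

theorem HPer.norm_incl_le {r s : ℝ} (h : r ≤ s) (u : HPer L s) : ‖u.incl h‖ ≤ 1 * ‖u‖ :=
  HPer.norm_le_of_fc_le zero_le_one fun n => by
    rw [one_mul, HPer.toL2_incl]
    exact mul_le_mul_of_nonneg_right
      (Real.rpow_le_rpow_of_exponent_le (one_le_wt n) (by linarith)) (norm_nonneg _)

variable (L) in
/-- The inclusion `H^s ⊆ H^r`, as a continuous linear map. -/
def inclCLM {r s : ℝ} (h : r ≤ s) : HPer L s →L[ℝ] HPer L r :=
  LinearMap.mkContinuous
    { toFun := HPer.incl h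
      map_add' := HPer.incl_add h
      map_smul' := HPer.incl_smul h } 1 (HPer.norm_incl_le h)

theorem SmoothPer.toL2_toH (g : SmoothPer L) (s : ℝ) : (g.toH s).toL2 = g.toL2 := rfl

/-- Interpolation between `L²` and `H^s`. -/
theorem HPer.norm_sq_le_of_half {s : ℝ} (u : HPer L s) (v : HPer L (s / 2))
    (h : v.toL2 = u.toL2) : ‖v‖ ^ 2 ≤ √L * ‖u.toL2‖ * ‖u‖ := by
  have hL : 0 < L := Fact.out
  have h1 : ‖besselPot L (s / 2) v‖ ^ 2 = inner ℝ u.toL2 (besselPot L s u) := by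
    refine (hasSum_norm_sq_fc _).unique ((hasSum_inner_fc _ _).congr_fun fun n => ?_)
    rw [fc_besselPot, fc_besselPot, h, mul_left_comm, Complex.re_ofReal_mul,
      mul_comm ((starRingEnd ℂ) _), Complex.mul_conj, Complex.ofReal_re,
      Complex.normSq_eq_norm_sq, norm_mul, mul_pow,
      Complex.norm_real, Real.norm_eq_abs, sq_abs, wt_rpow_half_sq]
  rw [v.norm_sq_eq, h1, u.norm_eq]
  have h2 : √L * √L = L := Real.mul_self_sqrt hL.le
  have h3 := real_inner_le_norm u.toL2 (besselPot L s u)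
  calc L * inner ℝ u.toL2 (besselPot L s u) ≤ L * (‖u.toL2‖ * ‖besselPot L s u‖) :=
        mul_le_mul_of_nonneg_left h3 hL.le
    _ = √L * √L * (‖u.toL2‖ * ‖besselPot L s u‖) := by rw [h2]
    _ = _ := by ring

end Bessel

/-! ### Characters of the circle and the symbol of the derivative. -/

section Characters

variable {L : ℝ}

theorem fourier_coe_add (n : ℤ) (r t : ℝ) :
    (fourier n ((r + t : ℝ) : AddCircle L) : ℂ)
      = fourier n (r : AddCircle L) * fourier n (t : AddCircle L) := by
  simp only [fourier_apply, AddCircle.coe_add, smul_add, AddCircle.toCircle_add, Circle.coe_mul]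

variable (L) in
/-- The symbol `2πin/L` of `∂ₓ`. -/
def derivSymbol (n : ℤ) : ℂ := 2 * Real.pi * Complex.I * n / L

theorem derivSymbol_eq (n : ℤ) :
    derivSymbol L n = ((2 * Real.pi * n / L : ℝ) : ℂ) * Complex.I := by
  rw [derivSymbol]
  push_cast
  ring

theorem derivSymbol_neg (n : ℤ) : derivSymbol L (-n) = -derivSymbol L n := by
  simp [derivSymbol, neg_div]

theorem fourier_coe_eq_exp (n : ℤ) (r : ℝ) :
    (fourier n (r : AddCircle L) : ℂ) = Complex.exp (r * derivSymbol L n) := by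
  rw [fourier_coe_apply, derivSymbol]
  congr 1
  ring

theorem norm_fourier_coe (n : ℤ) (r : ℝ) : ‖(fourier n (r : AddCircle L) : ℂ)‖ = 1 := by
  rw [fourier_apply, Circle.norm_coe]

theorem conj_derivSymbol (n : ℤ) : (starRingEnd ℂ) (derivSymbol L n) = -derivSymbol L n := by
  rw [derivSymbol_eq, map_mul, Complex.conj_ofReal, Complex.conj_I, mul_neg]

/-- Taylor's formula gives the bound for |y| ≤ 1. For |y| ≥ 1 both pieces are at most |y| ≤ y².
Having it for all y permits its use on every frequency at once. -/
theorem norm_exp_mul_I_sub_le (y : ℝ) :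
    ‖Complex.exp (y * Complex.I) - 1 - y * Complex.I‖ ≤ 2 * y ^ 2 := by
  have hn : ‖(y : ℂ) * Complex.I‖ = |y| := by simp
  rcases le_total |y| 1 with h | h
  · refine (Complex.norm_exp_sub_one_sub_id_le (by rw [hn]; exact h)).trans ?_
    rw [hn, sq_abs]
    nlinarith [sq_nonneg y]
  · have h1 : ‖Complex.exp (y * Complex.I) - 1‖ ≤ |y| := by
      have := Real.norm_exp_I_mul_ofReal_sub_one_le (x := y)
      rwa [mul_comm, Real.norm_eq_abs] at this
    refine (norm_sub_le _ _).trans ?_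
    rw [hn]
    nlinarith [sq_abs y]

variable (L) in
theorem isRealSymbol_fourier (r : ℝ) :
    IsRealSymbol fun n => (fourier n (r : AddCircle L) : ℂ) where
  bounded := ⟨1, fun n => (norm_fourier_coe n r).le⟩
  conj _ := fourier_neg

end Characters

/-! ### Translations on `L²` and `H^s`, and their derivative. -/

section Translation

variable {L : ℝ} [Fact (0 < L)]

variable (L) in
/-- Translation `u ↦ u(· + r)` on `L²`. -/
def trans (r : ℝ) : L2per L →L[ℝ] L2per L := mult L (isRealSymbol_fourier L r)

theorem fc_trans (r : ℝ) (u : L2per L) (n : ℤ) :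
    fc (trans L r u) n = fourier n (r : AddCircle L) * fc u n :=
  fc_mult _ u n

theorem fcFun_comp_add (g : AddCircle L → ℝ) (r : ℝ) (n : ℤ) :
    fcFun (fun x => g (x + (r : AddCircle L))) n = fourier n (r : AddCircle L) * fcFun g n := by
  have h := integral_add_right_eq_self (μ := AddCircle.haarAddCircle (T := L))
    (fun y : AddCircle L => (fourier (-n) (y - (r : AddCircle L)) : ℂ) * ((g y : ℝ) : ℂ))
    (r : AddCircle L)
  simp only [add_sub_cancel_right] at h
  unfold fcFun fourierCoeff
  simp only [smul_eq_mul]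
  rw [h, ← integral_const_mul]
  refine integral_congr_ae (Eventually.of_forall fun y => ?_)
  simp only [fourier_apply, smul_sub, neg_smul, sub_neg_eq_add]
  rw [AddCircle.toCircle_add, Circle.coe_mul]
  ring

/-- Links the definition of `trans` as a multiplier with the pointwise shift. The former gives the
group law and the norms, the latter is needed for nonlinear functionals. -/
theorem trans_ae (r : ℝ) (u : L2per L) :
    trans L r u =ᵐ[AddCircle.haarAddCircle] fun x => u (x + (r : AddCircle L)) := by
  have hmp := measurePreserving_add_right (AddCircle.haarAddCircle (T := L)) (r : AddCircle L)
  have h2 : MemLp (fun x => u (x + (r : AddCircle L))) 2 AddCircle.haarAddCircle :=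
    (Lp.memLp u).comp_measurePreserving hmp
  have h3 : trans L r u = h2.toLp _ := by
    refine ext_fc fun n => ?_
    rw [fc_trans]
    refine (fcFun_comp_add (fun x => u x) r n).symm.trans ?_
    refine congrFun (fourierCoeff_congr_ae ?_) n
    filter_upwards [h2.coeFn_toLp] with x hx
    rw [hx]
  rw [h3]
  exact h2.coeFn_toLp

theorem trans_trans (r t : ℝ) (u : L2per L) : trans L r (trans L t u) = trans L (r + t) u := by
  refine ext_fc fun n => ?_
  rw [fc_trans, fc_trans, fc_trans, fourier_coe_add, mul_assoc]

theorem trans_zero (u : L2per L) : trans L 0 u = u := by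
  refine ext_fc fun n => ?_
  rw [fc_trans]
  simp

theorem inner_trans_trans (r : ℝ) (u v : L2per L) :
    inner ℝ (trans L r u) (trans L r v) = inner ℝ u v := by
  refine (hasSum_inner_fc _ _).unique ((hasSum_inner_fc _ _).congr_fun fun n => ?_)
  rw [fc_trans, fc_trans, map_mul, mul_mul_mul_comm, ← Complex.normSq_eq_conj_mul_self,
    Complex.normSq_eq_norm_sq, norm_fourier_coe]
  simp

theorem norm_trans (r : ℝ) (u : L2per L) : ‖trans L r u‖ = ‖u‖ := by
  rw [norm_eq_sqrt_real_inner, inner_trans_trans, ← norm_eq_sqrt_real_inner]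

/-- Translation on `H^s`. -/
def HPer.trans {s : ℝ} (r : ℝ) (u : HPer L s) : HPer L s :=
  HPer.mk (PerWave.trans L r u.toL2) <| u.summable.congr fun n => by
    rw [fc_trans, norm_mul, norm_fourier_coe, one_mul]

theorem HPer.toL2_trans {s : ℝ} (r : ℝ) (u : HPer L s) :
    (u.trans r).toL2 = PerWave.trans L r u.toL2 := HPer.toL2_mk _ _

theorem HPer.norm_trans {s : ℝ} (r : ℝ) (u : HPer L s) : ‖u.trans r‖ = ‖u‖ := by
  refine (sq_eq_sq₀ (norm_nonneg _) (norm_nonneg _)).1 ?_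
  rw [HPer.norm_sq, HPer.norm_sq]
  congr 1
  refine tsum_congr fun n => ?_
  rw [HPer.toL2_trans, fc_trans, norm_mul, norm_fourier_coe, one_mul]

theorem HPer.toL2_sub {s : ℝ} (u v : HPer L s) : (u - v).toL2 = u.toL2 - v.toL2 :=
  map_sub HPer.toL2 u v

theorem HPer.trans_sub {s : ℝ} (r : ℝ) (u v : HPer L s) :
    (u - v).trans r = u.trans r - v.trans r := by
  apply HPer.ext_toL2
  rw [toL2_trans, toL2_sub, toL2_sub, map_sub, toL2_trans, toL2_trans]

theorem HPer.trans_trans {s : ℝ} (r t : ℝ) (u : HPer L s) :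
    (u.trans t).trans r = u.trans (r + t) := by
  apply HPer.ext_toL2
  rw [toL2_trans, toL2_trans, toL2_trans, PerWave.trans_trans]

theorem HPer.trans_zero {s : ℝ} (u : HPer L s) : u.trans 0 = u := by
  apply HPer.ext_toL2
  rw [toL2_trans, PerWave.trans_zero]

theorem SmoothPer.toL2_translate (g : SmoothPer L) (r : ℝ) :
    (g.translate r).toL2 = trans L r g.toL2 := by
  have hmp := measurePreserving_add_right (AddCircle.haarAddCircle (T := L)) (r : AddCircle L)
  ext1
  filter_upwards [(g.translate r).toL2_ae, trans_ae r g.toL2,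
    hmp.quasiMeasurePreserving.ae_eq_comp g.toL2_ae] with x h1 h2 h3
  rw [h1, h2]
  refine Eq.trans ?_ h3.symm
  induction x using QuotientAddGroup.induction_on with
  | H x => exact (circle_coe (g.translate r) x).trans (circle_coe g (x + r)).symm

theorem SmoothPer.toH_translate (g : SmoothPer L) (r s : ℝ) :
    (g.translate r).toH s = (g.toH s).trans r := by
  apply HPer.ext_toL2
  rw [HPer.toL2_trans, toL2_toH, toL2_toH, toL2_translate]

theorem norm_derivSymbol (n : ℤ) : ‖derivSymbol L n‖ = 2 * Real.pi / L * |(n : ℝ)| := by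
  have hL : 0 < L := Fact.out
  rw [derivSymbol_eq, norm_mul, Complex.norm_I, mul_one, Complex.norm_real, Real.norm_eq_abs,
    abs_div, abs_mul, abs_of_pos hL, abs_of_pos (by positivity : 0 < 2 * Real.pi)]
  ring

/-- Frequency by frequency this is `norm_exp_mul_I_sub_le` at 2πrn/L, whose square is r² times the
modulus of the symbol of the second derivative. -/
theorem norm_trans_sub_le {u u' u'' : L2per L} (h1 : ∀ n, fc u' n = derivSymbol L n * fc u n)
    (h2 : ∀ n, fc u'' n = derivSymbol L n * fc u' n) (r : ℝ) :
    ‖trans L r u - u - r • u'‖ ≤ 2 * r ^ 2 * ‖u''‖ := by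
  refine norm_le_of_fc_le (by positivity) fun n => ?_
  set y : ℝ := 2 * Real.pi * n / L
  have hy : derivSymbol L n = y * Complex.I := derivSymbol_eq n
  have hn : ‖(y : ℂ) * Complex.I‖ = |y| := by simp
  have h3 := norm_exp_mul_I_sub_le (r * y)
  rw [fc_sub, fc_sub, fc_trans, fc_smul, h2, h1, fourier_coe_eq_exp, hy]
  have h4 : Complex.exp (r * (y * Complex.I)) * fc u n - fc u n - r * (y * Complex.I * fc u n)
      = (Complex.exp (((r * y : ℝ) : ℂ) * Complex.I) - 1 - ((r * y : ℝ) : ℂ) * Complex.I)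
        * fc u n := by
    push_cast
    ring_nf
  rw [h4, norm_mul, norm_mul (_ * Complex.I), norm_mul (_ * Complex.I), hn]
  have h5 : 2 * r ^ 2 * (|y| * (|y| * ‖fc u n‖)) = 2 * (r * y) ^ 2 * ‖fc u n‖ := by
    rw [mul_pow, ← sq_abs y]
    ring
  rw [h5]
  exact mul_le_mul_of_nonneg_right h3 (norm_nonneg _)

theorem hasDerivAt_trans {u u' u'' : L2per L} (h1 : ∀ n, fc u' n = derivSymbol L n * fc u n)
    (h2 : ∀ n, fc u'' n = derivSymbol L n * fc u' n) (r : ℝ) :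
    HasDerivAt (fun r => trans L r u) (trans L r u') r := by
  rw [hasDerivAt_iff_isLittleO_nhds_zero]
  refine Asymptotics.IsBigO.trans_isLittleO (g := fun h : ℝ => h ^ 2) ?_ ?_
  · refine Asymptotics.IsBigO.of_bound (2 * ‖u''‖) (Eventually.of_forall fun h => ?_)
    have h3 : trans L (r + h) u - trans L r u - h • trans L r u'
        = trans L r (trans L h u - u - h • u') := by
      rw [map_sub, map_sub, map_smul, trans_trans]
    rw [h3, norm_trans, Real.norm_of_nonneg (sq_nonneg h)]
    exact (norm_trans_sub_le h1 h2 h).trans (le_of_eq (by ring))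
  · simpa using Asymptotics.isLittleO_pow_id (𝕜 := ℝ) one_lt_two

end Translation

/-! ### Pointwise bounds from absolutely summable Fourier coefficients. -/

section PointwiseSeries

variable {L : ℝ} [Fact (0 < L)]

/-- A function with absolutely summable Fourier coefficients is the sum of its Fourier series. -/
theorem ae_eq_tsum_fourier {u : L2per L} (h : Summable fun n => ‖fc u n‖) :
    ∀ᵐ x ∂(AddCircle.haarAddCircle (T := L)),
      ((u x : ℝ) : ℂ) = ∑' n, fc u n * fourier n x := by
  have hs : Summable fun n => fc u n • (fourier n : C(AddCircle L, ℂ)) :=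
    Summable.of_norm (h.congr fun n => by rw [norm_smul, fourier_norm, mul_one])
  have h1 := (hs.hasSum).mapL (ContinuousMap.toLp (E := ℂ) 2 AddCircle.haarAddCircle ℂ)
  have h2 := hasSum_fourier_series_L2 (toC u)
  have h3 : ContinuousMap.toLp (E := ℂ) 2 AddCircle.haarAddCircle ℂ
      (∑' n, fc u n • (fourier n : C(AddCircle L, ℂ))) = toC u := by
    refine h1.unique (h2.congr_fun fun n => ?_)
    rw [map_smul, ← fourierBasis_repr, ← fc_eq_repr]
  filter_upwards [toC_ae u, ContinuousMap.coeFn_toLp (p := 2) (𝕜 := ℂ) AddCircle.haarAddCircle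
      (∑' n, fc u n • (fourier n : C(AddCircle L, ℂ)))] with x hx1 hx2
  rw [h3] at hx2
  rw [← hx1, hx2]
  exact (ContinuousMap.hasSum_apply hs.hasSum x).tsum_eq.symm

theorem ae_abs_le_tsum {u : L2per L} (h : Summable fun n => ‖fc u n‖) :
    ∀ᵐ x ∂(AddCircle.haarAddCircle (T := L)), |u x| ≤ ∑' n, ‖fc u n‖ := by
  filter_upwards [ae_eq_tsum_fourier h] with x hx
  rw [← Real.norm_eq_abs, ← Complex.norm_real, hx]
  have h1 : ∀ n, ‖fc u n * fourier n x‖ = ‖fc u n‖ := fun n => by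
    rw [norm_mul, fourier_apply, Circle.norm_coe, mul_one]
  refine (norm_tsum_le_tsum_norm (h.congr fun n => (h1 n).symm)).trans (le_of_eq ?_)
  exact tsum_congr h1

theorem summable_wt_rpow {r : ℝ} (hr : 1 / 2 < r) : Summable fun n : ℤ => wt n ^ (-r) := by
  have h1 := Real.summable_abs_int_rpow (b := 2 * r) (by linarith)
  -- At n = 0 the power |n|^(-2r) is 0 by convention and does not dominate the weight 1; this
  -- indicator makes up for it.
  have h2 : Summable fun n : ℤ => if n = 0 then (1 : ℝ) else 0 :=
    summable_of_ne_finset_zero (s := {0}) fun n hn => by simpa using hn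
  refine Summable.of_nonneg_of_le (fun n => Real.rpow_nonneg (wt_pos n).le _) (fun n => ?_)
    (h1.add h2)
  rcases eq_or_ne n 0 with rfl | hn
  · have h3 : wt 0 = 1 := by simp [wt]
    rw [h3, Real.one_rpow, if_pos rfl]
    exact le_add_of_nonneg_left (Real.rpow_nonneg (abs_nonneg _) _)
  · rw [if_neg hn, add_zero]
    have h3 : (0 : ℝ) < |(n : ℝ)| := abs_pos.2 (by exact_mod_cast hn)
    have h4 : |(n : ℝ)| ^ (-(2 * r)) = (|(n : ℝ)| ^ 2) ^ (-r) := by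
      rw [← Real.rpow_natCast, ← Real.rpow_mul h3.le]
      norm_num
    rw [h4]
    refine Real.rpow_le_rpow_of_nonpos (by positivity) ?_ (by linarith)
    rw [sq_abs, wt]
    linarith

variable (L) in
/-- The Sobolev embedding of `H^r`, `r > 1/2`, into the functions with absolutely summable
Fourier coefficients. -/
theorem exists_tsum_norm_fc_le {r : ℝ} (hr : 1 / 2 < r) : ∃ C, 0 < C ∧ ∀ u : HPer L r,
    (Summable fun n => ‖fc u.toL2 n‖) ∧ ∑' n, ‖fc u.toL2 n‖ ≤ C * ‖u‖ := by
  have hL : 0 < √L := Real.sqrt_pos.2 Fact.out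
  set S : ℝ := ∑' n : ℤ, wt n ^ (-r) with hS
  have hS0 : 0 < S := (summable_wt_rpow hr).tsum_pos
    (fun n => Real.rpow_nonneg (wt_pos n).le _) 0 (Real.rpow_pos_of_pos (wt_pos 0) _)
  refine ⟨√S * (√L)⁻¹, by positivity, fun u => ?_⟩
  have h1 : ∀ n : ℤ, (wt n ^ (-r / 2)) ^ (2 : ℝ) = wt n ^ (-r) := fun n => by
    rw [Real.rpow_two, wt_rpow_half_sq]
  have hw := hasSum_norm_sq_fc (besselPot L r u)
  have h2 : ∀ n : ℤ, wt n ^ (-r / 2) * ‖fc (besselPot L r u) n‖ = ‖fc u.toL2 n‖ := fun n => by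
    rw [fc_besselPot, norm_mul, Complex.norm_real,
      Real.norm_of_nonneg (Real.rpow_nonneg (wt_pos n).le _), ← mul_assoc,
      ← Real.rpow_add (wt_pos n), neg_div, neg_add_cancel, Real.rpow_zero, one_mul]
  -- Cauchy–Schwarz, after splitting |û(n)| as (1 + n²)^(-r/2) times (1 + n²)^(r/2)|û(n)|.
  have key := Real.summable_and_inner_le_Lp_mul_Lq_tsum_of_nonneg
    (f := fun n : ℤ => wt n ^ (-r / 2)) (g := fun n => ‖fc (besselPot L r u) n‖)
    Real.HolderConjugate.two_two (fun n => Real.rpow_nonneg (wt_pos n).le _)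
    (fun n => norm_nonneg _) ((summable_wt_rpow hr).congr fun n => (h1 n).symm)
    (hw.summable.congr fun n => (Real.rpow_two _).symm)
  simp only [h2, h1, Real.rpow_two, hw.tsum_eq, ← Real.sqrt_eq_rpow, ← hS] at key
  refine ⟨key.1, key.2.trans (le_of_eq ?_)⟩
  rw [Real.sqrt_sq (norm_nonneg _), u.norm_eq, mul_assoc, ← mul_assoc _ (√L),
    inv_mul_cancel₀ hL.ne', one_mul]

end PointwiseSeries

/-! ### Projection on finitely many frequencies; density of smooth functions. -/

section LowPass

variable {L : ℝ} [Fact (0 < L)]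

/-- Only finitely many frequencies survive, so an unbounded symbol such as that of the derivative or
of M becomes bounded. -/
theorem isRealSymbol_lowPass (N : ℕ) {c : ℤ → ℂ} (hc : ∀ n, c (-n) = (starRingEnd ℂ) (c n)) :
    IsRealSymbol fun n => if |n| ≤ N then c n else 0 where
  bounded := by
    refine ⟨∑ n ∈ Finset.Icc (-(N : ℤ)) N, ‖c n‖, fun n => ?_⟩
    split_ifs with h
    · exact Finset.single_le_sum (f := fun n => ‖c n‖) (fun _ _ => norm_nonneg _)
        (Finset.mem_Icc.2 (abs_le.1 h))
    · rw [norm_zero]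
      exact Finset.sum_nonneg fun _ _ => norm_nonneg _
  conj n := by
    rw [abs_neg]
    split_ifs
    · exact hc n
    · rw [map_zero]

variable (L) in
/-- The multiplier with symbol `c` restricted to the frequencies `|n| ≤ N`. -/
def lowMult (N : ℕ) {c : ℤ → ℂ} (hc : ∀ n, c (-n) = (starRingEnd ℂ) (c n)) :
    L2per L →L[ℝ] L2per L := mult L (isRealSymbol_lowPass N hc)

theorem fc_lowMult (N : ℕ) {c : ℤ → ℂ} (hc : ∀ n, c (-n) = (starRingEnd ℂ) (c n)) (u : L2per L)
    (n : ℤ) : fc (lowMult L N hc u) n = (if |n| ≤ N then c n else 0) * fc u n :=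
  fc_mult _ u n

variable (L) in
/-- The projection on the frequencies `|n| ≤ N`. -/
def lowPass (N : ℕ) : L2per L →L[ℝ] L2per L :=
  lowMult L N (c := fun _ => 1) fun _ => (map_one _).symm

theorem fc_lowPass (N : ℕ) (u : L2per L) (n : ℤ) :
    fc (lowPass L N u) n = if |n| ≤ N then fc u n else 0 := by
  rw [lowPass, fc_lowMult, ite_mul, one_mul, zero_mul]

theorem norm_fc_lowPass_le (N : ℕ) (u : L2per L) (n : ℤ) :
    ‖fc (lowPass L N u) n‖ ≤ ‖fc u n‖ := by
  rw [fc_lowPass]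
  split_ifs
  · exact le_rfl
  · rw [norm_zero]
    exact norm_nonneg _

/-- The projection on the frequencies `|n| ≤ N`, in `H^s`. -/
def HPer.lowPass {s : ℝ} (N : ℕ) (u : HPer L s) : HPer L s :=
  HPer.mk (PerWave.lowPass L N u.toL2) <|
    Summable.of_nonneg_of_le
      (fun n => mul_nonneg (Real.rpow_nonneg (wt_pos n).le _) (sq_nonneg _))
      (fun n => mul_le_mul_of_nonneg_left
        (pow_le_pow_left₀ (norm_nonneg _) (norm_fc_lowPass_le N u.toL2 n) 2)
        (Real.rpow_nonneg (wt_pos n).le _)) u.summable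

theorem HPer.toL2_lowPass {s : ℝ} (N : ℕ) (u : HPer L s) :
    (u.lowPass N).toL2 = PerWave.lowPass L N u.toL2 := HPer.toL2_mk _ _

/-- Parseval, then dominated convergence over the frequencies: each coefficient of the difference
vanishes for large N and is dominated by that of u. -/
theorem tendsto_lowPass (u : L2per L) : Tendsto (fun N => lowPass L N u) atTop (𝓝 u) := by
  rw [tendsto_iff_norm_sub_tendsto_zero]
  have h1 : ∀ N, ‖lowPass L N u - u‖ ^ 2 = ∑' n, ‖fc (lowPass L N u - u) n‖ ^ 2 := fun N =>
    (hasSum_norm_sq_fc _).tsum_eq.symm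
  have h2 : Tendsto (fun N => ∑' n, ‖fc (lowPass L N u - u) n‖ ^ 2) atTop
      (𝓝 (∑' _ : ℤ, (0 : ℝ))) := by
    refine tendsto_tsum_of_dominated_convergence (summable_fc_sq u) (fun n => ?_)
      (Eventually.of_forall fun N n => ?_)
    · refine tendsto_const_nhds.congr' ?_
      filter_upwards [eventually_ge_atTop n.natAbs] with N hN
      have : |n| ≤ (N : ℤ) := by rw [Int.abs_eq_natAbs]; exact_mod_cast hN
      rw [fc_sub, fc_lowPass, if_pos this, sub_self, norm_zero]
      norm_num
    · rw [fc_sub, fc_lowPass]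
      split_ifs
      · simp
      · simp
  simp_rw [← h1, tsum_zero] at h2
  have h3 := h2.sqrt
  simpa [Real.sqrt_sq (norm_nonneg _)] using h3

theorem besselPot_lowPass {s : ℝ} (N : ℕ) (u : HPer L s) :
    besselPot L s (u.lowPass N) = lowPass L N (besselPot L s u) := by
  refine ext_fc fun n => ?_
  rw [fc_besselPot, HPer.toL2_lowPass, fc_lowPass, fc_lowPass, fc_besselPot]
  split_ifs <;> simp

theorem HPer.tendsto_lowPass {s : ℝ} (u : HPer L s) :
    Tendsto (fun N => u.lowPass N) atTop (𝓝 u) := by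
  rw [tendsto_iff_norm_sub_tendsto_zero]
  simp_rw [HPer.norm_eq, map_sub, besselPot_lowPass]
  have h := (tendsto_iff_norm_sub_tendsto_zero.1
    (PerWave.tendsto_lowPass (besselPot L s u))).const_mul √L
  simpa using h

/-- Trigonometric polynomials are smooth. -/
theorem exists_smoothPer_lowPass (N : ℕ) (u : L2per L) :
    ∃ g : SmoothPer L, g.toL2 = lowPass L N u := by
  set s : Finset ℤ := Finset.Icc (-(N : ℤ)) N
  let g : SmoothPer L :=
    { toFun := fun x => ∑ n ∈ s, (fc u n * Complex.exp (x * derivSymbol L n)).re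
      smooth := by
        refine ContDiff.sum fun n _ => ?_
        refine Complex.reCLM.contDiff.comp (contDiff_const.mul ?_)
        exact (Complex.ofRealCLM.contDiff.mul contDiff_const).cexp
      periodic := fun x => by
        refine Finset.sum_congr rfl fun n _ => ?_
        rw [← fourier_coe_eq_exp, ← fourier_coe_eq_exp, AddCircle.coe_add_period] }
  refine ⟨g, ?_⟩
  have h0 : ∀ n ∉ s, fc (lowPass L N u) n = 0 := fun n hn => by
    rw [fc_lowPass, if_neg]
    rwa [abs_le, ← Finset.mem_Icc]
  have hs : Summable fun n => ‖fc (lowPass L N u) n‖ :=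
    summable_of_ne_finset_zero (s := s) fun n hn => by rw [h0 n hn, norm_zero]
  ext1
  filter_upwards [g.toL2_ae, ae_eq_tsum_fourier hs] with x h1 h2
  rw [tsum_eq_sum (s := s) fun n hn => by rw [h0 n hn, zero_mul]] at h2
  have h3 := congrArg Complex.re h2
  rw [Complex.ofReal_re] at h3
  rw [h1, h3, Complex.re_sum]
  induction x using QuotientAddGroup.induction_on with
  | H x =>
    refine (SmoothPer.circle_coe g x).trans ?_
    change ∑ n ∈ s, (fc u n * Complex.exp (x * derivSymbol L n)).re = _
    refine Finset.sum_congr rfl fun n hn => ?_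
    rw [fc_lowPass, if_pos (abs_le.2 (Finset.mem_Icc.1 hn)), ← fourier_coe_eq_exp]

theorem HPer.exists_smoothPer_lowPass {s : ℝ} (N : ℕ) (u : HPer L s) :
    ∃ g : SmoothPer L, g.toH s = u.lowPass N := by
  obtain ⟨g, hg⟩ := PerWave.exists_smoothPer_lowPass N u.toL2
  refine ⟨g, HPer.ext_toL2 ?_⟩
  rw [HPer.toL2_lowPass, ← hg, SmoothPer.toL2_toH]

/-- Smooth functions are dense in `H^s`. -/
theorem HPer.dense_smooth (s : ℝ) : DenseRange (SmoothPer.toH (L := L) s) := fun u => by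
  refine mem_closure_of_tendsto u.tendsto_lowPass (Eventually.of_forall fun N => ?_)
  obtain ⟨g, hg⟩ := u.exists_smoothPer_lowPass N
  exact ⟨g, hg⟩

end LowPass

/-! ### Primitives of Lipschitz functions and Lipschitz truncation. -/

section Primitive

/-- The remainder is the integral of g(y) - g(a) over an interval of length |b|, on which the
integrand is at most K|b|. -/
theorem abs_primitive_sub_le {g : ℝ → ℝ} {K : NNReal} (hg : LipschitzWith K g) (a b : ℝ) :
    |(∫ y in (0 : ℝ)..(a + b), g y) - (∫ y in (0 : ℝ)..a, g y) - g a * b| ≤ K * b ^ 2 := by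
  have hi : ∀ c d : ℝ, IntervalIntegrable g volume c d := fun c d =>
    hg.continuous.intervalIntegrable c d
  have h1 : (∫ y in (0 : ℝ)..(a + b), g y) - (∫ y in (0 : ℝ)..a, g y) - g a * b
      = ∫ y in a..(a + b), (g y - g a) := by
    rw [intervalIntegral.integral_interval_sub_left (hi _ _) (hi _ _),
      intervalIntegral.integral_sub (hi _ _) (by simp), intervalIntegral.integral_const]
    simp [mul_comm]
  have h2 := intervalIntegral.norm_integral_le_of_norm_le_const (a := a) (b := a + b)
    (f := fun y => g y - g a) (C := K * |b|) fun y hy => by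
      refine (hg.norm_sub_le y a).trans (mul_le_mul_of_nonneg_left ?_ K.2)
      have := abs_sub_left_of_mem_uIcc (uIoc_subset_uIcc hy)
      simpa [Real.norm_eq_abs] using this
  rw [h1, ← Real.norm_eq_abs]
  refine h2.trans (le_of_eq ?_)
  rw [add_sub_cancel_left, mul_assoc, abs_mul_abs_self, sq]

/-- Along functions bounded by B nothing changes if f is replaced by g, and for g the superposition
operator and the potential energy behave well on all of `L²`. -/
theorem exists_lipschitz_eqOn {f : ℝ → ℝ} (hf : ContDiff ℝ ∞ f) (B : ℝ) :
    ∃ (K : NNReal) (g : ℝ → ℝ), LipschitzWith K g ∧ ∀ y, |y| ≤ B → g y = f y := by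
  obtain ⟨K, hK⟩ := (hf.contDiffOn (s := Icc (-B) B)).exists_lipschitzOnWith (by simp)
    (convex_Icc _ _) isCompact_Icc
  obtain ⟨g, hg, hfg⟩ := hK.extend_real
  exact ⟨K, g, hg, fun y hy => (hfg (abs_le.1 hy)).symm⟩

theorem primitive_eq_of_eqOn {f g : ℝ → ℝ} {B : ℝ} (h : ∀ y, |y| ≤ B → g y = f y) {a : ℝ}
    (ha : |a| ≤ B) : ∫ y in (0 : ℝ)..a, g y = ∫ y in (0 : ℝ)..a, f y := by
  refine intervalIntegral.integral_congr fun y hy => h y ?_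
  have := abs_sub_left_of_mem_uIcc hy
  simp only [sub_zero] at this
  exact this.trans ha

end Primitive

/-! ### Superposition operators and the potential energy on `L²`. -/

section Superposition

variable {L : ℝ} [Fact (0 < L)]

theorem integral_eq_haar (F : AddCircle L → ℝ) :
    ∫ x, F x = L * ∫ x, F x ∂AddCircle.haarAddCircle := by
  have hL : 0 < L := Fact.out
  rw [AddCircle.integral_haarAddCircle, smul_eq_mul, mul_inv_cancel_left₀ hL.ne']

theorem memLp_superposition {g : ℝ → ℝ} {K : NNReal} (hg : LipschitzWith K g) (u : L2per L) :
    MemLp (fun x => g (u x)) 2 AddCircle.haarAddCircle := by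
  refine MemLp.of_le (((memLp_const |g 0|).add ((Lp.memLp u).norm.const_mul (K : ℝ))))
    (hg.continuous.comp_aestronglyMeasurable (Lp.aestronglyMeasurable u))
    (Eventually.of_forall fun x => ?_)
  have h1 := hg.norm_sub_le (u x) 0
  have h2 : ‖g (u x)‖ ≤ |g 0| + K * ‖u x‖ := by
    have h3 := norm_add_le (g 0) (g (u x) - g 0)
    rw [add_sub_cancel] at h3
    rw [sub_zero] at h1
    exact h3.trans (by rw [Real.norm_eq_abs (g 0)]; linarith)
  exact h2.trans (le_abs_self _)

/-- The superposition operator `u ↦ g ∘ u` of a Lipschitz function. -/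
def superposition {g : ℝ → ℝ} {K : NNReal} (hg : LipschitzWith K g) (u : L2per L) : L2per L :=
  (memLp_superposition hg u).toLp _

theorem superposition_ae {g : ℝ → ℝ} {K : NNReal} (hg : LipschitzWith K g) (u : L2per L) :
    superposition hg u =ᵐ[AddCircle.haarAddCircle] fun x => g (u x) := MemLp.coeFn_toLp _

theorem lipschitz_superposition {g : ℝ → ℝ} {K : NNReal} (hg : LipschitzWith K g) :
    LipschitzWith K (superposition (L := L) hg) := by
  refine LipschitzWith.of_dist_le_mul fun u v => ?_
  rw [dist_eq_norm, dist_eq_norm]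
  refine Lp.norm_le_mul_norm_of_ae_le_mul ?_
  filter_upwards [superposition_ae hg u, superposition_ae hg v, Lp.coeFn_sub u v,
    Lp.coeFn_sub (superposition hg u) (superposition hg v)] with x h1 h2 h3 h4
  rw [h3, h4, Pi.sub_apply, Pi.sub_apply, h1, h2]
  exact hg.norm_sub_le _ _

variable (L) in
/-- The potential energy `∫₀ᴸ W(u) dx`, `W(y) = ∫₀^y g`. -/
def potential (g : ℝ → ℝ) (u : L2per L) : ℝ := ∫ x : AddCircle L, ∫ y in (0 : ℝ)..(u x), g y

theorem potential_eq_haar (g : ℝ → ℝ) (u : L2per L) :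
    potential L g u = L * ∫ x, (∫ y in (0 : ℝ)..(u x), g y) ∂AddCircle.haarAddCircle :=
  integral_eq_haar _

theorem integrable_inner_mul (u v : L2per L) :
    Integrable (fun x => u x * v x) AddCircle.haarAddCircle :=
  (Lp.memLp u).integrable_mul (Lp.memLp v)

theorem inner_eq_integral (u v : L2per L) :
    inner ℝ u v = ∫ x, u x * v x ∂AddCircle.haarAddCircle := by
  rw [L2.inner_def]
  refine integral_congr_ae (Eventually.of_forall fun x => ?_)
  simp [mul_comm]

theorem integrable_primitive {g : ℝ → ℝ} {K : NNReal} (hg : LipschitzWith K g) (u : L2per L) :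
    Integrable (fun x => ∫ y in (0 : ℝ)..(u x), g y) AddCircle.haarAddCircle := by
  have hc : Continuous fun a : ℝ => ∫ y in (0 : ℝ)..a, g y :=
    intervalIntegral.continuous_primitive (fun c d => hg.continuous.intervalIntegrable c d) 0
  have hu : Integrable (fun x => u x) AddCircle.haarAddCircle :=
    (Lp.memLp u).integrable (by norm_num)
  refine Integrable.mono' ((hu.norm.const_mul |g 0|).add
    ((integrable_inner_mul u u).const_mul (K : ℝ)))
    (hc.comp_aestronglyMeasurable (Lp.aestronglyMeasurable u)) (Eventually.of_forall fun x => ?_)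
  have h := abs_primitive_sub_le hg 0 (u x)
  rw [zero_add, intervalIntegral.integral_same, sub_zero] at h
  have h2 := abs_sub_abs_le_abs_sub (∫ y in (0 : ℝ)..(u x), g y) (g 0 * u x)
  rw [abs_mul] at h2
  rw [Real.norm_eq_abs, Pi.add_apply, Real.norm_eq_abs, ← sq]
  linarith

/-- `abs_primitive_sub_le` integrated over the circle. The remainder is quadratic in the `L²` norm,
so the potential of a Lipschitz nonlinearity is differentiable on `L²` itself. -/
theorem abs_potential_sub_le {g : ℝ → ℝ} {K : NNReal} (hg : LipschitzWith K g) (u v : L2per L) :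
    |potential L g (u + v) - potential L g u - L * inner ℝ (superposition hg u) v|
      ≤ L * (K * ‖v‖ ^ 2) := by
  have hL : 0 < L := Fact.out
  have h1 : potential L g (u + v) - potential L g u - L * inner ℝ (superposition hg u) v
      = L * ∫ x, ((∫ y in (0 : ℝ)..((u + v) x), g y) - (∫ y in (0 : ℝ)..(u x), g y)
          - superposition hg u x * v x) ∂AddCircle.haarAddCircle := by
    have h2 : Integrable (fun x => (∫ y in (0 : ℝ)..((u + v) x), g y)
        - ∫ y in (0 : ℝ)..(u x), g y) AddCircle.haarAddCircle :=
      (integrable_primitive hg _).sub (integrable_primitive hg _)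
    rw [integral_sub h2 (integrable_inner_mul _ _), integral_sub (integrable_primitive hg _)
      (integrable_primitive hg _), potential_eq_haar, potential_eq_haar, inner_eq_integral]
    ring
  rw [h1, abs_mul, abs_of_pos hL, ← real_inner_self_eq_norm_sq, inner_eq_integral,
    ← integral_const_mul]
  refine mul_le_mul_of_nonneg_left ?_ hL.le
  refine (Real.norm_eq_abs _).symm.le.trans <|
    norm_integral_le_of_norm_le ((integrable_inner_mul v v).const_mul _) ?_
  filter_upwards [superposition_ae hg u, Lp.coeFn_add u v] with x h2 h3
  rw [h2, h3, Pi.add_apply, ← sq]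
  exact abs_primitive_sub_le hg (u x) (v x)

theorem hasFDerivAt_potential {g : ℝ → ℝ} {K : NNReal} (hg : LipschitzWith K g) (u : L2per L) :
    HasFDerivAt (potential L g) (L • innerSL ℝ (superposition hg u)) u := by
  rw [hasFDerivAt_iff_isLittleO_nhds_zero]
  refine Asymptotics.IsBigO.trans_isLittleO (g := fun h : L2per L => ‖h‖ ^ 2) ?_ ?_
  · refine Asymptotics.IsBigO.of_bound (L * K) (Eventually.of_forall fun h => ?_)
    have h1 := abs_potential_sub_le hg u h
    rw [norm_pow, norm_norm, mul_assoc]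
    exact h1
  · simpa using Asymptotics.isLittleO_norm_pow_id (E' := L2per L) one_lt_two

theorem potential_trans (g : ℝ → ℝ) (r : ℝ) (u : L2per L) :
    potential L g (trans L r u) = potential L g u := by
  rw [potential_eq_haar, potential_eq_haar]
  congr 1
  have h1 := integral_add_right_eq_self (μ := AddCircle.haarAddCircle (T := L))
    (fun x => ∫ y in (0 : ℝ)..(u x), g y) (r : AddCircle L)
  rw [← h1]
  refine integral_congr_ae ?_
  filter_upwards [trans_ae r u] with x hx
  rw [hx]

/-- Formally ∫ g(u)u' = ∫ (W(u))' = 0. It is obtained by differentiating the potential energy, which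
is translation invariant, along the translates of u; u'' in `L²` ensures that these are
differentiable. -/
theorem inner_superposition_deriv {g : ℝ → ℝ} {K : NNReal} (hg : LipschitzWith K g)
    {u u' u'' : L2per L} (h1 : ∀ n, fc u' n = derivSymbol L n * fc u n)
    (h2 : ∀ n, fc u'' n = derivSymbol L n * fc u' n) :
    inner ℝ (superposition hg u) u' = 0 := by
  have hL : 0 < L := Fact.out
  have h3 := hasDerivAt_trans h1 h2 0
  rw [trans_zero] at h3
  have h4 : HasFDerivAt (potential L g) (L • innerSL ℝ (superposition hg u)) (trans L 0 u) := by
    rw [trans_zero]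
    exact hasFDerivAt_potential hg u
  have h5 := h4.comp_hasDerivAt (0 : ℝ) h3
  have h6 : potential L g ∘ (fun r => trans L r u) = fun _ => potential L g u :=
    funext fun r => potential_trans g r u
  rw [h6] at h5
  have h7 := h5.unique (hasDerivAt_const (0 : ℝ) (potential L g u))
  rw [smul_apply, innerSL_apply_apply, smul_eq_mul] at h7
  exact (mul_eq_zero.1 h7).resolve_left hL.ne'

end Superposition

/-! ### Conservation laws for a Lipschitz nonlinearity by frequency truncation. -/

section Galerkin

variable {L : ℝ}

variable (L) in
theorem derivSymbol_conj_neg (n : ℤ) :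
    derivSymbol L (-n) = (starRingEnd ℂ) (derivSymbol L n) := by
  rw [conj_derivSymbol, derivSymbol_neg]

theorem conj_lowDerivSymbol (N : ℕ) (n : ℤ) :
    (starRingEnd ℂ) (if |n| ≤ N then derivSymbol L n else 0)
      = -(if |n| ≤ N then derivSymbol L n else 0) := by
  split_ifs
  · exact conj_derivSymbol n
  · simp

variable [Fact (0 < L)]

variable (L) in
/-- The derivative of the projection on the frequencies `|n| ≤ N`. -/
def lowDeriv (N : ℕ) : L2per L →L[ℝ] L2per L := lowMult L N (derivSymbol_conj_neg L)

theorem fc_lowDeriv (N : ℕ) (u : L2per L) (n : ℤ) :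
    fc (lowDeriv L N u) n = (if |n| ≤ N then derivSymbol L n else 0) * fc u n := fc_lowMult _ _ _ _

theorem norm_lowDeriv_le (N : ℕ) (u : L2per L) :
    ‖lowDeriv L N u‖ ≤ 2 * Real.pi / L * N * ‖u‖ := by
  have hL : 0 < L := Fact.out
  refine norm_mult_le (isRealSymbol_lowPass N (derivSymbol_conj_neg L)) (fun n => ?_) u
  split_ifs with h
  · rw [norm_derivSymbol]
    refine mul_le_mul_of_nonneg_left ?_ (by positivity)
    exact_mod_cast h
  · rw [norm_zero]
    positivity

theorem inner_lowDeriv (N : ℕ) (u v : L2per L) :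
    inner ℝ (lowDeriv L N u) v = -inner ℝ u (lowDeriv L N v) :=
  inner_mult_skew (isRealSymbol_lowPass N (derivSymbol_conj_neg L))
    (conj_lowDerivSymbol N) u v

theorem inner_lowDeriv_self (N : ℕ) (u : L2per L) : inner ℝ u (lowDeriv L N u) = 0 :=
  inner_mult_skew_self (isRealSymbol_lowPass N (derivSymbol_conj_neg L))
    (conj_lowDerivSymbol N) u

variable (L) in
/-- The multiplier `θ` on the frequencies `|n| ≤ N`. -/
def lowSymbol {θ : ℝ → ℝ} (hθ : ∀ k, θ (-k) = θ k) (N : ℕ) : L2per L →L[ℝ] L2per L :=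
  lowMult L N (c := fun n : ℤ => ((θ n : ℝ) : ℂ)) fun n => by
    rw [Complex.conj_ofReal, Int.cast_neg, hθ]

theorem fc_lowSymbol {θ : ℝ → ℝ} (hθ : ∀ k, θ (-k) = θ k) (N : ℕ) (u : L2per L) (n : ℤ) :
    fc (lowSymbol L hθ N u) n = (if |n| ≤ N then (θ n : ℂ) else 0) * fc u n := fc_lowMult _ _ _ _

theorem inner_lowSymbol {θ : ℝ → ℝ} (hθ : ∀ k, θ (-k) = θ k) (N : ℕ) (u v : L2per L) :
    inner ℝ (lowSymbol L hθ N u) v = inner ℝ u (lowSymbol L hθ N v) := by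
  refine (hasSum_inner_fc _ _).unique ((hasSum_inner_fc _ _).congr_fun fun n => ?_)
  rw [fc_lowSymbol, fc_lowSymbol, map_mul]
  split_ifs
  · rw [Complex.conj_ofReal]
    ring_nf
  · simp

theorem lowSymbol_lowPass {θ : ℝ → ℝ} (hθ : ∀ k, θ (-k) = θ k) (N : ℕ) (u : L2per L) :
    lowSymbol L hθ N (lowPass L N u) = lowSymbol L hθ N u := by
  refine ext_fc fun n => ?_
  rw [fc_lowSymbol, fc_lowSymbol, fc_lowPass]
  split_ifs <;> simp

theorem lowDeriv_lowPass (N : ℕ) (u : L2per L) :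
    lowDeriv L N (lowPass L N u) = lowDeriv L N u := by
  refine ext_fc fun n => ?_
  rw [fc_lowDeriv, fc_lowDeriv, fc_lowPass]
  split_ifs <;> simp

/-- The derivative is skew, M is symmetric and they commute. Hence the dispersive term does not
change the momentum. -/
theorem inner_lowDeriv_lowSymbol {θ : ℝ → ℝ} (hθ : ∀ k, θ (-k) = θ k) (N : ℕ) (u : L2per L) :
    inner ℝ (lowDeriv L N u) (lowSymbol L hθ N u) = 0 := by
  have h1 := inner_lowDeriv N u (lowSymbol L hθ N u)
  have h2 : lowDeriv L N (lowSymbol L hθ N u) = lowSymbol L hθ N (lowDeriv L N u) := by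
    refine ext_fc fun n => ?_
    rw [fc_lowDeriv, fc_lowSymbol, fc_lowSymbol, fc_lowDeriv]
    ring
  rw [h2, ← inner_lowSymbol hθ N u, real_inner_comm (lowDeriv L N u)] at h1
  linarith

/-- The exact cancellation needs the projected function inside g. With the full u there instead, an
error remains, and it is the only one in the Galerkin argument. -/
theorem inner_superposition_lowDeriv {g : ℝ → ℝ} {K : NNReal} (hg : LipschitzWith K g) (N : ℕ)
    (u : L2per L) :
    inner ℝ (superposition hg (lowPass L N u)) (lowDeriv L N u) = 0 := by
  refine inner_superposition_deriv hg (u'' := lowDeriv L N (lowDeriv L N u)) (fun n => ?_)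
    fun n => ?_
  · rw [fc_lowDeriv, fc_lowPass]
    split_ifs <;> simp
  · rw [fc_lowDeriv, fc_lowDeriv]
    split_ifs <;> simp

/-- A function with derivative `O(1/N)` which is the `N`-th term of a sequence has vanishing
increments in the limit. -/
theorem tendsto_increment {e e' : ℕ → ℝ → ℝ} {T C : ℝ} (hT : 0 ≤ T)
    (h : ∀ N, ∀ t ∈ Icc 0 T, HasDerivAt (e N) (e' N t) t)
    (hC : ∀ N : ℕ, ∀ t ∈ Icc 0 T, N * |e' N t| ≤ C) :
    Tendsto (fun N => e N T - e N 0) atTop (𝓝 0) := by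
  have h1 : ∀ N : ℕ, 0 < N → ‖e N T - e N 0‖ ≤ C * T / N := fun N hN => by
    have hN' : (0 : ℝ) < N := by exact_mod_cast hN
    have h2 := (convex_Icc (0 : ℝ) T).norm_image_sub_le_of_norm_hasDerivWithin_le (C := C / N)
      (fun t ht => (h N t ht).hasDerivWithinAt)
      (fun t ht => by
        rw [le_div_iff₀ hN', mul_comm]
        exact hC N t ht) (left_mem_Icc.2 hT) (right_mem_Icc.2 hT)
    refine h2.trans (le_of_eq ?_)
    rw [sub_zero, Real.norm_of_nonneg hT]
    ring
  refine squeeze_zero_norm' ?_ (tendsto_const_div_atTop_nhds_zero_nat (C * T))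
  filter_upwards [eventually_gt_atTop 0] with N hN using h1 N hN

/-- Conservation laws for the equation with a globally Lipschitz nonlinearity, by Galerkin
projection. -/
theorem galerkin_conservation {g : ℝ → ℝ} {K : NNReal} (hg : LipschitzWith K g) {θ : ℝ → ℝ}
    (hθ : ∀ k, θ (-k) = θ k) {T : ℝ} (hT : 0 ≤ T) {U : ℝ → L2per L} (hU : Continuous U)
    (heq : ∀ n : ℤ, ∀ t ∈ Icc 0 T, fc (U t) n = fc (U 0) n + ∫ τ in (0 : ℝ)..t,
      derivSymbol L n * ((θ n : ℂ) * fc (U τ) n - fc (superposition hg (U τ)) n))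
    {C : ℝ} (h1 : ∀ t ∈ Icc 0 T, ∀ N : ℕ, N ^ 2 * ‖U t - lowPass L N (U t)‖ ≤ C)
    (h2 : ∀ t ∈ Icc 0 T, ∀ N, ‖lowSymbol L hθ N (U t)‖ ≤ C) :
    ‖U T‖ = ‖U 0‖ ∧
    Tendsto (fun N =>
      (L / 2 * inner ℝ (lowSymbol L hθ N (U T)) (U T) - potential L g (lowPass L N (U T)))
      - (L / 2 * inner ℝ (lowSymbol L hθ N (U 0)) (U 0) - potential L g (lowPass L N (U 0))))
      atTop (𝓝 0) := by
  have hL : 0 < L := Fact.out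
  have h0T : (0 : ℝ) ∈ Icc 0 T := left_mem_Icc.2 hT
  have hTT : T ∈ Icc 0 T := right_mem_Icc.2 hT
  have hS : Continuous fun t => superposition hg (U t) :=
    (lipschitz_superposition hg).continuous.comp hU
  obtain ⟨C', hC'⟩ := isCompact_Icc.exists_bound_of_continuousOn (s := Icc 0 T) hS.continuousOn
  have hC0 : 0 ≤ C := (norm_nonneg _).trans (h2 0 h0T 0)
  have hC'0 : 0 ≤ C' := (norm_nonneg _).trans (hC' 0 h0T)
  set H : ℕ → ℝ → L2per L := fun N t => lowSymbol L hθ N (U t) - superposition hg (U t) with hH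
  have hHn : ∀ N, ∀ t ∈ Icc 0 T, ‖H N t‖ ≤ C + C' := fun N t ht =>
    (norm_sub_le _ _).trans (add_le_add (h2 t ht N) (hC' t ht))
  set V : ℕ → ℝ → L2per L := fun N t => lowDeriv L N (H N t) with hV
  have hVc : ∀ N, Continuous (V N) := fun N =>
    (lowDeriv L N).continuous.comp (((lowSymbol L hθ N).continuous.comp hU).sub hS)
  -- The projection of U, written through its integral equation: this form is differentiable at
  -- every t, and `hwU` identifies it with the projection on [0, T].
  set w : ℕ → ℝ → L2per L := fun N t => lowPass L N (U 0) + ∫ τ in (0 : ℝ)..t, V N τ with hw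
  have hwd : ∀ N t, HasDerivAt (w N) (V N t) t := fun N t => by
    refine HasDerivAt.const_add _ ?_
    exact intervalIntegral.integral_hasDerivAt_right ((hVc N).intervalIntegrable _ _)
      (hVc N).stronglyMeasurable.stronglyMeasurableAtFilter (hVc N).continuousAt
  have hwU : ∀ N, ∀ t ∈ Icc 0 T, w N t = lowPass L N (U t) := fun N t ht => by
    refine ext_fc fun n => ?_
    have h3 : fc (∫ τ in (0 : ℝ)..t, V N τ) n = ∫ τ in (0 : ℝ)..t, fc (V N τ) n :=
      ((fcCLM n).intervalIntegral_comp_comm ((hVc N).intervalIntegrable 0 t)).symm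
    rw [hw, fc_add, h3, fc_lowPass, fc_lowPass]
    simp only [hV, hH, fc_lowDeriv, fc_sub, fc_lowSymbol]
    split_ifs with h
    · exact (heq n t ht).symm
    · simp
  have hdist : ∀ N : ℕ, ∀ t ∈ Icc 0 T, N ^ 2 *
      ‖superposition hg (U t) - superposition hg (lowPass L N (U t))‖ ≤ K * C := fun N t ht => by
    have h3 := (lipschitz_superposition hg).norm_sub_le (U t) (lowPass L N (U t))
    calc _ ≤ (N : ℝ) ^ 2 * (K * ‖U t - lowPass L N (U t)‖) :=
          mul_le_mul_of_nonneg_left h3 (by positivity)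
      _ = K * (N ^ 2 * ‖U t - lowPass L N (U t)‖) := by ring
      _ ≤ _ := mul_le_mul_of_nonneg_left (h1 t ht N) K.2
  -- Two derivatives beyond `L²` make g(U) - g(P_N U) of size N⁻², where P_N is the projection on
  -- |n| ≤ N, while one truncated derivative in z costs N. The pairing is therefore O(1/N), which
  -- `tendsto_increment` requires.
  have hest : ∀ (N : ℕ), ∀ t ∈ Icc 0 T, ∀ z : L2per L,
      ‖z‖ ≤ 2 * Real.pi / L * N * (C + C' + ‖U t‖) →
      N * |inner ℝ (superposition hg (U t) - superposition hg (lowPass L N (U t))) z|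
        ≤ 2 * Real.pi / L * (K * C) * (C + C' + ‖U t‖) := fun N t ht z hz => by
    have h3 := abs_real_inner_le_norm
      (superposition hg (U t) - superposition hg (lowPass L N (U t))) z
    have h4 := hdist N t ht
    calc _ ≤ (N : ℝ) * (‖superposition hg (U t) - superposition hg (lowPass L N (U t))‖
            * (2 * Real.pi / L * N * (C + C' + ‖U t‖))) := by gcongr; exact h3.trans (by gcongr)
      _ = 2 * Real.pi / L * (N ^ 2 *
          ‖superposition hg (U t) - superposition hg (lowPass L N (U t))‖)
            * (C + C' + ‖U t‖) := by ring
      _ ≤ _ := by gcongr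
  obtain ⟨B, hB⟩ := isCompact_Icc.exists_bound_of_continuousOn (s := Icc 0 T) hU.continuousOn
  have hestB : ∀ (N : ℕ), ∀ t ∈ Icc 0 T, ∀ z : L2per L,
      ‖z‖ ≤ 2 * Real.pi / L * N * (C + C' + ‖U t‖) →
      N * |inner ℝ (superposition hg (U t) - superposition hg (lowPass L N (U t))) z|
        ≤ 2 * Real.pi / L * (K * C) * (C + C' + B) := fun N t ht z hz =>
    (hest N t ht z hz).trans (by have := hB t ht; gcongr)
  constructor
  · have hd : ∀ N t, HasDerivAt (fun t => ‖w N t‖ ^ 2) (2 * inner ℝ (w N t) (V N t)) t :=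
      fun N t => (hwd N t).norm_sq
    have hlim := tendsto_increment (C := 2 * (2 * Real.pi / L * (K * C) * (C + C' + B))) hT
      (fun N t _ => hd N t) fun N t ht => by
        -- Integration by parts moves the derivative onto w. The dispersive term then vanishes, and
        -- so does the pairing with g(P_N U), which is subtracted freely.
        have h3 : inner ℝ (w N t) (V N t) = inner ℝ
            (superposition hg (U t) - superposition hg (lowPass L N (U t)))
            (lowDeriv L N (U t)) := by
          rw [hV, ← neg_eq_iff_eq_neg.2 (inner_lowDeriv N (w N t) (H N t)), hwU N t ht,
            lowDeriv_lowPass, hH, inner_sub_right, inner_lowDeriv_lowSymbol, inner_sub_left,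
            inner_superposition_lowDeriv, real_inner_comm]
          ring
        rw [h3, abs_mul, abs_two, mul_left_comm]
        refine mul_le_mul_of_nonneg_left (hestB N t ht _ ?_) zero_le_two
        refine (norm_lowDeriv_le N (U t)).trans ?_
        gcongr
        linarith
    have hlim' : Tendsto (fun N => ‖w N T‖ ^ 2 - ‖w N 0‖ ^ 2) atTop
        (𝓝 (‖U T‖ ^ 2 - ‖U 0‖ ^ 2)) := by
      simp_rw [fun N => hwU N T hTT, fun N => hwU N 0 h0T]
      exact ((tendsto_lowPass _).norm.pow 2).sub ((tendsto_lowPass _).norm.pow 2)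
    have h3 := tendsto_nhds_unique hlim' hlim
    exact (sq_eq_sq₀ (norm_nonneg _) (norm_nonneg _)).1 (sub_eq_zero.1 h3)
  · have hd : ∀ N t, HasDerivAt
        (fun t => L / 2 * inner ℝ (lowSymbol L hθ N (w N t)) (w N t) - potential L g (w N t))
        (L / 2 * (inner ℝ (lowSymbol L hθ N (w N t)) (V N t)
          + inner ℝ (lowSymbol L hθ N (V N t)) (w N t))
          - L * inner ℝ (superposition hg (w N t)) (V N t)) t := fun N t => by
      refine HasDerivAt.sub (HasDerivAt.const_mul _ ?_) ?_
      · exact HasDerivAt.inner ℝ ((lowSymbol L hθ N).hasFDerivAt.comp_hasDerivAt t (hwd N t))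
          (hwd N t)
      · have h3 := (hasFDerivAt_potential hg (w N t)).comp_hasDerivAt t (hwd N t)
        simp only [smul_apply, innerSL_apply_apply, smul_eq_mul] at h3
        exact h3
    have hlim := tendsto_increment (C := L * (2 * Real.pi / L * (K * C) * (C + C' + B))) hT
      (fun N t _ => hd N t) fun N t ht => by
        have h3 : L / 2 * (inner ℝ (lowSymbol L hθ N (w N t)) (V N t)
            + inner ℝ (lowSymbol L hθ N (V N t)) (w N t))
            - L * inner ℝ (superposition hg (w N t)) (V N t)
            = L * inner ℝ (superposition hg (U t) - superposition hg (lowPass L N (U t)))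
              (V N t) := by
          -- V is the truncated derivative of H, hence orthogonal to H = MU - g(U). This is the
          -- Hamiltonian structure, up to the error of having g(P_N U) in the derivative of the
          -- energy.
          have h4 : inner ℝ (lowSymbol L hθ N (U t)) (V N t)
              = inner ℝ (superposition hg (U t)) (V N t) := by
            have := inner_lowDeriv_self N (H N t)
            rw [hH, inner_sub_left] at this
            exact sub_eq_zero.1 this
          rw [inner_lowSymbol hθ N (V N t), real_inner_comm (lowSymbol L hθ N (w N t)) (V N t),
            hwU N t ht, lowSymbol_lowPass, h4, inner_sub_left]
          ring
        rw [h3, abs_mul, abs_of_pos hL, mul_left_comm]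
        refine mul_le_mul_of_nonneg_left (hestB N t ht _ ?_) hL.le
        refine (norm_lowDeriv_le N _).trans ?_
        have := hHn N t ht
        gcongr
        linarith [norm_nonneg (U t)]
    refine hlim.congr fun N => ?_
    rw [hwU N T hTT, hwU N 0 h0T, lowSymbol_lowPass, lowSymbol_lowPass]
    have h3 : ∀ u : L2per L, inner ℝ (lowSymbol L hθ N u) (lowPass L N u)
        = inner ℝ (lowSymbol L hθ N u) u := fun u => by
      rw [inner_lowSymbol, lowSymbol_lowPass, ← inner_lowSymbol]
    rw [h3, h3]

end Galerkin

/-! ### The kinetic form and the energy on `H^{m/2}`. -/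

section Energy

variable {L : ℝ} [Fact (0 < L)]

theorem potential_congr {f g : ℝ → ℝ} {B : ℝ} (h : ∀ y, |y| ≤ B → g y = f y) {u : L2per L}
    (hu : ∀ᵐ x ∂(AddCircle.haarAddCircle (T := L)), |u x| ≤ B) :
    potential L g u = potential L f u := by
  rw [potential_eq_haar, potential_eq_haar]
  congr 1
  refine integral_congr_ae ?_
  filter_upwards [hu] with x hx
  exact primitive_eq_of_eqOn h hx

theorem fc_superposition_congr {f g : ℝ → ℝ} {B : ℝ} (h : ∀ y, |y| ≤ B → g y = f y)
    {K : NNReal} (hg : LipschitzWith K g) {u : L2per L}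
    (hu : ∀ᵐ x ∂(AddCircle.haarAddCircle (T := L)), |u x| ≤ B) (n : ℤ) :
    fc (superposition hg u) n = fcFun (fun x => f (u x)) n := by
  refine congrFun (fourierCoeff_congr_ae ?_) n
  filter_upwards [hu, superposition_ae hg u] with x h1 h2
  rw [h2, h _ h1]

/-- For m > 1 a ball of `H^{m/2}` consists of uniformly bounded functions, on which f may be
replaced by a Lipschitz function. For m ≤ 1 continuity is part of the assumption. -/
theorem continuous_potential {m : ℝ} {f : ℝ → ℝ} (hf : ContDiff ℝ ∞ f)
    (hE : m ≤ 1 → PotentialIsC2 L f (m / 2)) :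
    Continuous fun u : HPer L (m / 2) => potential L f u.toL2 := by
  rcases le_or_gt m 1 with h | h
  · exact (hE h).2.continuous
  · obtain ⟨C, hC, hemb⟩ := exists_tsum_norm_fc_le L (r := m / 2) (by linarith)
    rw [continuous_iff_continuousAt]
    intro u
    obtain ⟨K, g, hg, hfg⟩ := exists_lipschitz_eqOn hf (C * (‖u‖ + 1))
    have h1 : ContinuousAt (fun v : HPer L (m / 2) => potential L g (toL2CLM L (by linarith) v))
        u :=
      (hasFDerivAt_potential hg _).continuousAt.comp
        (toL2CLM L (by linarith : (0 : ℝ) ≤ m / 2)).continuous.continuousAt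
    refine h1.congr ?_
    filter_upwards [Metric.ball_mem_nhds u one_pos] with v hv
    rw [Metric.mem_ball, dist_eq_norm] at hv
    refine potential_congr hfg ?_
    filter_upwards [ae_abs_le_tsum (hemb v).1] with x hx
    refine hx.trans ((hemb v).2.trans (mul_le_mul_of_nonneg_left ?_ hC.le))
    have := norm_le_norm_add_norm_sub' v u
    linarith

/-- The symbol of `M (1 - (L/2π)² ∂ₓ²)^{-m/2}`. -/
theorem IsSymbol.isRealSymbol {m : ℝ} {θ : ℝ → ℝ} (hθ : IsSymbol m θ) :
    IsRealSymbol fun n : ℤ => ((θ n * wt n ^ (-(m / 2)) : ℝ) : ℂ) := by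
  refine IsRealSymbol.ofReal ?_ fun n => ?_
  · obtain ⟨C, hC⟩ := hθ.bound
    refine ⟨√C, fun n => Real.abs_le_sqrt ?_⟩
    have h1 : (wt n ^ (-(m / 2))) ^ 2 = (wt n ^ m)⁻¹ := by
      rw [← Real.rpow_neg (wt_pos n).le, ← wt_rpow_half_sq n (-m), neg_div]
    rw [mul_pow, h1, ← div_eq_mul_inv, div_le_iff₀ (Real.rpow_pos_of_pos (wt_pos n) _)]
    exact hC n
  · rw [wt_neg, Int.cast_neg, hθ.even]

/-- The symmetric bilinear form `(M u, v)` on `H^{m/2}`. -/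
def kinetic {m : ℝ} {θ : ℝ → ℝ} (hθ : IsSymbol m θ) (u v : HPer L (m / 2)) : ℝ :=
  L * inner ℝ (mult L hθ.isRealSymbol (besselPot L (m / 2) u)) (besselPot L (m / 2) v)

theorem kinetic_comm {m : ℝ} {θ : ℝ → ℝ} (hθ : IsSymbol m θ) (u v : HPer L (m / 2)) :
    kinetic hθ u v = kinetic hθ v u := by
  rw [kinetic, kinetic, inner_mult_ofReal, real_inner_comm]

theorem continuous_kinetic {m : ℝ} {θ : ℝ → ℝ} (hθ : IsSymbol m θ) :
    Continuous fun u : HPer L (m / 2) => kinetic hθ u u := by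
  unfold kinetic
  fun_prop

theorem wt_rpow_quarter (n : ℤ) (s : ℝ) :
    wt n ^ (-s) * (wt n ^ (s / 2) * wt n ^ (s / 2)) = 1 := by
  rw [← sq, wt_rpow_half_sq, ← Real.rpow_add (wt_pos n), neg_add_cancel, Real.rpow_zero]

/-- The Bessel weights in the definition of `kinetic` cancel. They serve only to express the form
through bounded operators, since Mu need not lie in `L²` for u in `H^{m/2}`. -/
theorem hasSum_kinetic {m : ℝ} {θ : ℝ → ℝ} (hθ : IsSymbol m θ) (u v : HPer L (m / 2)) :
    HasSum (fun n : ℤ => L * (θ n * ((starRingEnd ℂ) (fc u.toL2 n) * fc v.toL2 n).re))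
      (kinetic hθ u v) := by
  refine ((hasSum_inner_fc _ _).mul_left L).congr_fun fun n => ?_
  have h := wt_rpow_quarter n (m / 2)
  rw [fc_mult, fc_besselPot, fc_besselPot, map_mul, map_mul, Complex.conj_ofReal,
    Complex.conj_ofReal]
  have h1 : ((θ n * wt n ^ (-(m / 2)) : ℝ) : ℂ) * (((wt n ^ (m / 2 / 2) : ℝ) : ℂ)
      * (starRingEnd ℂ) (fc u.toL2 n)) * (((wt n ^ (m / 2 / 2) : ℝ) : ℂ) * fc v.toL2 n)
      = ((θ n * (wt n ^ (-(m / 2)) * (wt n ^ (m / 2 / 2) * wt n ^ (m / 2 / 2))) : ℝ) : ℂ)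
        * ((starRingEnd ℂ) (fc u.toL2 n) * fc v.toL2 n) := by
    push_cast
    ring
  rw [h1, h, mul_one, Complex.re_ofReal_mul]

/-- The Galerkin kinetic energy is that of the projected function, so it converges to the full one
by continuity of the form on `H^{m/2}`. -/
theorem inner_lowSymbol_eq_kinetic {m : ℝ} {θ : ℝ → ℝ} (hθ : IsSymbol m θ) (N : ℕ)
    (u : HPer L (m / 2)) :
    L * inner ℝ (lowSymbol L hθ.even N u.toL2) u.toL2
      = kinetic hθ (u.lowPass N) (u.lowPass N) := by
  refine ((hasSum_inner_fc _ _).mul_left L).unique ((hasSum_kinetic hθ _ _).congr_fun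
    fun n => ?_)
  rw [HPer.toL2_lowPass, fc_lowPass, fc_lowSymbol]
  split_ifs
  · rw [map_mul, Complex.conj_ofReal, mul_assoc, Complex.re_ofReal_mul]
  · simp

theorem kinetic_trans {m : ℝ} {θ : ℝ → ℝ} (hθ : IsSymbol m θ) (r : ℝ) (u v : HPer L (m / 2)) :
    kinetic hθ (u.trans r) (v.trans r) = kinetic hθ u v := by
  refine (hasSum_kinetic hθ _ _).unique ((hasSum_kinetic hθ _ _).congr_fun fun n => ?_)
  rw [HPer.toL2_trans, HPer.toL2_trans, fc_trans, fc_trans, map_mul, mul_mul_mul_comm,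
    ← Complex.normSq_eq_conj_mul_self, Complex.normSq_eq_norm_sq, norm_fourier_coe]
  simp

/-- The energy `E(u) = ½ (M u, u) - ∫₀ᴸ W(u) dx`. -/
def energy {m : ℝ} {θ : ℝ → ℝ} (hθ : IsSymbol m θ) (f : ℝ → ℝ) (u : HPer L (m / 2)) : ℝ :=
  kinetic hθ u u / 2 - potential L f u.toL2

theorem continuous_energy {m : ℝ} {θ f : ℝ → ℝ} (hθ : IsSymbol m θ) (hf : ContDiff ℝ ∞ f)
    (hE : m ≤ 1 → PotentialIsC2 L f (m / 2)) :
    Continuous (energy (L := L) hθ f) :=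
  ((continuous_kinetic hθ).div_const 2).sub (continuous_potential hf hE)

theorem energy_trans {m : ℝ} {θ : ℝ → ℝ} (hθ : IsSymbol m θ) (f : ℝ → ℝ) (r : ℝ)
    (u : HPer L (m / 2)) : energy hθ f (u.trans r) = energy hθ f u := by
  rw [energy, energy, kinetic_trans, HPer.toL2_trans, potential_trans]

end Energy

/-! ### Conservation of mass, momentum and energy for solutions in `H^s`. -/

section Conservation

variable {L : ℝ} [Fact (0 < L)]

/-- Only frequencies |n| > N contribute, and for these N² ≤ 1 + n² ≤ (1 + n²)^(r/2). -/
theorem sq_mul_norm_sub_lowPass_le {r : ℝ} (hr : 2 ≤ r) (u : HPer L r) (N : ℕ) :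
    N ^ 2 * ‖u.toL2 - lowPass L N u.toL2‖ ≤ ‖besselPot L r u‖ := by
  have h : ‖((N : ℝ) ^ 2) • (u.toL2 - lowPass L N u.toL2)‖ ≤ 1 * ‖besselPot L r u‖ := by
    refine norm_le_of_fc_le zero_le_one fun n => ?_
    rw [one_mul, fc_besselPot, fc_smul, fc_sub, fc_lowPass, norm_mul, norm_mul, Complex.norm_real,
      Complex.norm_real, Real.norm_of_nonneg (sq_nonneg _),
      Real.norm_of_nonneg (Real.rpow_nonneg (wt_pos n).le _)]
    split_ifs with hn
    · rw [sub_self, norm_zero, mul_zero]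
      exact mul_nonneg (Real.rpow_nonneg (wt_pos n).le _) (norm_nonneg _)
    · rw [sub_zero]
      refine mul_le_mul_of_nonneg_right ?_ (norm_nonneg _)
      have h1 : (N : ℝ) ≤ |(n : ℝ)| := by exact_mod_cast (not_le.1 hn).le
      calc (N : ℝ) ^ 2 ≤ |(n : ℝ)| ^ 2 := pow_le_pow_left₀ (Nat.cast_nonneg N) h1 2
        _ ≤ wt n ^ (1 : ℝ) := by
          rw [sq_abs, Real.rpow_one, wt]
          linarith
        _ ≤ _ := Real.rpow_le_rpow_of_exponent_le (one_le_wt n) (by linarith)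
  rwa [norm_smul, one_mul, Real.norm_of_nonneg (sq_nonneg _)] at h

theorem exists_norm_lowSymbol_le {m : ℝ} {θ : ℝ → ℝ} (hθ : IsSymbol m θ) {r : ℝ} (hr : m ≤ r) :
    ∃ C, 0 ≤ C ∧ ∀ (N : ℕ) (u : HPer L r),
      ‖lowSymbol L hθ.even N u.toL2‖ ≤ C * ‖besselPot L r u‖ := by
  obtain ⟨C, hC⟩ := hθ.bound
  refine ⟨√C, Real.sqrt_nonneg _, fun N u => norm_le_of_fc_le (Real.sqrt_nonneg _) fun n => ?_⟩
  rw [fc_lowSymbol, fc_besselPot, norm_mul, norm_mul, Complex.norm_real,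
    Real.norm_of_nonneg (Real.rpow_nonneg (wt_pos n).le _), ← mul_assoc]
  refine mul_le_mul_of_nonneg_right ?_ (norm_nonneg _)
  split_ifs
  · have hC0 : 0 ≤ C := by
      have h2 := (sq_nonneg _).trans (hC 0)
      exact nonneg_of_mul_nonneg_left h2 (Real.rpow_pos_of_pos (wt_pos 0) _)
    rw [Complex.norm_real, Real.norm_eq_abs]
    calc |θ n| ≤ √(C * wt n ^ m) := Real.abs_le_sqrt (hC n)
      _ = √C * wt n ^ (m / 2) := by
        rw [Real.sqrt_mul hC0, ← wt_rpow_half_sq, Real.sqrt_sq (Real.rpow_nonneg (wt_pos n).le _)]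
      _ ≤ _ := by
        gcongr
        exact one_le_wt n
  · rw [norm_zero]
    exact mul_nonneg (Real.sqrt_nonneg _) (Real.rpow_nonneg (wt_pos n).le _)

/-- By persistence the solution stays bounded in a high Sobolev norm on [0, T], hence pointwise.
There f may be replaced by a Lipschitz g, and `galerkin_conservation` applies. -/
theorem conservation_of_smooth {m s : ℝ} {θ f : ℝ → ℝ} (hθ : IsSymbol m θ) (hf : ContDiff ℝ ∞ f)
    (hs : m / 2 ≤ s) (hwp : GloballyWellPosed L θ f s) {u : ℝ → HPer L s}
    (hu : IsSolution θ f u) (h0 : ∃ g : SmoothPer L, u 0 = g.toH s) {T : ℝ} (hT : 0 ≤ T) :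
    ‖(u T).toL2‖ = ‖(u 0).toL2‖ ∧
      energy hθ f ((u T).incl hs) = energy hθ f ((u 0).incl hs) := by
  have hL : 0 < L := Fact.out
  -- r ≥ m bounds Mu in `L²`; r ≥ 2 gives the N⁻² tail and, being larger than 1/2, the pointwise
  -- bound.
  set r : ℝ := max s (max m 2)
  have hrs : s ≤ r := le_max_left _ _
  have hrm : m ≤ r := (le_max_left _ _).trans (le_max_right _ _)
  have hr2 : 2 ≤ r := (le_max_right _ _).trans (le_max_right _ _)
  obtain ⟨w, hw, hwu⟩ := hwp.persistence u hu h0 r hrs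
  -- Clamping time to [0, T] extends the solution continuously to all real times, as
  -- `galerkin_conservation` expects.
  have hclamp : Continuous fun t : ℝ => max 0 (min t T) := by fun_prop
  have hclamp0 : ∀ t, max 0 (min t T) ∈ Icc 0 T := fun t =>
    ⟨le_max_left _ _, max_le hT (min_le_right _ _)⟩
  have hclamp1 : ∀ t ∈ Icc 0 T, max 0 (min t T) = t := fun t ht => by
    rw [min_eq_left ht.2, max_eq_right ht.1]
  set W : ℝ → HPer L r := fun t => w (max 0 (min t T)) with hW
  have hWc : Continuous W := hw.comp_continuous hclamp fun t => (hclamp0 t).1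
  have hWu : ∀ t ∈ Icc 0 T, (W t).toL2 = (u t).toL2 := fun t ht => by
    rw [hW]
    simp only [hclamp1 t ht]
    exact hwu t ht.1
  have hr0 : (0 : ℝ) ≤ r := by linarith
  have hUc : Continuous fun t => (W t).toL2 := (toL2CLM L hr0).continuous.comp hWc
  obtain ⟨B, hB⟩ := isCompact_Icc.exists_bound_of_continuousOn (s := Icc 0 T) hWc.continuousOn
  obtain ⟨D, hD⟩ := isCompact_Icc.exists_bound_of_continuousOn (s := Icc 0 T)
    ((besselPot L r).continuous.comp hWc).continuousOn
  have hD0 : 0 ≤ D := (norm_nonneg _).trans (hD 0 (left_mem_Icc.2 hT))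
  obtain ⟨C, hC, hemb⟩ := exists_tsum_norm_fc_le L (r := r) (by linarith)
  obtain ⟨C', hC', hsym⟩ := exists_norm_lowSymbol_le (L := L) hθ hrm
  obtain ⟨K, g, hg, hfg⟩ := exists_lipschitz_eqOn hf (C * B)
  have hbd : ∀ t ∈ Icc 0 T, ∀ᵐ x ∂(AddCircle.haarAddCircle (T := L)), |(W t).toL2 x| ≤ C * B :=
    fun t ht => by
      filter_upwards [ae_abs_le_tsum (hemb (W t)).1] with x hx
      exact hx.trans ((hemb _).2.trans (mul_le_mul_of_nonneg_left (hB t ht) hC.le))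
  have h0T : (0 : ℝ) ∈ Icc 0 T := left_mem_Icc.2 hT
  have hTT : T ∈ Icc 0 T := right_mem_Icc.2 hT
  have key := galerkin_conservation hg hθ.even hT (U := fun t => (W t).toL2) hUc
    (fun n t ht => by
      simp only [hWu t ht, hWu 0 h0T]
      rw [hu.equation n t ht.1]
      congr 1
      refine intervalIntegral.integral_congr fun τ hτ => ?_
      rw [uIcc_of_le ht.1] at hτ
      have hτT : τ ∈ Icc 0 T := ⟨hτ.1, hτ.2.trans ht.2⟩
      have hfc := fc_superposition_congr hfg hg (hbd τ hτT) n
      rw [hWu τ hτT] at hfc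
      simp only [hWu τ hτT, hfc]
      rfl)
    (C := max D (C' * D))
    (fun t ht N => (sq_mul_norm_sub_lowPass_le hr2 (W t) N).trans
      ((hD t ht).trans (le_max_left _ _)))
    (fun t ht N => (hsym N (W t)).trans
      ((mul_le_mul_of_nonneg_left (hD t ht) hC').trans (le_max_right _ _)))
  -- The potential of g is continuous on `L²`, so the projections need not obey the pointwise bound;
  -- only the limit does, and there the potentials of g and f agree.
  have hlim : ∀ t ∈ Icc 0 T, Tendsto (fun N =>
      L / 2 * inner ℝ (lowSymbol L hθ.even N (W t).toL2) (W t).toL2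
        - potential L g (lowPass L N (W t).toL2)) atTop (𝓝 (energy hθ f ((u t).incl hs))) :=
    fun t ht => by
      have h1 : ∀ N, L / 2 * inner ℝ (lowSymbol L hθ.even N (W t).toL2) (W t).toL2
          = kinetic hθ (((u t).incl hs).lowPass N) (((u t).incl hs).lowPass N) / 2 := fun N => by
        rw [← inner_lowSymbol_eq_kinetic, HPer.toL2_incl, hWu t ht]
        ring
      simp only [h1]
      refine Tendsto.sub ((((continuous_kinetic hθ).tendsto _).comp
        ((u t).incl hs).tendsto_lowPass).div_const 2) ?_
      rw [HPer.toL2_incl, ← hWu t ht, ← potential_congr hfg (hbd t ht)]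
      exact (hasFDerivAt_potential hg _).continuousAt.tendsto.comp (tendsto_lowPass _)
  refine ⟨?_, ?_⟩
  · rw [← hWu T hTT, ← hWu 0 h0T]
    exact key.1
  · exact sub_eq_zero.1 (tendsto_nhds_unique ((hlim T hTT).sub (hlim 0 h0T)) key.2)

/-- Conservation of mass. -/
theorem IsSolution.fc_zero_eq {s : ℝ} {θ f : ℝ → ℝ} {u : ℝ → HPer L s} (hu : IsSolution θ f u)
    {t : ℝ} (ht : 0 ≤ t) : fc (u t).toL2 0 = fc (u 0).toL2 0 := by
  rw [hu.equation 0 t ht]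
  simp

/-- Conservation of momentum and energy. -/
theorem IsSolution.conservation {m s : ℝ} {θ f : ℝ → ℝ} (hθ : IsSymbol m θ)
    (hf : ContDiff ℝ ∞ f) (hE : m ≤ 1 → PotentialIsC2 L f (m / 2))
    (hs : m / 2 ≤ s) (hwp : GloballyWellPosed L θ f s) {u : ℝ → HPer L s}
    (hu : IsSolution θ f u) {t : ℝ} (ht : 0 ≤ t) :
    ‖(u t).toL2‖ = ‖(u 0).toL2‖ ∧
      energy hθ f ((u t).incl hs) = energy hθ f ((u 0).incl hs) := by
  have hs0 : 0 ≤ s := by have := hθ.pos; linarith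
  -- The projections of u(0) are trigonometric polynomials, hence smooth data converging to u(0) in
  -- `H^s`.
  choose v hv hv0 using fun k : ℕ => hwp.existence ((u 0).lowPass k)
  have hlim0 : Tendsto (fun k => v k 0) atTop (𝓝 (u 0)) := by
    simp only [hv0]
    exact (u 0).tendsto_lowPass
  have hlim : Tendsto (fun k => v k t) atTop (𝓝 (u t)) := by
    rw [Metric.tendsto_atTop]
    intro ε hε
    -- Continuous dependence is given for T > 0 only, while t may be 0.
    obtain ⟨δ, hδ, hdep⟩ := hwp.dependence u hu (t + 1) (by linarith) ε hε
    obtain ⟨N, hN⟩ := Metric.tendsto_atTop.1 hlim0 δ hδ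
    refine ⟨N, fun k hk => ?_⟩
    have h1 := hN k hk
    rw [dist_eq_norm] at h1 ⊢
    exact hdep (v k) (hv k) h1 t ⟨ht, by linarith⟩
  have hcons := fun k => conservation_of_smooth hθ hf hs hwp (hv k)
    (by
      obtain ⟨g, hg⟩ := (u 0).exists_smoothPer_lowPass k
      exact ⟨g, by rw [hv0, hg]⟩) ht
  have hn : Continuous fun z : HPer L s => ‖z.toL2‖ := (toL2CLM L hs0).continuous.norm
  have he : Continuous fun z : HPer L s => energy hθ f (z.incl hs) :=
    (continuous_energy hθ hf hE).comp (inclCLM L hs).continuous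
  refine ⟨tendsto_nhds_unique ((hn.tendsto _).comp hlim)
    (((hn.tendsto _).comp hlim0).congr fun k => (hcons k).1.symm),
    tendsto_nhds_unique ((he.tendsto _).comp hlim)
    (((he.tendsto _).comp hlim0).congr fun k => (hcons k).2.symm)⟩

end Conservation

/-! ### Second order Taylor expansions, abstract and scalar. -/

section SecondOrder

/-- Second order Taylor expansion of a `C²` function. -/
theorem exists_taylor_two {E : Type*} [NormedAddCommGroup E] [NormedSpace ℝ E] {F : E → ℝ}
    (hF : ContDiff ℝ 2 F) (x : E) {η : ℝ} (hη : 0 < η) : ∃ δ > 0, ∀ v : E, ‖v‖ < δ →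
      |F (x + v) - F x - fderiv ℝ F x v - fderiv ℝ (fderiv ℝ F) x v v / 2| ≤ η * ‖v‖ ^ 2 := by
  set B := fderiv ℝ (fderiv ℝ F) x with hB
  have hF1 : ∀ y, HasFDerivAt F (fderiv ℝ F y) y := fun y =>
    (hF.differentiable (by norm_num) y).hasFDerivAt
  have hF2 : HasFDerivAt (fderiv ℝ F) B x :=
    ((hF.fderiv_right (m := 1) (by norm_num)).differentiable (by norm_num) x).hasFDerivAt
  have hsymm : ∀ v w, B v w = B w v := fun v w =>
    (hF.contDiffAt.isSymmSndFDerivAt (by simp)) v w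
  have h1 := (hasFDerivAt_iff_isLittleO_nhds_zero.1 hF2).def hη
  obtain ⟨δ, hδ, hball⟩ := Metric.eventually_nhds_iff_ball.1 h1
  refine ⟨δ, hδ, fun v hv => ?_⟩
  -- The derivative of R at w is the first order remainder of F' at x, thus at most η‖w‖. The mean
  -- value inequality on the ball of radius ‖v‖ then gives η‖v‖².
  set R : E → ℝ := fun w => F (x + w) - F x - fderiv ℝ F x w - B w w / 2 with hR
  have hd : ∀ w, HasFDerivAt R (fderiv ℝ F (x + w) - fderiv ℝ F x - B w) w := fun w => by
    have h2 : HasFDerivAt (fun w => F (x + w)) (fderiv ℝ F (x + w)) w := by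
      have := (hF1 (x + w)).comp w ((hasFDerivAt_id w).const_add x)
      rwa [ContinuousLinearMap.comp_id] at this
    have h3 : HasFDerivAt (fun w => B w w) (B w + B.flip w) w := by
      have := B.hasFDerivAt_of_bilinear (hasFDerivAt_id w) (hasFDerivAt_id w)
      refine this.congr_fderiv ?_
      ext z
      simp
    have h4 := ((h2.sub_const (F x)).sub (fderiv ℝ F x).hasFDerivAt).sub (h3.mul_const (1 / 2))
    have h5 : R = fun w => F (x + w) - F x - fderiv ℝ F x w - B w w * (1 / 2) := by
      funext w
      rw [hR]
      ring
    rw [h5]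
    refine h4.congr_fderiv ?_
    ext z
    simp [hsymm z w]
    ring
  have h2 := (convex_closedBall (0 : E) ‖v‖).norm_image_sub_le_of_norm_hasFDerivWithin_le
    (f := R) (C := η * ‖v‖) (fun w _ => (hd w).hasFDerivWithinAt)
    (fun w hw => by
      rw [mem_closedBall_zero_iff] at hw
      have := hball w (by rw [mem_ball_zero_iff]; exact hw.trans_lt hv)
      exact this.trans (by gcongr))
    (Metric.mem_closedBall_self (norm_nonneg v)) (mem_closedBall_zero_iff.2 le_rfl)
  have h3 : R 0 = 0 := by simp [hR]
  rw [h3, sub_zero, sub_zero, mul_assoc, ← sq] at h2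
  exact h2

/-- A polynomial at + bt² that is o(t²) as t → 0⁺ vanishes. This compares the coefficients of two
second order expansions. -/
theorem eq_zero_of_abs_add_le {a b : ℝ}
    (h : ∀ η > 0, ∃ δ > 0, ∀ t, 0 < t → t < δ → |a * t + b * t ^ 2| ≤ η * t ^ 2) :
    a = 0 ∧ b = 0 := by
  have ha : a = 0 := by
    obtain ⟨δ, hδ, h1⟩ := h 1 one_pos
    by_contra hne
    have hpos : 0 < |a| := abs_pos.2 hne
    have hb : 0 < 2 * (1 + |b|) := by positivity
    -- For this t one has (1 + |b|)t² ≤ |a|t/2, whereas the hypothesis with η = 1 forces |a|t ≤ (1 +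
    -- |b|)t².
    set t := min (δ / 2) (|a| / (2 * (1 + |b|))) with ht
    have ht0 : 0 < t := lt_min (by linarith) (by positivity)
    have ht1 : t < δ := (min_le_left _ _).trans_lt (by linarith)
    have ht2 : t * (2 * (1 + |b|)) ≤ |a| := by
      rw [← le_div_iff₀ hb]
      exact min_le_right _ _
    have h2 := h1 t ht0 ht1
    have h3 := abs_sub_abs_le_abs_sub (a * t) (-(b * t ^ 2))
    rw [sub_neg_eq_add, abs_neg, abs_mul, abs_mul, abs_of_pos ht0, abs_of_pos (by positivity :
      0 < t ^ 2)] at h3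
    nlinarith [mul_pos hpos ht0]
  refine ⟨ha, ?_⟩
  subst ha
  rw [← abs_eq_zero]
  refine le_antisymm (le_of_forall_pos_le_add fun η hη => ?_) (abs_nonneg _)
  obtain ⟨δ, hδ, h1⟩ := h η hη
  have h2 := h1 (δ / 2) (by linarith) (by linarith)
  rw [zero_mul, zero_add, abs_mul, abs_of_pos (by positivity : 0 < (δ / 2) ^ 2)] at h2
  rw [zero_add]
  exact le_of_mul_le_mul_right h2 (by positivity)

/-- `abs_primitive_sub_le` for a Lipschitz extension of f' bounds the first order remainder of f by
Kb²; integrating this in b gives the cubic bound. -/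
theorem exists_primitive_taylor {f : ℝ → ℝ} (hf : ContDiff ℝ ∞ f) (B : ℝ) :
    ∃ K : ℝ, 0 ≤ K ∧ ∀ a b : ℝ, |a| ≤ B → |b| ≤ 1 →
      |(∫ y in (0 : ℝ)..(a + b), f y) - (∫ y in (0 : ℝ)..a, f y) - f a * b - deriv f a * b ^ 2 / 2|
        ≤ K * |b| ^ 3 := by
  obtain ⟨K, g, hg, hfg⟩ := exists_lipschitz_eqOn (contDiff_deriv hf) (B + 1)
  have hfd : ∀ y, HasDerivAt f (deriv f y) y := fun y =>
    (hf.differentiable (by simp) y).hasDerivAt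
  have hfc : Continuous f := hf.continuous
  have hdc : Continuous (deriv f) := (contDiff_deriv hf).continuous
  have h1 : ∀ a b : ℝ, |a| ≤ B → |b| ≤ 1 → |f (a + b) - f a - deriv f a * b| ≤ K * b ^ 2 :=
    fun a b ha hb => by
      have h2 := abs_primitive_sub_le hg a b
      rwa [primitive_eq_of_eqOn hfg ((abs_add_le a b).trans (by linarith)),
        primitive_eq_of_eqOn hfg (by linarith : |a| ≤ B + 1), hfg a (by linarith),
        intervalIntegral.integral_eq_sub_of_hasDerivAt (fun y _ => hfd y)
          (hdc.intervalIntegrable _ _),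
        intervalIntegral.integral_eq_sub_of_hasDerivAt (fun y _ => hfd y)
          (hdc.intervalIntegrable _ _), sub_sub_sub_cancel_right] at h2
  refine ⟨K, K.2, fun a b ha hb => ?_⟩
  have h3 : (∫ y in (0 : ℝ)..(a + b), f y) - (∫ y in (0 : ℝ)..a, f y) - f a * b
      - deriv f a * b ^ 2 / 2 = ∫ y in (0 : ℝ)..b, (f (a + y) - f a - deriv f a * y) := by
    have hc1 : Continuous fun y => f (a + y) := by fun_prop
    have i1 : IntervalIntegrable (fun y => f (a + y) - f a) volume 0 b :=
      (hc1.sub continuous_const).intervalIntegrable _ _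
    have i2 : IntervalIntegrable (fun y => deriv f a * y) volume 0 b :=
      (continuous_const.mul continuous_id).intervalIntegrable _ _
    rw [intervalIntegral.integral_interval_sub_left (hfc.intervalIntegrable _ _)
      (hfc.intervalIntegrable _ _), intervalIntegral.integral_sub i1 i2,
      intervalIntegral.integral_sub (hc1.intervalIntegrable _ _)
      (continuous_const.intervalIntegrable _ _), intervalIntegral.integral_const_mul,
      intervalIntegral.integral_comp_add_left, intervalIntegral.integral_const, integral_id,
      add_zero]
    simp only [sub_zero, smul_eq_mul]
    ring
  have h4 := intervalIntegral.norm_integral_le_of_norm_le_const (a := 0) (b := b)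
    (f := fun y => f (a + y) - f a - deriv f a * y) (C := K * b ^ 2) fun y hy => by
      have hy' : |y| ≤ |b| := by
        have := abs_sub_left_of_mem_uIcc (uIoc_subset_uIcc hy)
        simpa using this
      refine (h1 a y ha (hy'.trans hb)).trans ?_
      have := sq_le_sq' (neg_le_of_neg_le (by linarith [neg_abs_le y])) ((le_abs_self y).trans hy')
      rw [sq_abs] at this
      exact mul_le_mul_of_nonneg_left this K.2
  rw [h3, ← Real.norm_eq_abs]
  refine h4.trans (le_of_eq ?_)
  rw [sub_zero, ← sq_abs b]
  ring

end SecondOrder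

/-! ### Second order expansion of the potential energy at φ. -/

section PotentialTaylor

variable {L : ℝ}

theorem SmoothPer.circle_comp {h : ℝ → ℝ} (hh : ContDiff ℝ ∞ h) (g : SmoothPer L)
    (x : AddCircle L) : (g.comp h hh).circle x = h (g.circle x) := by
  induction x using QuotientAddGroup.induction_on with
  | H x => exact (circle_coe _ x).trans (congrArg h (circle_coe g x).symm)

variable [Fact (0 < L)]

theorem SmoothPer.exists_bound (g : SmoothPer L) : ∃ C, 0 ≤ C ∧ ∀ x, |g.circle x| ≤ C := by
  obtain ⟨C, hC⟩ := (isCompact_univ (X := AddCircle L)).exists_bound_of_continuousOn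
    g.continuous_circle.continuousOn
  exact ⟨C, (norm_nonneg _).trans (hC 0 (mem_univ _)), fun x => hC x (mem_univ x)⟩

theorem smoothMul_ae (g : SmoothPer L) (v : L2per L) :
    smoothMul g v =ᵐ[AddCircle.haarAddCircle] fun x => g.circle x * v x := MemLp.coeFn_toLp _

/-- Multiplication by a smooth function as a continuous linear map. -/
def smoothMulCLM (g : SmoothPer L) : L2per L →L[ℝ] L2per L :=
  LinearMap.mkContinuousOfExistsBound
    { toFun := smoothMul g
      map_add' := fun u v => by
        ext1
        filter_upwards [smoothMul_ae g (u + v), smoothMul_ae g u, smoothMul_ae g v,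
          Lp.coeFn_add u v, Lp.coeFn_add (smoothMul g u) (smoothMul g v)] with x h1 h2 h3 h4 h5
        rw [h1, h5, Pi.add_apply, h2, h3, h4, Pi.add_apply, mul_add]
      map_smul' := fun c u => by
        ext1
        filter_upwards [smoothMul_ae g (c • u), smoothMul_ae g u, Lp.coeFn_smul c u,
          Lp.coeFn_smul c (smoothMul g u)] with x h1 h2 h3 h4
        rw [RingHom.id_apply, h1, h4, Pi.smul_apply, h2, h3, Pi.smul_apply, smul_eq_mul,
          smul_eq_mul, mul_left_comm] } <| by
    obtain ⟨C, _, hC⟩ := g.exists_bound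
    refine ⟨C, fun v => Lp.norm_le_mul_norm_of_ae_le_mul ?_⟩
    filter_upwards [smoothMul_ae g v] with x h1
    change ‖smoothMul g v x‖ ≤ _
    rw [h1, norm_mul]
    exact mul_le_mul_of_nonneg_right (hC x) (norm_nonneg _)

theorem smoothMulCLM_apply (g : SmoothPer L) (v : L2per L) : smoothMulCLM g v = smoothMul g v :=
  rfl

theorem inner_smoothMul (g : SmoothPer L) (u v : L2per L) :
    inner ℝ (smoothMul g u) v = inner ℝ u (smoothMul g v) := by
  rw [inner_eq_integral, inner_eq_integral]
  refine integral_congr_ae ?_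
  filter_upwards [smoothMul_ae g u, smoothMul_ae g v] with x h1 h2
  rw [h1, h2]
  ring

/-- The remainder in the second order expansion of the potential energy at `φ`. -/
def potentialRem {f : ℝ → ℝ} (hf : ContDiff ℝ ∞ f) (φ : SmoothPer L) (v : L2per L) : ℝ :=
  potential L f (φ.toL2 + v) - potential L f φ.toL2 - L * inner ℝ (φ.comp f hf).toL2 v
    - L * inner ℝ (smoothMul (φ.comp (deriv f) (contDiff_deriv hf)) v) v / 2

/-- The remainder is cubic along bounded functions. -/
theorem exists_abs_potentialRem_le {f : ℝ → ℝ} (hf : ContDiff ℝ ∞ f) (φ : SmoothPer L) :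
    ∃ K, 0 ≤ K ∧ ∀ (v : L2per L) (M : ℝ), M ≤ 1 →
      (∀ᵐ x ∂(AddCircle.haarAddCircle (T := L)), |v x| ≤ M) →
      |potentialRem hf φ v| ≤ K * M * ‖v‖ ^ 2 := by
  have hL : 0 < L := Fact.out
  obtain ⟨B, hB0, hB⟩ := φ.exists_bound
  obtain ⟨K, hK, htay⟩ := exists_primitive_taylor hf B
  -- g supplies integrability of the primitives; the values of φ and φ + v lie where g = f.
  obtain ⟨K', g, hg, hfg⟩ := exists_lipschitz_eqOn hf (B + 1)
  refine ⟨L * K, by positivity, fun v M hM hv => ?_⟩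
  have hφ : ∀ᵐ x ∂(AddCircle.haarAddCircle (T := L)), |φ.toL2 x| ≤ B + 1 := by
    filter_upwards [φ.toL2_ae] with x hx
    rw [hx]
    linarith [hB x]
  have hφv : ∀ᵐ x ∂(AddCircle.haarAddCircle (T := L)), |(φ.toL2 + v) x| ≤ B + 1 := by
    filter_upwards [φ.toL2_ae, Lp.coeFn_add φ.toL2 v, hv] with x h1 h2 h3
    rw [h2, Pi.add_apply, h1]
    exact (abs_add_le _ _).trans (by linarith [hB x])
  set F : AddCircle L → ℝ := fun x => (∫ y in (0 : ℝ)..((φ.toL2 + v) x), g y)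
    - (∫ y in (0 : ℝ)..(φ.toL2 x), g y) - (φ.comp f hf).toL2 x * v x
    - (smoothMul (φ.comp (deriv f) (contDiff_deriv hf)) v) x * v x / 2 with hF
  have h1 : potentialRem hf φ v = L * ∫ x, F x ∂AddCircle.haarAddCircle := by
    have i1 : Integrable (fun x => (∫ y in (0 : ℝ)..((φ.toL2 + v) x), g y)
        - (∫ y in (0 : ℝ)..(φ.toL2 x), g y)) AddCircle.haarAddCircle :=
      (integrable_primitive hg _).sub (integrable_primitive hg _)
    have i2 : Integrable (fun x => (∫ y in (0 : ℝ)..((φ.toL2 + v) x), g y)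
        - (∫ y in (0 : ℝ)..(φ.toL2 x), g y) - (φ.comp f hf).toL2 x * v x)
        AddCircle.haarAddCircle := i1.sub (integrable_inner_mul _ _)
    rw [hF, integral_sub i2 ((integrable_inner_mul _ _).div_const 2),
      integral_sub i1 (integrable_inner_mul _ _),
      integral_sub (integrable_primitive hg _) (integrable_primitive hg _), integral_div,
      ← inner_eq_integral, ← inner_eq_integral, potentialRem, ← potential_congr hfg hφ,
      ← potential_congr hfg hφv, potential_eq_haar, potential_eq_haar]
    ring
  rw [h1, abs_mul, abs_of_pos hL, mul_assoc, mul_assoc]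
  refine mul_le_mul_of_nonneg_left ?_ hL.le
  rw [← mul_assoc, ← real_inner_self_eq_norm_sq, inner_eq_integral, ← integral_const_mul,
    ← Real.norm_eq_abs]
  refine norm_integral_le_of_norm_le ((integrable_inner_mul v v).const_mul _) ?_
  filter_upwards [φ.toL2_ae, Lp.coeFn_add φ.toL2 v, hv, (φ.comp f hf).toL2_ae,
    smoothMul_ae (φ.comp (deriv f) (contDiff_deriv hf)) v, hφ, hφv] with x h2 h3 h4 h5 h6 h7 h8
  rw [hF]
  simp only
  rw [primitive_eq_of_eqOn hfg h7, primitive_eq_of_eqOn hfg h8, h3, Pi.add_apply, h2, h5, h6,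
    SmoothPer.circle_comp, SmoothPer.circle_comp, mul_assoc _ (v x) (v x), ← sq, Real.norm_eq_abs]
  refine (htay _ _ (hB x) (h4.trans hM)).trans ?_
  have h9 : |v x| ^ 3 = |v x| * v x ^ 2 := by
    rw [← sq_abs (v x)]
    ring
  rw [h9, mul_assoc]
  gcongr

/-- Second order expansion of the potential energy in `H^{m/2}`. -/
theorem exists_abs_potentialRem_le_sobolev {m : ℝ} {f : ℝ → ℝ} (hm : 0 < m)
    (hf : ContDiff ℝ ∞ f) (hE : m ≤ 1 → PotentialIsC2 L f (m / 2)) (φ : SmoothPer L) {η : ℝ}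
    (hη : 0 < η) : ∃ δ > 0, ∀ v : HPer L (m / 2), ‖v‖ < δ →
      |potentialRem hf φ v.toL2| ≤ η * ‖v‖ ^ 2 := by
  have hL : 0 < L := Fact.out
  have hm2 : 0 ≤ m / 2 := by linarith
  obtain ⟨K, hK, hrem⟩ := exists_abs_potentialRem_le hf φ
  rcases le_or_gt m 1 with h | h
  · have hP : ContDiff ℝ 2 fun u : HPer L (m / 2) => potential L f u.toL2 := (hE h).2
    set P : HPer L (m / 2) → ℝ := fun u => potential L f u.toL2 with hPdef
    set x : HPer L (m / 2) := φ.toH (m / 2)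
    set f1 : HPer L (m / 2) → ℝ := fun v => L * inner ℝ (φ.comp f hf).toL2 (toL2CLM L hm2 v)
    set f2 : HPer L (m / 2) → ℝ := fun v => L * inner ℝ
      (smoothMulCLM (φ.comp (deriv f) (contDiff_deriv hf)) (toL2CLM L hm2 v)) (toL2CLM L hm2 v)
    have hf1c : Continuous f1 := by fun_prop
    have hf2c : Continuous f2 := by fun_prop
    have hremeq : ∀ v, potentialRem hf φ v.toL2 = P (x + v) - P x - f1 v - f2 v / 2 := fun v => by
      simp only [hPdef, HPer.toL2_add]
      rfl
    -- Functions in `H^{m/2}` may be unbounded here, so the cubic bound is available only along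
    -- bounded directions. Along tv with v smooth, both it and the abstract expansion are valid up
    -- to o(t²), so their coefficients agree.
    have hident : ∀ g : SmoothPer L, fderiv ℝ P x (g.toH (m / 2)) - f1 (g.toH (m / 2)) = 0 ∧
        (fderiv ℝ (fderiv ℝ P) x (g.toH (m / 2)) (g.toH (m / 2)) - f2 (g.toH (m / 2))) / 2 = 0 :=
      fun g => by
        set v := g.toH (m / 2)
        obtain ⟨M, hM0, hM⟩ := g.exists_bound
        refine eq_zero_of_abs_add_le fun ε hε => ?_
        obtain ⟨δ, hδ, htay⟩ := exists_taylor_two hP x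
          (η := ε / (2 * (‖v‖ ^ 2 + 1))) (by positivity)
        set D := K * M * ‖v.toL2‖ ^ 2 with hD
        have hD0 : 0 ≤ D := by positivity
        -- The three bounds on t place tv in the Taylor ball, make |tv| ≤ 1 pointwise, and bring the
        -- cubic remainder tD·t² below (ε/2)t². The factor `ε / (2 * (‖v‖ ^ 2 + 1))` above leaves
        -- the other (ε/2)t² to the abstract remainder.
        refine ⟨min (δ / (‖v‖ + 1)) (min (1 / (M + 1)) (ε / (2 * (D + 1)))), by positivity,
          fun t ht0 ht => ?_⟩
        have ht1 : t * (‖v‖ + 1) < δ := (lt_div_iff₀ (by positivity)).1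
          (ht.trans_le (min_le_left _ _))
        have ht2 : t * (M + 1) < 1 := (lt_div_iff₀ (by positivity)).1
          (ht.trans_le ((min_le_right _ _).trans (min_le_left _ _)))
        have ht3 : t * (2 * (D + 1)) < ε := (lt_div_iff₀ (by positivity)).1
          (ht.trans_le ((min_le_right _ _).trans (min_le_right _ _)))
        have e1 := htay (t • v) (by
          rw [norm_smul, Real.norm_of_nonneg ht0.le]
          nlinarith [norm_nonneg v])
        have e2 := hrem (t • v).toL2 (t * M) (by nlinarith) (by
          have h4 : (t • v).toL2 = t • g.toL2 := map_smul HPer.toL2 t v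
          rw [h4]
          filter_upwards [Lp.coeFn_smul t g.toL2, g.toL2_ae] with y h5 h6
          rw [h5, Pi.smul_apply, h6, smul_eq_mul, abs_mul, abs_of_pos ht0]
          exact mul_le_mul_of_nonneg_left (hM y) ht0.le)
        rw [hremeq] at e2
        have s1 : f1 (t • v) = t * f1 v := by
          simp only [f1, map_smul, inner_smul_right]
          ring
        have s2 : f2 (t • v) = t ^ 2 * f2 v := by
          simp only [f2, map_smul, inner_smul_right, inner_smul_left]
          simp
          ring
        have s3 : (t • v).toL2 = t • v.toL2 := map_smul HPer.toL2 t v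
        rw [map_smul, map_smul, map_smul, smul_apply, smul_eq_mul, smul_eq_mul, smul_eq_mul,
          norm_smul,
          Real.norm_of_nonneg ht0.le, mul_pow] at e1
        rw [s1, s2, s3, norm_smul, Real.norm_of_nonneg ht0.le, mul_pow] at e2
        have e3 : ε / (2 * (‖v‖ ^ 2 + 1)) * (t ^ 2 * ‖v‖ ^ 2) ≤ ε / 2 * t ^ 2 := by
          have : ‖v‖ ^ 2 / (‖v‖ ^ 2 + 1) ≤ 1 := (div_le_one (by positivity)).2 (by linarith)
          calc _ = ε / 2 * t ^ 2 * (‖v‖ ^ 2 / (‖v‖ ^ 2 + 1)) := by field_simp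
            _ ≤ ε / 2 * t ^ 2 * 1 := by gcongr
            _ = _ := mul_one _
        have e4 : K * (t * M) * (t ^ 2 * ‖v.toL2‖ ^ 2) ≤ ε / 2 * t ^ 2 := by
          calc _ = t * D * t ^ 2 := by rw [hD]; ring
            _ ≤ _ := by
              gcongr
              nlinarith
        have e5 : (fderiv ℝ P x v - f1 v) * t
            + (fderiv ℝ (fderiv ℝ P) x v v - f2 v) / 2 * t ^ 2
            = (P (x + t • v) - P x - t * f1 v - t ^ 2 * f2 v / 2)
              - (P (x + t • v) - P x - t * fderiv ℝ P x v
                - t * (t * fderiv ℝ (fderiv ℝ P) x v v) / 2) := by ring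
        rw [e5]
        refine (abs_sub _ _).trans ?_
        linarith
    -- Both sides are continuous on `H^{m/2}` and agree on the dense set of smooth functions.
    have hd1 : ∀ v, fderiv ℝ P x v = f1 v := fun v => by
      have := DenseRange.equalizer (HPer.dense_smooth (L := L) (m / 2))
        (fderiv ℝ P x).continuous hf1c (funext fun g => sub_eq_zero.1 (hident g).1)
      exact congrFun this v
    have hd2 : ∀ v, fderiv ℝ (fderiv ℝ P) x v v = f2 v := fun v => by
      have hc : Continuous fun v => fderiv ℝ (fderiv ℝ P) x v v := by fun_prop
      have := DenseRange.equalizer (HPer.dense_smooth (L := L) (m / 2)) hc hf2c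
        (funext fun g => by
          have := (hident g).2
          simp only [Function.comp_apply]
          linarith)
      exact congrFun this v
    obtain ⟨δ, hδ, htay⟩ := exists_taylor_two hP x hη
    refine ⟨δ, hδ, fun v hv => ?_⟩
    rw [hremeq, ← hd1, ← hd2]
    exact htay v hv
  · obtain ⟨C, hC, hemb⟩ := exists_tsum_norm_fc_le L (r := m / 2) (by linarith)
    -- The first bound yields |v| ≤ C‖v‖ ≤ 1 pointwise; the second absorbs one factor ‖v‖ of the
    -- cubic remainder into η.
    refine ⟨min (1 / C) (η / (K * C * L⁻¹ + 1)), by positivity, fun v hv => ?_⟩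
    have h1 : C * ‖v‖ ≤ 1 := by
      have := (lt_div_iff₀ hC).1 (hv.trans_le (min_le_left _ _))
      linarith
    have h2 : ‖v‖ * (K * C * L⁻¹ + 1) < η := (lt_div_iff₀ (by positivity)).1
      (hv.trans_le (min_le_right _ _))
    have h3 := hrem v.toL2 (C * ‖v‖) h1 (by
      filter_upwards [ae_abs_le_tsum (hemb v).1] with x hx
      exact hx.trans (hemb v).2)
    have h4 : ‖v.toL2‖ ^ 2 ≤ L⁻¹ * ‖v‖ ^ 2 := by
      have := pow_le_pow_left₀ (norm_nonneg _) (v.norm_toL2_le hm2) 2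
      rwa [mul_pow, inv_pow, Real.sq_sqrt hL.le] at this
    refine h3.trans ?_
    calc K * (C * ‖v‖) * ‖v.toL2‖ ^ 2 ≤ K * (C * ‖v‖) * (L⁻¹ * ‖v‖ ^ 2) := by gcongr
      _ = (‖v‖ * (K * C * L⁻¹)) * ‖v‖ ^ 2 := by ring
      _ ≤ _ := by
        gcongr
        linarith [norm_nonneg v]

end PotentialTaylor

/-! ### The quadratic form of 𝓛 on `H^{m/2}` and its coercivity. -/

section Hessian

variable {L : ℝ}

theorem SmoothPer.circle_affine (a b : ℝ) (g : SmoothPer L) (x : AddCircle L) :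
    (g.affine a b).circle x = a + b * g.circle x := circle_comp _ g x

variable [Fact (0 < L)]

/-- The bilinear form `(𝓛 v, w)` on `H^{m/2}`. -/
def hessian {m : ℝ} {θ f : ℝ → ℝ} (hθ : IsSymbol m θ) (hf : ContDiff ℝ ∞ f) (om : ℝ)
    (φ : SmoothPer L) (v w : HPer L (m / 2)) : ℝ :=
  kinetic hθ v w + om * (L * inner ℝ v.toL2 w.toL2)
    - L * inner ℝ (smoothMul (φ.comp (deriv f) (contDiff_deriv hf)) v.toL2) w.toL2

variable {m : ℝ} {θ f : ℝ → ℝ} (hθ : IsSymbol m θ) (hf : ContDiff ℝ ∞ f) (om : ℝ)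
  (φ : SmoothPer L)

theorem hessian_comm (v w : HPer L (m / 2)) :
    hessian hθ hf om φ v w = hessian hθ hf om φ w v := by
  rw [hessian, hessian, kinetic_comm, inner_smoothMul, real_inner_comm,
    real_inner_comm (smoothMul _ _)]

theorem kinetic_add_left (u v w : HPer L (m / 2)) :
    kinetic hθ (u + v) w = kinetic hθ u w + kinetic hθ v w := by
  simp only [kinetic, map_add, inner_add_left, mul_add]

theorem hessian_add_left (u v w : HPer L (m / 2)) :
    hessian hθ hf om φ (u + v) w = hessian hθ hf om φ u w + hessian hθ hf om φ v w := by
  simp only [hessian, kinetic_add_left, ← smoothMulCLM_apply, map_add, inner_add_left]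
  ring

theorem hessian_add_self (v w : HPer L (m / 2)) :
    hessian hθ hf om φ (v + w) (v + w)
      = hessian hθ hf om φ v v + 2 * hessian hθ hf om φ v w + hessian hθ hf om φ w w := by
  rw [hessian_add_left, hessian_comm hθ hf om φ v (v + w), hessian_comm hθ hf om φ w (v + w),
    hessian_add_left, hessian_add_left, hessian_comm hθ hf om φ w v]
  ring

theorem continuous_hessian_self :
    Continuous fun v : HPer L (m / 2) => hessian hθ hf om φ v v := by
  have hm : 0 ≤ m / 2 := by have := hθ.pos; linarith
  have h : Continuous fun v : HPer L (m / 2) => kinetic hθ v v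
      + om * (L * inner ℝ (toL2CLM L hm v) (toL2CLM L hm v))
      - L * inner ℝ (smoothMulCLM (φ.comp (deriv f) (contDiff_deriv hf)) (toL2CLM L hm v))
        (toL2CLM L hm v) := by
    have := continuous_kinetic (L := L) hθ
    fun_prop
  exact h

theorem exists_abs_hessian_le : ∃ C, 0 ≤ C ∧ ∀ v w : HPer L (m / 2),
    |hessian hθ hf om φ v w| ≤ C * ‖v‖ * ‖w‖ := by
  have hL : 0 < L := Fact.out
  have hm : 0 ≤ m / 2 := by have := hθ.pos; linarith
  set J := besselPot L (m / 2)
  set S := mult L hθ.isRealSymbol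
  set I := toL2CLM L hm
  set F := smoothMulCLM (φ.comp (deriv f) (contDiff_deriv hf))
  refine ⟨L * (‖S‖ * ‖J‖ * ‖J‖) + |om| * (L * (‖I‖ * ‖I‖)) + L * (‖F‖ * ‖I‖ * ‖I‖), by positivity,
    fun v w => ?_⟩
  have h1 : |inner ℝ (S (J v)) (J w)| ≤ ‖S‖ * ‖J‖ * ‖J‖ * (‖v‖ * ‖w‖) := by
    refine (abs_real_inner_le_norm _ _).trans ?_
    calc ‖S (J v)‖ * ‖J w‖ ≤ (‖S‖ * (‖J‖ * ‖v‖)) * (‖J‖ * ‖w‖) := by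
          gcongr
          · exact S.le_opNorm_of_le (J.le_opNorm v)
          · exact J.le_opNorm w
      _ = _ := by ring
  have h2 : |inner ℝ (I v) (I w)| ≤ ‖I‖ * ‖I‖ * (‖v‖ * ‖w‖) := by
    refine (abs_real_inner_le_norm _ _).trans ?_
    calc ‖I v‖ * ‖I w‖ ≤ (‖I‖ * ‖v‖) * (‖I‖ * ‖w‖) := by
          gcongr
          · exact I.le_opNorm v
          · exact I.le_opNorm w
      _ = _ := by ring
  have h3 : |inner ℝ (F (I v)) (I w)| ≤ ‖F‖ * ‖I‖ * ‖I‖ * (‖v‖ * ‖w‖) := by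
    refine (abs_real_inner_le_norm _ _).trans ?_
    calc ‖F (I v)‖ * ‖I w‖ ≤ (‖F‖ * (‖I‖ * ‖v‖)) * (‖I‖ * ‖w‖) := by
          gcongr
          · exact F.le_opNorm_of_le (I.le_opNorm v)
          · exact I.le_opNorm w
      _ = _ := by ring
  have h4 : hessian hθ hf om φ v w = L * inner ℝ (S (J v)) (J w)
      + om * (L * inner ℝ (I v) (I w)) - L * inner ℝ (F (I v)) (I w) := rfl
  rw [h4]
  refine (abs_sub _ _).trans ((add_le_add_left (abs_add_le _ _) _).trans ?_)
  rw [abs_mul, abs_mul om, abs_mul, abs_mul, abs_of_pos hL]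
  calc _ ≤ L * (‖S‖ * ‖J‖ * ‖J‖ * (‖v‖ * ‖w‖)) + |om| * (L * (‖I‖ * ‖I‖ * (‖v‖ * ‖w‖)))
        + L * (‖F‖ * ‖I‖ * ‖I‖ * (‖v‖ * ‖w‖)) := by gcongr
    _ = _ := by ring

theorem inner_multiplier (v : HPer L m) (w : HPer L (m / 2)) (h : m / 2 ≤ m) :
    L * inner ℝ (multiplier hθ v) w.toL2 = kinetic hθ (v.incl h) w := by
  refine ((hasSum_inner_fc _ _).mul_left L).unique ((hasSum_kinetic hθ _ _).congr_fun
    fun n => ?_)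
  rw [fc_multiplier, HPer.toL2_incl, map_mul, Complex.conj_ofReal, mul_assoc,
    Complex.re_ofReal_mul]

/-- Transfers (H₁) and (H₂), stated for the operator on `H^m`, to the form on the energy space. -/
theorem pair_linOp (v : HPer L m) (h : m / 2 ≤ m) :
    pair (linOp hθ hf om φ v) v.toL2 = hessian hθ hf om φ (v.incl h) (v.incl h) := by
  rw [pair_eq_inner, linOp, inner_sub_left, inner_add_left, inner_smul_left, hessian,
    ← inner_multiplier hθ v (v.incl h) h, HPer.toL2_incl]
  simp
  ring

theorem SmoothPer.incl_toH {r s : ℝ} (h : r ≤ s) (g : SmoothPer L) : (g.toH s).incl h = g.toH r :=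
  HPer.ext_toL2 (by rw [HPer.toL2_incl, SmoothPer.toL2_toH, SmoothPer.toL2_toH])

variable {hθ hf om φ}

/-- Both sides are continuous in the `H^{m/2}` norm and smooth functions are dense. -/
theorem GardingCondition.hessian_le (H : GardingCondition (linOp hθ hf om φ)) :
    ∃ c₁ c₂ : ℝ, 0 < c₁ ∧ 0 < c₂ ∧ ∀ v : HPer L (m / 2),
      c₁ * ‖v‖ ^ 2 - c₂ * (L * ‖v.toL2‖ ^ 2) ≤ hessian hθ hf om φ v v := by
  have hm : 0 ≤ m / 2 := by have := hθ.pos; linarith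
  obtain ⟨c₁, c₂, h1, h2, h⟩ := H
  refine ⟨c₁, c₂, h1, h2, fun v => ?_⟩
  have hc : Continuous fun v : HPer L (m / 2) => c₁ * ‖v‖ ^ 2 - c₂ * (L * ‖v.toL2‖ ^ 2) := by
    have : Continuous fun v : HPer L (m / 2) => v.toL2 := (toL2CLM L hm).continuous
    fun_prop
  refine (HPer.dense_smooth (L := L) (m / 2)).induction_on v
    (isClosed_le hc (continuous_hessian_self hθ hf om φ)) fun g => ?_
  have h3 := h g
  rw [pair_self, ← SmoothPer.toL2_toH g m, pair_linOp hθ hf om φ _ (by linarith),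
    SmoothPer.incl_toH] at h3
  exact h3

theorem SmoothPer.fc_deriv_eq (g : SmoothPer L) (n : ℤ) :
    fc g.deriv.toL2 n = derivSymbol L n * fc g.toL2 n := g.fc_deriv n

/-- A case of `inner_superposition_deriv`. It makes the constraint directions φ' and Q'(φ)
orthogonal, so that they can be projected out independently. -/
theorem SmoothPer.inner_affine_deriv (g : SmoothPer L) (a b : ℝ) :
    inner ℝ (g.affine a b).toL2 g.deriv.toL2 = 0 := by
  have hlip : LipschitzWith ‖b‖₊ fun y : ℝ => a + b * y := by
    refine LipschitzWith.of_dist_le_mul fun x y => le_of_eq ?_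
    rw [Real.dist_eq, Real.dist_eq, add_sub_add_left_eq_sub, ← mul_sub, abs_mul, coe_nnnorm,
      Real.norm_eq_abs]
  have h1 := inner_superposition_deriv hlip g.fc_deriv_eq g.deriv.fc_deriv_eq
  have h2 : superposition hlip g.toL2 = (g.affine a b).toL2 := by
    ext1
    filter_upwards [superposition_ae hlip g.toL2, (g.affine a b).toL2_ae, g.toL2_ae] with x h3 h4 h5
    rw [h3, h4, circle_affine, h5]
  rwa [h2] at h1

/-- For the normalised measure the mean of v is its zeroth Fourier coefficient, which is how mass
enters `action` and `meanCharge`. -/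
theorem SmoothPer.inner_affine (g : SmoothPer L) (a b : ℝ) (v : L2per L) :
    inner ℝ (g.affine a b).toL2 v = a * (fc v 0).re + b * inner ℝ g.toL2 v := by
  have hv : Integrable (fun x => v x) AddCircle.haarAddCircle :=
    (Lp.memLp v).integrable (by norm_num)
  have h0 : (fc v 0).re = ∫ x, v x ∂AddCircle.haarAddCircle := by
    have : fc v 0 = ((∫ x, v x ∂AddCircle.haarAddCircle : ℝ) : ℂ) := by
      rw [fc, fcFun, fourierCoeff, ← integral_complex_ofReal]
      refine integral_congr_ae (Eventually.of_forall fun x => ?_)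
      simp
    rw [this, Complex.ofReal_re]
  rw [h0, inner_eq_integral, inner_eq_integral, ← integral_const_mul, ← integral_const_mul,
    ← integral_add (hv.const_mul a) ((integrable_inner_mul _ _).const_mul b)]
  refine integral_congr_ae ?_
  filter_upwards [(g.affine a b).toL2_ae, g.toL2_ae] with x h3 h4
  rw [h3, circle_affine, h4]
  ring

/-- Young's inequality for the cross term: positivity c on the component of size x survives adding a
component of size z, at the price of a multiple of z². -/
theorem coercive_add {c B x z n q p r : ℝ} (hc : 0 < c) (hn : 0 ≤ n) (hxz : n ≤ x + z)
    (hq : c * x ^ 2 ≤ q) (hp : -(B * x * z) ≤ p) (hr : -(B * z * z) ≤ r) :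
    c / 4 * n ^ 2 - (c / 2 + B + 2 * B ^ 2 / c) * z ^ 2 ≤ q + 2 * p + r := by
  have hnorm : n ^ 2 ≤ 2 * x ^ 2 + 2 * z ^ 2 := by
    refine (pow_le_pow_left₀ hn hxz 2).trans ?_
    nlinarith [sq_nonneg (x - z)]
  have hyoung : 2 * B * x * z ≤ c / 2 * x ^ 2 + 2 * B ^ 2 / c * z ^ 2 := by
    have h1 : c / 2 * x ^ 2 + 2 * B ^ 2 / c * z ^ 2 - 2 * B * x * z
        = (c * x - 2 * B * z) ^ 2 / (2 * c) := by
      field_simp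
      ring
    have h2 : 0 ≤ (c * x - 2 * B * z) ^ 2 / (2 * c) := by positivity
    linarith
  have h3 := mul_le_mul_of_nonneg_left hnorm (by positivity : 0 ≤ c / 4)
  linarith

/-- An unconstrained form of the coercivity of `𝓛`. -/
theorem exists_coercive {a b : ℝ} (H1 : GardingCondition (linOp hθ hf om φ))
    (H2 : CoercivityCondition (linOp hθ hf om φ) a b φ) :
    ∃ c C : ℝ, 0 < c ∧ 0 < C ∧ ∀ v : HPer L (m / 2),
      c * ‖v‖ ^ 2 - C * (inner ℝ v.toL2 φ.deriv.toL2 ^ 2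
        + inner ℝ v.toL2 (φ.affine a b).toL2 ^ 2) ≤ hessian hθ hf om φ v v := by
  have hL : 0 < L := Fact.out
  have hm : 0 ≤ m / 2 := by have := hθ.pos; linarith
  have hmm : m / 2 ≤ m := by linarith
  obtain ⟨c₁, c₂, hc₁, hc₂, hG⟩ := H1.hessian_le
  obtain ⟨c₃, hc₃, hK⟩ := H2
  obtain ⟨B, hB0, hB⟩ := exists_abs_hessian_le hθ hf om φ
  set χ := φ.deriv with hχ
  set ψ := φ.affine a b with hψ
  have horth : inner ℝ ψ.toL2 χ.toL2 = 0 := φ.inner_affine_deriv a b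
  -- The sum of c₃ times Gårding's inequality and c₂ times (H₂), in which the `L²` norms cancel.
  set c := c₁ * c₃ / (c₂ + c₃) with hc
  have hc0 : 0 < c := by positivity
  set D := 2 * (‖χ.toH (m / 2)‖ ^ 2 / (‖χ.toL2‖ ^ 2) ^ 2
    + ‖ψ.toH (m / 2)‖ ^ 2 / (‖ψ.toL2‖ ^ 2) ^ 2) with hD
  set E := c / 2 + B + 2 * B ^ 2 / c with hE
  have hE0 : 0 < E := by positivity
  refine ⟨c / 4, E * D + 1, by positivity, by positivity, fun v => ?_⟩
  have hcont : Continuous fun v : HPer L (m / 2) => c / 4 * ‖v‖ ^ 2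
      - (E * D + 1) * (inner ℝ v.toL2 χ.toL2 ^ 2 + inner ℝ v.toL2 ψ.toL2 ^ 2) := by
    have : Continuous fun v : HPer L (m / 2) => v.toL2 := (toL2CLM L hm).continuous
    fun_prop
  refine (HPer.dense_smooth (L := L) (m / 2)).induction_on v
    (isClosed_le hcont (continuous_hessian_self hθ hf om φ)) fun g => ?_
  rw [SmoothPer.toL2_toH]
  -- If χ or ψ vanishes, the quotient is 0 by convention and the projection identities `hα'`, `hβ'`
  -- still hold.
  set α := inner ℝ g.toL2 χ.toL2 / ‖χ.toL2‖ ^ 2 with hα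
  set β := inner ℝ g.toL2 ψ.toL2 / ‖ψ.toL2‖ ^ 2 with hβ
  have hα' : α * ‖χ.toL2‖ ^ 2 = inner ℝ g.toL2 χ.toL2 :=
    div_mul_cancel_of_imp fun h => by
      rw [norm_eq_zero.1 (pow_eq_zero_iff two_ne_zero |>.1 h), inner_zero_right]
  have hβ' : β * ‖ψ.toL2‖ ^ 2 = inner ℝ g.toL2 ψ.toL2 :=
    div_mul_cancel_of_imp fun h => by
      rw [norm_eq_zero.1 (pow_eq_zero_iff two_ne_zero |>.1 h), inner_zero_right]
  -- The component of g satisfying both constraints. It belongs to `H^m`, as (H₂) demands, because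
  -- g, χ and ψ are smooth; hence the reduction to smooth g.
  set w : HPer L m := g.toH m - α • χ.toH m - β • ψ.toH m with hw
  have hwL : w.toL2 = g.toL2 - α • χ.toL2 - β • ψ.toL2 := by
    rw [hw, HPer.toL2_sub, HPer.toL2_sub, HPer.toL2_smul, HPer.toL2_smul, SmoothPer.toL2_toH,
      SmoothPer.toL2_toH, SmoothPer.toL2_toH]
  have hw1 : inner ℝ w.toL2 χ.toL2 = 0 := by
    rw [hwL, inner_sub_left, inner_sub_left, real_inner_smul_left, real_inner_smul_left, horth,
      real_inner_self_eq_norm_sq, hα']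
    ring
  have hw2 : inner ℝ w.toL2 ψ.toL2 = 0 := by
    rw [hwL, inner_sub_left, inner_sub_left, real_inner_smul_left, real_inner_smul_left,
      real_inner_comm ψ.toL2 χ.toL2, horth, real_inner_self_eq_norm_sq, hβ']
    ring
  have hk := hK w (by rw [pair_eq_inner, hw1, mul_zero]) (by rw [pair_eq_inner, hw2, mul_zero])
  rw [pair_self, pair_linOp hθ hf om φ w hmm] at hk
  set x := w.incl hmm with hx
  have hg := hG x
  rw [hx, HPer.toL2_incl, ← hx] at hg
  have hqx : c * ‖x‖ ^ 2 ≤ hessian hθ hf om φ x x := by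
    rw [hc, div_mul_eq_mul_div, div_le_iff₀ (by positivity)]
    nlinarith
  set z : HPer L (m / 2) := α • χ.toH (m / 2) + β • ψ.toH (m / 2) with hz
  have hgz : g.toH (m / 2) = x + z := by
    apply HPer.ext_toL2
    rw [HPer.toL2_add, hx, HPer.toL2_incl, hwL, hz, HPer.toL2_add, HPer.toL2_smul,
      HPer.toL2_smul, SmoothPer.toL2_toH, SmoothPer.toL2_toH, SmoothPer.toL2_toH]
    abel
  have hzn : ‖z‖ ^ 2 ≤ D * (inner ℝ g.toL2 χ.toL2 ^ 2 + inner ℝ g.toL2 ψ.toL2 ^ 2) := by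
    have h1 : ‖z‖ ≤ |α| * ‖χ.toH (m / 2)‖ + |β| * ‖ψ.toH (m / 2)‖ := by
      refine (norm_add_le _ _).trans (le_of_eq ?_)
      rw [norm_smul, norm_smul, Real.norm_eq_abs, Real.norm_eq_abs]
    have h2 : ‖z‖ ^ 2 ≤ 2 * (α ^ 2 * ‖χ.toH (m / 2)‖ ^ 2 + β ^ 2 * ‖ψ.toH (m / 2)‖ ^ 2) := by
      refine (pow_le_pow_left₀ (norm_nonneg z) h1 2).trans ?_
      rw [← sq_abs α, ← sq_abs β]
      nlinarith [sq_nonneg (|α| * ‖χ.toH (m / 2)‖ - |β| * ‖ψ.toH (m / 2)‖)]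
    refine h2.trans ?_
    have h3 : α ^ 2 * ‖χ.toH (m / 2)‖ ^ 2
        = ‖χ.toH (m / 2)‖ ^ 2 / (‖χ.toL2‖ ^ 2) ^ 2 * inner ℝ g.toL2 χ.toL2 ^ 2 := by
      rw [hα, div_pow]
      ring
    have h4 : β ^ 2 * ‖ψ.toH (m / 2)‖ ^ 2
        = ‖ψ.toH (m / 2)‖ ^ 2 / (‖ψ.toL2‖ ^ 2) ^ 2 * inner ℝ g.toL2 ψ.toL2 ^ 2 := by
      rw [hβ, div_pow]
      ring
    rw [h3, h4, hD]
    have h5 : 0 ≤ ‖χ.toH (m / 2)‖ ^ 2 / (‖χ.toL2‖ ^ 2) ^ 2 * inner ℝ g.toL2 ψ.toL2 ^ 2 := by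
      positivity
    have h6 : 0 ≤ ‖ψ.toH (m / 2)‖ ^ 2 / (‖ψ.toL2‖ ^ 2) ^ 2 * inner ℝ g.toL2 χ.toL2 ^ 2 := by
      positivity
    linarith
  have hxz := (abs_le.1 (hB x z)).1
  have hzz := (abs_le.1 (hB z z)).1
  have hfin : c / 4 * ‖x + z‖ ^ 2 - E * ‖z‖ ^ 2 ≤ hessian hθ hf om φ (x + z) (x + z) := by
    rw [hessian_add_self]
    exact coercive_add hc0 (norm_nonneg _) (norm_add_le x z) hqx hxz hzz
  rw [hgz]
  have h1 := mul_le_mul_of_nonneg_left hzn hE0.le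
  have h2 : 0 ≤ inner ℝ g.toL2 χ.toL2 ^ 2 + inner ℝ g.toL2 ψ.toL2 ^ 2 := by positivity
  linarith

end Hessian

/-! ### The action as a Lyapunov functional. -/

section Lyapunov

variable {L : ℝ} [Fact (0 < L)]

/-- The action `E(u) + (ω/2) ‖u‖² + A ∫ u`, of which `φ` is a critical point. -/
def action {m : ℝ} {θ : ℝ → ℝ} (hθ : IsSymbol m θ) (f : ℝ → ℝ) (om A : ℝ)
    (u : HPer L (m / 2)) : ℝ :=
  energy hθ f u + om / 2 * (L * ‖u.toL2‖ ^ 2) + A * (L * (fc u.toL2 0).re)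

/-- `a û(0) + (b/2) ‖u‖²`, which is `Q` up to the factor `L`. -/
def meanCharge (a b : ℝ) (u : L2per L) : ℝ := a * (fc u 0).re + b / 2 * ‖u‖ ^ 2

variable {m : ℝ} {θ f : ℝ → ℝ} {hθ : IsSymbol m θ} {hf : ContDiff ℝ ∞ f} {om A : ℝ}
  {φ : SmoothPer L}

theorem meanCharge_add (a b : ℝ) (v : L2per L) :
    meanCharge a b (φ.toL2 + v) = meanCharge a b φ.toL2 + inner ℝ (φ.affine a b).toL2 v
      + b / 2 * ‖v‖ ^ 2 := by
  rw [meanCharge, meanCharge, fc_add, Complex.add_re, norm_add_sq_real, SmoothPer.inner_affine]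
  ring

/-- The terms linear in v sum to the travelling wave equation paired with v, hence vanish; the
quadratic ones form half of (𝓛v, v). -/
theorem action_add (hφ : IsTravellingWave hθ hf om A φ) (v : HPer L (m / 2)) :
    action hθ f om A (φ.toH (m / 2) + v) = action hθ f om A (φ.toH (m / 2))
      + hessian hθ hf om φ v v / 2 - potentialRem hf φ v.toL2 := by
  have hmm : m / 2 ≤ m := by have := hθ.pos; linarith
  have h1 : L * inner ℝ (multiplier hθ (φ.toH m) + om • φ.toL2 - (φ.comp f hf).toL2
      + (φ.affine A 0).toL2) v.toL2 = 0 := by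
    rw [show multiplier hθ (φ.toH m) + om • φ.toL2 - (φ.comp f hf).toL2 + (φ.affine A 0).toL2 = 0
      from hφ, inner_zero_left, mul_zero]
  rw [inner_add_left, inner_sub_left, inner_add_left, real_inner_smul_left,
    SmoothPer.inner_affine, mul_add, mul_sub, mul_add, inner_multiplier hθ (φ.toH m) v hmm,
    SmoothPer.incl_toH] at h1
  have h2 : kinetic hθ (φ.toH (m / 2) + v) (φ.toH (m / 2) + v)
      = kinetic hθ (φ.toH (m / 2)) (φ.toH (m / 2)) + 2 * kinetic hθ (φ.toH (m / 2)) v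
        + kinetic hθ v v := by
    rw [kinetic_add_left, kinetic_comm hθ _ (_ + v), kinetic_comm hθ v (_ + v), kinetic_add_left,
      kinetic_add_left, kinetic_comm hθ v (φ.toH _)]
    ring
  rw [action, action, energy, energy, h2, HPer.toL2_add, SmoothPer.toL2_toH, norm_add_sq_real,
    fc_add, Complex.add_re, potentialRem, hessian, real_inner_self_eq_norm_sq]
  linarith

/-- Coercivity bounds c‖v‖² by (𝓛v, v) and (v, Q'(φ))². The former is twice the increment of the
action up to o(‖v‖²), the latter the squared increment of the charge up to O(‖v‖⁴); small v absorbs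
both errors. -/
theorem exists_norm_sq_le {a b : ℝ} (hE : m ≤ 1 → PotentialIsC2 L f (m / 2))
    (hφ : IsTravellingWave hθ hf om A φ)
    (H1 : GardingCondition (linOp hθ hf om φ))
    (H2 : CoercivityCondition (linOp hθ hf om φ) a b φ) :
    ∃ ρ C : ℝ, 0 < ρ ∧ 0 < C ∧ ∀ v : HPer L (m / 2), ‖v‖ < ρ →
      inner ℝ v.toL2 φ.deriv.toL2 = 0 →
      ‖v‖ ^ 2 ≤ C * (|action hθ f om A (φ.toH (m / 2) + v) - action hθ f om A (φ.toH (m / 2))|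
        + (meanCharge a b (φ.toL2 + v.toL2) - meanCharge a b φ.toL2) ^ 2) := by
  have hL : 0 < L := Fact.out
  have hm : 0 ≤ m / 2 := by have := hθ.pos; linarith
  obtain ⟨c, C, hc, hC, hq⟩ := exists_coercive H1 H2
  obtain ⟨δ, hδ, hrem⟩ := exists_abs_potentialRem_le_sobolev hθ.pos hf hE φ
    (η := c / 8) (by positivity)
  -- Chosen so that ‖v‖² < τ puts the quartic term below (c/4)‖v‖². The Taylor remainder, with η =
  -- c/8 and doubled, takes another c/4, so c/2 remains.
  set τ := c * L ^ 2 / (2 * C * (b ^ 2 + 1)) with hτ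
  have hτ0 : 0 < τ := by positivity
  refine ⟨min δ √τ, 4 / c * (1 + C), by positivity, by positivity, fun v hv horth => ?_⟩
  have h1 := hq v
  have h2 := (abs_le.1 (hrem v (hv.trans_le (min_le_left _ _)))).2
  have h3 := action_add (hθ := hθ) hφ v
  have h4 := meanCharge_add (φ := φ) a b v.toL2
  set dG := action hθ f om A (φ.toH (m / 2) + v) - action hθ f om A (φ.toH (m / 2)) with hdG
  set dM := meanCharge a b (φ.toL2 + v.toL2) - meanCharge a b φ.toL2 with hdM
  have h5 : inner ℝ v.toL2 (φ.affine a b).toL2 = dM - b / 2 * ‖v.toL2‖ ^ 2 := by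
    rw [real_inner_comm]
    linarith
  rw [horth, h5] at h1
  have h6 : ‖v‖ ^ 2 < τ := by
    have := hv.trans_le (min_le_right _ _)
    rwa [Real.lt_sqrt (norm_nonneg _)] at this
  have h7 : ‖v.toL2‖ ^ 2 ≤ L⁻¹ * ‖v‖ ^ 2 := by
    have := pow_le_pow_left₀ (norm_nonneg _) (v.norm_toL2_le hm) 2
    rwa [mul_pow, inv_pow, Real.sq_sqrt hL.le] at this
  have h8 : (dM - b / 2 * ‖v.toL2‖ ^ 2) ^ 2 ≤ 2 * dM ^ 2 + b ^ 2 / 2 * (‖v.toL2‖ ^ 2) ^ 2 := by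
    nlinarith [sq_nonneg (dM + b / 2 * ‖v.toL2‖ ^ 2)]
  have h9 : C * (b ^ 2 / 2 * (‖v.toL2‖ ^ 2) ^ 2) ≤ c / 4 * ‖v‖ ^ 2 := by
    calc C * (b ^ 2 / 2 * (‖v.toL2‖ ^ 2) ^ 2)
        ≤ C * ((b ^ 2 + 1) / 2 * (L⁻¹ * ‖v‖ ^ 2) ^ 2) := by
          gcongr
          linarith
      _ = C * (b ^ 2 + 1) / (2 * L ^ 2) * ‖v‖ ^ 2 * ‖v‖ ^ 2 := by
          field_simp
      _ ≤ C * (b ^ 2 + 1) / (2 * L ^ 2) * τ * ‖v‖ ^ 2 := by gcongr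
      _ = c / 4 * ‖v‖ ^ 2 := by
          rw [hτ]
          field_simp
          ring
  have h10 := mul_le_mul_of_nonneg_left h8 hC.le
  have h11 : c / 4 * ‖v‖ ^ 2 ≤ |dG| + C * dM ^ 2 := by
    have := le_abs_self dG
    nlinarith
  have h12 : |dG| + C * dM ^ 2 ≤ (1 + C) * (|dG| + dM ^ 2) := by
    have := mul_nonneg hC.le (abs_nonneg dG)
    nlinarith [sq_nonneg dM]
  calc ‖v‖ ^ 2 = 4 / c * (c / 4 * ‖v‖ ^ 2) := by field_simp
    _ ≤ 4 / c * ((1 + C) * (|dG| + dM ^ 2)) :=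
      mul_le_mul_of_nonneg_left (h11.trans h12) (by positivity)
    _ = _ := by ring

theorem continuous_action (hf : ContDiff ℝ ∞ f) (hE : m ≤ 1 → PotentialIsC2 L f (m / 2)) :
    Continuous (action (L := L) hθ f om A) := by
  have hm : 0 ≤ m / 2 := by have := hθ.pos; linarith
  have h1 : Continuous fun v : HPer L (m / 2) => v.toL2 := (toL2CLM L hm).continuous
  have h2 : Continuous fun v : HPer L (m / 2) => fc v.toL2 0 := (fcCLM 0).continuous.comp h1
  have h3 : Continuous fun v : HPer L (m / 2) => (fc v.toL2 0).re :=
    Complex.continuous_re.comp h2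
  have h4 := continuous_energy (L := L) hθ hf hE
  unfold action
  fun_prop

theorem continuous_meanCharge (a b : ℝ) : Continuous (meanCharge (L := L) a b) := by
  have h2 : Continuous fun v : L2per L => fc v 0 := (fcCLM 0).continuous
  have h3 : Continuous fun v : L2per L => (fc v 0).re := Complex.continuous_re.comp h2
  unfold meanCharge
  fun_prop

theorem fc_trans_zero (r : ℝ) (u : L2per L) : fc (trans L r u) 0 = fc u 0 := by
  rw [fc_trans, fourier_zero, one_mul]

theorem action_trans (r : ℝ) (u : HPer L (m / 2)) :
    action hθ f om A (u.trans r) = action hθ f om A u := by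
  rw [action, action, energy_trans, HPer.toL2_trans, norm_trans, fc_trans_zero]

theorem meanCharge_trans (a b r : ℝ) (u : L2per L) :
    meanCharge a b (trans L r u) = meanCharge a b u := by
  rw [meanCharge, meanCharge, norm_trans, fc_trans_zero]

end Lyapunov

/-! ### Distance to the orbit and choice of the translate. -/

section Modulation

variable {L : ℝ} [Fact (0 < L)]

theorem bddBelow_orbit {r : ℝ} (v : HPer L r) (φ : SmoothPer L) :
    BddBelow (range fun ρ : ℝ => ‖v - (φ.translate ρ).toH r‖) :=
  ⟨0, by rintro _ ⟨ρ, rfl⟩; exact norm_nonneg _⟩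

theorem orbitDist_le {r : ℝ} (v : HPer L r) (φ : SmoothPer L) (ρ : ℝ) :
    orbitDist v φ ≤ ‖v - (φ.toH r).trans ρ‖ := by
  rw [← SmoothPer.toH_translate]
  exact ciInf_le (bddBelow_orbit v φ) ρ

theorem continuous_orbitDist {r : ℝ} (φ : SmoothPer L) :
    Continuous fun v : HPer L r => orbitDist v φ := by
  refine (LipschitzWith.of_le_add fun v w => ?_ : LipschitzWith 1 _).continuous
  rw [← sub_le_iff_le_add]
  refine le_ciInf fun ρ => ?_
  rw [sub_le_iff_le_add, dist_eq_norm]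
  refine (ciInf_le (bddBelow_orbit v φ) ρ).trans ?_
  have h := norm_add_le (w - (φ.translate ρ).toH r) (v - w)
  rwa [add_comm (w - _), sub_add_sub_cancel] at h

theorem trans_add_period (r : ℝ) (u : L2per L) : trans L (r + L) u = trans L r u := by
  refine ext_fc fun n => ?_
  rw [fc_trans, fc_trans, AddCircle.coe_add_period]

theorem SmoothPer.hasDerivAt_trans (g : SmoothPer L) (r : ℝ) :
    HasDerivAt (fun r => trans L r g.toL2) (trans L r g.deriv.toL2) r :=
  PerWave.hasDerivAt_trans g.fc_deriv_eq g.deriv.fc_deriv_eq r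

/-- The `L²`-closest translate of `φ`. -/
theorem exists_closest_translate (φ : SmoothPer L) (u : L2per L) :
    ∃ r : ℝ, inner ℝ u (trans L r φ.deriv.toL2) = 0 ∧
      ∀ t : ℝ, ‖u - trans L r φ.toL2‖ ≤ ‖u - trans L t φ.toL2‖ := by
  have hL : 0 < L := Fact.out
  -- All translates of φ have the same norm, so the closest one maximises this periodic function,
  -- and the critical point equation is orthogonality to the translate of φ'.
  set k : ℝ → ℝ := fun r => inner ℝ u (trans L r φ.toL2) with hk
  have hd : ∀ r, HasDerivAt k (inner ℝ u (trans L r φ.deriv.toL2)) r := fun r =>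
    (innerSL ℝ u).hasFDerivAt.comp_hasDerivAt r (φ.hasDerivAt_trans r)
  have hkc : Continuous k := continuous_iff_continuousAt.2 fun r => (hd r).continuousAt
  have hper : Function.Periodic k L := fun r => by
    rw [hk]
    simp only [trans_add_period]
  obtain ⟨r, _, hr⟩ := isCompact_Icc.exists_isMaxOn (nonempty_Icc.2 hL.le) hkc.continuousOn
  have hmax : ∀ t, k t ≤ k r := fun t => by
    obtain ⟨y, hy, hty⟩ := hper.exists_mem_Ico₀ hL t
    rw [hty]
    exact hr (Ico_subset_Icc_self hy)
  refine ⟨r, (IsLocalMax.hasDerivAt_eq_zero (Eventually.of_forall hmax) (hd r)), fun t => ?_⟩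
  refine le_of_sq_le_sq ?_ (norm_nonneg _)
  rw [norm_sub_sq_real, norm_sub_sq_real, norm_trans, norm_trans]
  have := hmax t
  simp only [hk] at this
  linarith

/-- Orthogonality singles out the `L²`-closest translate, whereas the orbit distance supplies one
close in `H^{m/2}`. Their difference is small in `L²` and bounded in `H^m`, hence small in `H^{m/2}`
by interpolation. -/
theorem exists_modulation {m : ℝ} (hm : 0 < m) (φ : SmoothPer L) {ρ : ℝ} (hρ : 0 < ρ) :
    ∃ ρ₁ > 0, ∀ u : HPer L (m / 2), orbitDist u φ < ρ₁ → ∃ r : ℝ,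
      inner ℝ (u.trans (-r) - φ.toH (m / 2)).toL2 φ.deriv.toL2 = 0 ∧
      ‖u.trans (-r) - φ.toH (m / 2)‖ < ρ ∧
      orbitDist u φ ≤ ‖u.trans (-r) - φ.toH (m / 2)‖ := by
  have hL : 0 < √L := Real.sqrt_pos.2 Fact.out
  have hm2 : 0 ≤ m / 2 := by linarith
  set N := ‖φ.toH m‖ with hN
  have hN0 : 0 ≤ N := norm_nonneg _
  -- With e the distance to the nearly optimal translate, interpolation gives ‖z‖² ≤ 4eN < (ρ/2)²;
  -- the other half of ρ is for e itself.
  refine ⟨min (ρ / 2) (ρ ^ 2 / (16 * (N + 1))), by positivity, fun u hu => ?_⟩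
  obtain ⟨t, ht⟩ := exists_lt_of_ciInf_lt hu
  rw [SmoothPer.toH_translate] at ht
  obtain ⟨r, hr1, hr2⟩ := exists_closest_translate φ u.toL2
  have hback : ∀ s : ℝ, ‖u.trans (-s) - φ.toH (m / 2)‖ = ‖u - (φ.toH (m / 2)).trans s‖ :=
      fun s => by
    rw [← HPer.norm_trans s, HPer.trans_sub, HPer.trans_trans, add_neg_cancel, HPer.trans_zero]
  have horth : inner ℝ φ.toL2 φ.deriv.toL2 = 0 := by
    have h1 := φ.inner_affine_deriv 0 1
    rw [SmoothPer.inner_affine] at h1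
    linarith
  refine ⟨r, ?_, ?_, ?_⟩
  · rw [HPer.toL2_sub, inner_sub_left, SmoothPer.toL2_toH, horth, sub_zero, HPer.toL2_trans,
      ← inner_trans_trans r, trans_trans, add_neg_cancel, trans_zero, hr1]
  · rw [hback]
    set zm : HPer L m := (φ.toH m).trans r - (φ.toH m).trans t with hzm
    set z : HPer L (m / 2) := (φ.toH (m / 2)).trans r - (φ.toH (m / 2)).trans t with hz
    have hzz : z.toL2 = zm.toL2 := by
      rw [hz, hzm, HPer.toL2_sub, HPer.toL2_sub, HPer.toL2_trans, HPer.toL2_trans,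
        HPer.toL2_trans, HPer.toL2_trans, SmoothPer.toL2_toH, SmoothPer.toL2_toH]
    have h1 := HPer.norm_sq_le_of_half zm z hzz
    have h2 : ‖zm‖ ≤ 2 * N := by
      refine (norm_sub_le _ _).trans (le_of_eq ?_)
      rw [HPer.norm_trans, HPer.norm_trans]
      ring
    have h3 : ‖u.toL2 - trans L t φ.toL2‖ ≤ (√L)⁻¹ * ‖u - (φ.toH (m / 2)).trans t‖ := by
      have := (u - (φ.toH (m / 2)).trans t).norm_toL2_le hm2
      rwa [HPer.toL2_sub, HPer.toL2_trans, SmoothPer.toL2_toH] at this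
    have h4 : ‖zm.toL2‖ ≤ 2 * ((√L)⁻¹ * ‖u - (φ.toH (m / 2)).trans t‖) := by
      have h5 : zm.toL2 = (u.toL2 - trans L t φ.toL2) - (u.toL2 - trans L r φ.toL2) := by
        rw [hzm, HPer.toL2_sub, HPer.toL2_trans, HPer.toL2_trans, SmoothPer.toL2_toH]
        abel
      rw [h5]
      refine (norm_sub_le _ _).trans ?_
      linarith [hr2 t]
    set e := ‖u - (φ.toH (m / 2)).trans t‖ with he
    have he0 : 0 ≤ e := norm_nonneg _
    have h6 : ‖z‖ ^ 2 ≤ 4 * e * N := by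
      refine h1.trans ?_
      calc √L * ‖zm.toL2‖ * ‖zm‖ ≤ √L * (2 * ((√L)⁻¹ * e)) * (2 * N) := by gcongr
        _ = √L * (√L)⁻¹ * (4 * e * N) := by ring
        _ = _ := by rw [mul_inv_cancel₀ hL.ne', one_mul]
    have h7 : e * (16 * (N + 1)) < ρ ^ 2 :=
      (lt_div_iff₀ (by positivity)).1 (ht.trans_le (min_le_right _ _))
    have h8 : ‖z‖ < ρ / 2 := by
      refine lt_of_pow_lt_pow_left₀ 2 (by positivity) ?_
      nlinarith
    have h9 : u - (φ.toH (m / 2)).trans r = (u - (φ.toH (m / 2)).trans t) - z := by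
      rw [hz]
      abel
    rw [h9]
    have h10 : e < ρ / 2 := ht.trans_le (min_le_left _ _)
    exact (norm_sub_le _ _).trans_lt (by linarith)
  · rw [hback]
    exact orbitDist_le u φ r

end Modulation

/-! ### Stability by continuity in time. -/

/-- Orbital stability from coercivity of the linearised operator and the conservation laws. -/
theorem orbitallyStable_of_coercive {L : ℝ} [Fact (0 < L)] {m : ℝ} {θ f : ℝ → ℝ}
    {hθ : IsSymbol m θ} {hf : ContDiff ℝ ∞ f} (hE : m ≤ 1 → PotentialIsC2 L f (m / 2))
    {om A a b : ℝ} {φ : SmoothPer L} (hφ : IsTravellingWave hθ hf om A φ)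
    (H1 : GardingCondition (linOp hθ hf om φ))
    (H2 : CoercivityCondition (linOp hθ hf om φ) a b φ) : OrbitallyStable m θ f φ := by
  intro ε hε
  have hm : 0 ≤ m / 2 := by have := hθ.pos; linarith
  obtain ⟨ρ, C, hρ, hC, hlyap⟩ := exists_norm_sq_le hE hφ H1 H2
  obtain ⟨ρ₁, hρ₁, hmod⟩ := exists_modulation hθ.pos φ hρ
  -- Strictly below ρ₁, so that a function at orbit distance exactly ε' is still in the range of
  -- modulation.
  set ε' := min ε (ρ₁ / 2) with hε'
  have hε'0 : 0 < ε' := lt_min hε (by linarith)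
  have hε'1 : ε' < ρ₁ := (min_le_right _ _).trans_lt (by linarith)
  set Φ : HPer L (m / 2) → ℝ := fun u =>
    C * (|action hθ f om A u - action hθ f om A (φ.toH (m / 2))|
      + (meanCharge a b u.toL2 - meanCharge a b φ.toL2) ^ 2) with hΦ
  have hΦc : Continuous Φ := by
    have h1 := continuous_action (L := L) (hθ := hθ) (om := om) (A := A) hf hE
    have h2 : Continuous fun u : HPer L (m / 2) => meanCharge a b u.toL2 :=
      (continuous_meanCharge a b).comp (toL2CLM L hm).continuous
    fun_prop
  have hΦ0 : Φ (φ.toH (m / 2)) = 0 := by simp [hΦ, SmoothPer.toL2_toH]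
  -- Within distance ρ₁ of the orbit, Φ bounds the squared distance; its translation invariance
  -- permits evaluation at u rather than at the modulated function.
  have hstep : ∀ u : HPer L (m / 2), orbitDist u φ < ρ₁ → Φ u < ε' ^ 2 → orbitDist u φ < ε' :=
    fun u hu hΦu => by
      obtain ⟨r, hr1, hr2, hr3⟩ := hmod u hu
      refine hr3.trans_lt (lt_of_pow_lt_pow_left₀ 2 hε'0.le ?_)
      refine (hlyap _ hr2 hr1).trans_lt ?_
      rw [← SmoothPer.toL2_toH φ (m / 2), ← HPer.toL2_add, add_sub_cancel, action_trans,
        HPer.toL2_trans, meanCharge_trans]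
      exact hΦu
  have hnear : ∀ᶠ u in 𝓝 (φ.toH (m / 2)), Φ u < ε' ^ 2 := by
    refine hΦc.continuousAt.eventually_lt continuousAt_const ?_
    rw [hΦ0]
    positivity
  -- Φ is a functional on `H^{m/2}`, so δ is fixed before s is introduced.
  obtain ⟨δ, hδ, hball⟩ := Metric.eventually_nhds_iff.1 hnear
  refine ⟨min δ ε', lt_min hδ hε'0, fun s hs hwp u₀ hu₀ => ⟨hwp.existence u₀, ?_⟩⟩
  intro u hu hu0 t ht
  have hΦt : ∀ τ, 0 ≤ τ → Φ ((u τ).incl hs) < ε' ^ 2 := fun τ hτ => by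
    have h1 : Φ ((u τ).incl hs) = Φ (u₀.incl hs) := by
      obtain ⟨h2, h3⟩ := hu.conservation hθ hf hE hs hwp hτ
      have h4 := hu.fc_zero_eq hτ
      simp only [hΦ, action, meanCharge, HPer.toL2_incl, h2, h3, h4, hu0]
    rw [h1]
    refine hball ?_
    rw [dist_eq_norm]
    exact hu₀.trans_le (min_le_left _ _)
  set D : ℝ → ℝ := fun τ => orbitDist ((u τ).incl hs) φ with hD
  have hDc : ContinuousOn D (Icc 0 t) :=
    ((continuous_orbitDist φ).comp (inclCLM L hs).continuous).comp_continuousOn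
      (hu.continuous.mono Icc_subset_Ici_self)
  have hD0 : D 0 < ε' := by
    have h1 := orbitDist_le ((u 0).incl hs) φ 0
    rw [HPer.trans_zero, hu0] at h1
    rw [hD]
    simp only [hu0]
    exact h1.trans_lt (hu₀.trans_le (min_le_right _ _))
  have hDt : D t < ε' := by
    -- Otherwise the distance equals ε' at some time; as Φ is still below ε'² then, `hstep` makes
    -- the distance strictly smaller than ε'.
    by_contra! hcon
    obtain ⟨τ, hτ, hDτ⟩ := intermediate_value_Icc ht hDc ⟨hD0.le, hcon⟩
    have h1 := hstep ((u τ).incl hs) (lt_of_eq_of_lt hDτ hε'1) (hΦt τ hτ.1)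
    exact h1.ne hDτ
  exact hDt.trans_le (min_le_left _ _)

end PerWave

end

theorem theorem3p1 (L : ℝ) [Fact (0 < L)] (m : ℝ) (θ f : ℝ → ℝ)
    (hθ : PerWave.IsSymbol m θ) (hf : ContDiff ℝ ∞ f)
    (hE : m ≤ 1 → PerWave.PotentialIsC2 L f (m / 2))
    (om A a b : ℝ) (hab : a ≠ 0 ∨ b ≠ 0) (φ : PerWave.SmoothPer L)
    (hφ : PerWave.IsTravellingWave hθ hf om A φ)
    (H0 : PerWave.SpectralCondition (PerWave.linOp hθ hf om φ) φ)
    (H1 : PerWave.GardingCondition (PerWave.linOp (L := L) hθ hf om φ))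
    (H2 : PerWave.CoercivityCondition (PerWave.linOp hθ hf om φ) a b φ)
    (hwp : ∃ s : ℝ, m / 2 ≤ s ∧ PerWave.GloballyWellPosed L θ f s) :
    PerWave.OrbitallyStable m θ f φ :=
  PerWave.orbitallyStable_of_coercive hE hφ H1 H2
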